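/- Let $h_-<h_+$ and let $\Omega=\{x\in\mathbb R^3: h_-<x_3<h_+\}$. Let $X:A\to\Omega$, $A=\{z\in\mathbb C: R_0<|z|<R_1\}$, $0<R_0<R_1<\infty$, be a proper conformal harmonic immersion (an immersed minimal annulus $\Sigma$ in the slab $\Omega$). Areas and lengths on $\Sigma$ are those of the parameterization $X$, i.e. counted with multiplicity; $\mathrm{Area}(\Sigma)=\infty$ is allowed. Assume: * the flux $\mathrm{Flux}(\Sigma)=\int_{X(\{|z|=r\})}\nu\,ds$ ($\nu$ the unit conormal along the curve; the value does not depend on $r\in(R_0,R_1)$) is vertical, $\mathrm{Flux}(\Sigma)=(0,0,F_3)$; * the Gauss map of $X$, composed with stereographic projection from the north pole, takes nonzero finite values on a circle $|z|=r$, $r\in(R_0,R_1)$, and has winding number $0$ around the origin along it. For $h\in(h_-,h_+)$ let $\ell_\Sigma(h)$ be the length of the level curve of $\Sigma$ at height $h$: $\ell_\Sigma(h)$ is the length of $X(\{|z|=r_h\})$, where $\{z\in A: x_3(X(z))=h\}=\{|z|=r_h\}$ (and $\ell_\Sigma(h)=\infty$ if there is no such $r_h$). Put $\ell_\Sigma(h_\pm)=\liminf_{h\to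 h_\pm}\ell_\Sigma(h)$. 1. Let $h_0\in[h_-,h_+]$ satisfy $\ell_\Sigma(h_0)=\inf_{h\in(h_-,h_+)}\ell_\Sigma(h)$. Let $C$ be the part in $\Omega$ of a complete vertical catenoid $(x_1-p)^2+(x_2-q)^2=c^2\cosh^2\big((x_3-h_0)/c\big)$, $c>0$, which is symmetric with respect to the plane $\{x_3=h_0\}$, and suppose that $C$ has the same flux as $\Sigma$ up to the choice of orientation: $\mathrm{Flux}(C)=(0,0,|F_3|)$ for the conormal pointing upwards. Then $$\mathrm{Area}(\Sigma)>\mathrm{Area}(C).$$ 2. Let $C_\Omega$ be the maximally symmetric marginally stable catenoid waist of $\Omega$, that is, the part in $\Omega$ of a vertical catenoid $(x_1-p)^2+(x_2-q)^2=c^2\cosh^2\big((x_3-m)/c\big)$, $c>0$, $m=\tfrac12(h_-+h_+)$, such that along its two boundary circles the rays from the center $(p,q,m)$ are tangent to the catenoid. Then $$\mathrm{Area}(\Sigma)>\mathrm{Area}(C_\Omega).$$ -/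

import Mathlib

open Set Filter Topology MeasureTheory
open scoped ENNReal

/-- Euclidean three-space, with coordinates `x 0`, `x 1`, `x 2` (the last one is the height). -/
abbrev E3 : Type := EuclideanSpace ℝ (Fin 3)

/-- The open annulus `R₀ < |z| < R₁` in the complex plane. -/
def annulus (R₀ R₁ : ℝ) : Set ℂ := {z | R₀ < ‖z‖ ∧ ‖z‖ < R₁}

/-- The open horizontal slab `h₋ < x₃ < h₊`. -/
def slab (hm hp : ℝ) : Set E3 := {x | hm < x 2 ∧ x 2 < hp}

/-- The point of the plane with polar coordinates `r`, `θ`. -/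
noncomputable def polarPt (r θ : ℝ) : ℂ := (r : ℂ) * Complex.exp ((θ : ℂ) * Complex.I)

/-- The vector (cross) product of `ℝ³`. -/
def cross3 (a b : E3) : E3 :=
  !₂[a 1 * b 2 - a 2 * b 1, a 2 * b 0 - a 0 * b 2, a 0 * b 1 - a 1 * b 0]

/-- The partial derivative `∂X/∂x` with respect to `z = x + i y`. -/
noncomputable def partialX (X : ℂ → E3) (z : ℂ) : E3 := fderiv ℝ X z 1

/-- The partial derivative `∂X/∂y` with respect to `z = x + i y`. -/
noncomputable def partialY (X : ℂ → E3) (z : ℂ) : E3 := fderiv ℝ X z Complex.I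

/-- `X` restricted to the annulus `R₀ < |z| < R₁` is a proper conformal harmonic immersion into the
open slab `h₋ < x₃ < h₊`. `ConformalAt` says that the derivative is a nonzero multiple of a linear
isometry; `proper` says that preimages of compact subsets of the slab are compact, so that the
limit points of the surface which are not on it lie on the two boundary planes. -/
structure IsMinimalAnnulus (hm hp R₀ R₁ : ℝ) (X : ℂ → E3) : Prop where
  inner_pos : 0 < R₀
  inner_lt_outer : R₀ < R₁
  mapsTo : MapsTo X (annulus R₀ R₁) (slab hm hp)
  harmonic : InnerProductSpace.HarmonicOnNhd X (annulus R₀ R₁)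
  conformal : ∀ z ∈ annulus R₀ R₁, ConformalAt X z
  proper : ∀ K : Set E3, IsCompact K → K ⊆ slab hm hp → IsCompact (annulus R₀ R₁ ∩ X ⁻¹' K)

/-- The area (with multiplicity, possibly infinite) of the surface parameterized by `X` on the
annulus: the integral of `|∂X/∂x × ∂X/∂y|`. -/
noncomputable def surfaceArea (R₀ R₁ : ℝ) (X : ℂ → E3) : ℝ≥0∞ :=
  ∫⁻ z in annulus R₀ R₁, ‖cross3 (partialX X z) (partialY X z)‖ₑ

/-- The velocity `∂X/∂θ` of the image of the circle of radius `r`. -/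
noncomputable def angularDeriv (X : ℂ → E3) (r θ : ℝ) : E3 := deriv (fun t => X (polarPt r t)) θ

/-- The radial derivative `∂X/∂r`. -/
noncomputable def radialDeriv (X : ℂ → E3) (r θ : ℝ) : E3 := deriv (fun s => X (polarPt s θ)) r

/-- The length `L(r)` (with multiplicity) of the image of the circle `|z| = r`. -/
noncomputable def circleLength (X : ℂ → E3) (r : ℝ) : ℝ≥0∞ :=
  ∫⁻ θ in Ioc 0 (2 * Real.pi), ‖angularDeriv X r θ‖ₑ

/-- The flux `∫ ν ds` through the image of the circle `|z| = r`. As `X` is conformal, the unit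
conormal pointing away from the inner boundary is `ν = ∂X/∂r / |∂X/∂r|`; and `ds = |∂X/∂θ| dθ`. -/
noncomputable def circleFlux (X : ℂ → E3) (r : ℝ) : E3 :=
  ∫ θ in (0 : ℝ)..(2 * Real.pi),
    ‖angularDeriv X r θ‖ • (‖radialDeriv X r θ‖⁻¹ • radialDeriv X r θ)

/-- The flux vector of the minimal annulus is `v`. It is computed on a circle `|z| = r`, which
generates the first homology; the choice of `r` is immaterial. -/
def HasFlux (R₀ R₁ : ℝ) (X : ℂ → E3) (v : E3) : Prop :=
  ∃ r ∈ Ioo R₀ R₁, circleFlux X r = v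

/-- The unit normal of the surface. -/
noncomputable def unitNormal (X : ℂ → E3) (z : ℂ) : E3 :=
  ‖cross3 (partialX X z) (partialY X z)‖⁻¹ • cross3 (partialX X z) (partialY X z)

/-- The Gauss map, viewed as a complex function by stereographic projection from the north pole. -/
noncomputable def gaussMap (X : ℂ → E3) (z : ℂ) : ℂ :=
  ((unitNormal X z 0 : ℂ) + (unitNormal X z 1 : ℂ) * Complex.I) / (1 - (unitNormal X z 2 : ℂ))

/-- The loop `γ : [0, 2π] → ℂ \ {0}` has winding number `k` around the origin: a continuous branch
of its argument increases by `2πk`. -/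
def HasWindingNumber (γ : ℝ → ℂ) (k : ℤ) : Prop :=
  ∃ a : ℝ → ℝ, ContinuousOn a (Icc 0 (2 * Real.pi)) ∧
    (∀ θ ∈ Icc 0 (2 * Real.pi),
      γ θ ≠ 0 ∧ γ θ = (‖γ θ‖ : ℂ) * Complex.exp ((a θ : ℂ) * Complex.I)) ∧
    a (2 * Real.pi) - a 0 = 2 * Real.pi * k

/-- The Gauss map of the annulus has winding number `k`: its restriction to a circle `|z| = r`,
which generates the fundamental group of the annulus, winds `k` times around the origin; the choice
of `r` is immaterial. -/
def HasGaussWinding (R₀ R₁ : ℝ) (X : ℂ → E3) (k : ℤ) : Prop :=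
  ∃ r ∈ Ioo R₀ R₁, HasWindingNumber (fun θ => gaussMap X (polarPt r θ)) k

/-- The length `ℓ(h)` of the level curve at height `h`: it is `L(r)` for the radius `r` with
`{z | x₃(X(z)) = h} = {z | |z| = r}` (there is exactly one when the height tends to `h₋` at one end
of the annulus and to `h₊` at the other; if there is none, the value is `∞`). -/
noncomputable def levelLength (R₀ R₁ : ℝ) (X : ℂ → E3) (h : ℝ) : ℝ≥0∞ :=
  ⨅ (r : ℝ) (_ : r ∈ Ioo R₀ R₁ ∧ {z | z ∈ annulus R₀ R₁ ∧ X z 2 = h} = Metric.sphere (0 : ℂ) r),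
    circleLength X r

/-- The level length, extended to the closed interval `[h₋, h₊]` by lower limits at the ends. -/
noncomputable def levelLengthExt (hm hp R₀ R₁ : ℝ) (X : ℂ → E3) (h : ℝ) : ℝ≥0∞ :=
  if h = hm then liminf (levelLength R₀ R₁ X) (𝓝[>] hm)
  else if h = hp then liminf (levelLength R₀ R₁ X) (𝓝[<] hp)
  else levelLength R₀ R₁ X h

/-- The plane `{x₃ = h₀}` in the closed slab is one where the level length is smallest. -/
def IsShortestLevel (hm hp R₀ R₁ : ℝ) (X : ℂ → E3) (h₀ : ℝ) : Prop :=
  h₀ ∈ Icc hm hp ∧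
    levelLengthExt hm hp R₀ R₁ X h₀ = ⨅ h ∈ Ioo hm hp, levelLength R₀ R₁ X h

/-- The complete vertical catenoid `(x₁-p)² + (x₂-q)² = c² cosh²((x₃-h₀)/c)`, which is symmetric
with respect to the plane `{x₃ = h₀}`, parameterized conformally on `ℂ \ {0}` by
`x₁ + i x₂ = p + i q + c cosh(log |z|) z / |z|`, `x₃ = h₀ + c log |z|`. -/
noncomputable def catenoid (p q c h₀ : ℝ) (z : ℂ) : E3 :=
  !₂[p + c * Real.cosh (Real.log ‖z‖) * (z.re / ‖z‖),
     q + c * Real.cosh (Real.log ‖z‖) * (z.im / ‖z‖),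
     h₀ + c * Real.log ‖z‖]

/-- The radius of the circle which `catenoid p q c h₀` maps to height `h`. -/
noncomputable def catenoidRadius (c h₀ h : ℝ) : ℝ := Real.exp ((h - h₀) / c)

/-- The area of the waist `catenoid ∩ {h₋ < x₃ < h₊}`. -/
noncomputable def catenoidWaistArea (hm hp p q c h₀ : ℝ) : ℝ≥0∞ :=
  surfaceArea (catenoidRadius c h₀ hm) (catenoidRadius c h₀ hp) (catenoid p q c h₀)

/-- The waist in the slab of the vertical catenoid `(x₁-p)² + (x₂-q)² = c² cosh²((x₃-m)/c)`, `m`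
being the mid-height of the slab, is the maximally symmetric marginally stable one: along its
boundary circles the rays from its center `(p, q, m)` are tangent to the catenoid. -/
def IsMaxSymMarginallyStable (hm hp p q c : ℝ) : Prop :=
  0 < c ∧ ∀ z : ℂ,
    (catenoid p q c ((hm + hp) / 2) z 2 = hm ∨ catenoid p q c ((hm + hp) / 2) z 2 = hp) →
      ∃ v : ℂ, fderiv ℝ (catenoid p q c ((hm + hp) / 2)) z v =
        catenoid p q c ((hm + hp) / 2) z - !₂[p, q, (hm + hp) / 2]

/-!
Write `z = e^ζ` with `ζ = t + iθ`, so that the annulus becomes the strip `a < t < b`, and let `Φ` be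
the holomorphic derivative `∂/∂t - i ∂/∂θ` of `X (e^ζ)`. If the area is infinite, there is nothing
to prove but that the catenoid waists have finite area.

*The height is linear in `t`.* If the area is finite, the Dirichlet energy of `X (e^ζ)` is finite.
Hence on almost every ray `θ = const` the height has a limit at either end; as `X` is proper, each
limit is the height of one of the planes. At a given end it is the same plane for almost all rays:
otherwise all circles near this end would cross the slab, which costs infinite energy
(`exists_ae_tendsto_height`). The convex function of `t` given by the squared distance, in the mean
over the circle, from the height to its linear interpolation tends to zero at both ends, so it
vanishes (`eq_interpolation_of_ae_tendsto`, `IsMinimalAnnulus.exists_height_eq`). Thus `x₃ = αt +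
β`, with `α ≠ 0` because a constant height cannot be that of a boundary plane; the level curves are
the circles `t = const`, and `Φ₂ = α`.

*The length satisfies* `L'' ≥ 2L`. Isotropy says `(Φ₀ - iΦ₁)(Φ₀ + iΦ₁) = -α²`. The Gauss map is `α /
(Φ₀ - iΦ₁)`; as its winding number is zero, both factors have periodic holomorphic square roots `G`
and `K`, and the length of the level curve is `L = ½ ∫ |G|² + |K|² dθ`. Since the flux is vertical,
`∫ G² = ∫ K² = 0`, so on each circle the constant Fourier coefficient of `G` is controlled by the
other ones, and Wirtinger's inequality gives `∫ |G|² ≤ 2 ∫ |G'|²`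
(`wirtinger_of_integral_sq_eq_zero`). As `Δ|G|² = 4|G'|²`, and likewise for `K`, it follows that
`L'' ≥ 2L` (`exists_hasDerivAt_integral_norm_sq`, `HasWeierstrassData.exists_length_convex`).
Moreover `L ≥ 2π|α|`, because `|∂X/∂θ| = |∂X/∂t| ≥ |α|`.

*Comparison.* It follows that `L(t) ≥ 2π|α| cosh(√2 (t - t₀))`, where `t₀` can be taken to be the
position of a shortest level (`IsShortestLevel.cosh_le`). If the shortest level is an end of the
slab, `L` is monotone, and `t₀` is an end of the strip. The catenoid with the same flux has waist
radius `|α|`, and its level curves have length `2π|α| cosh(t - t₀)`, with equality in the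
Cauchy–Schwarz inequality `Area ≥ ∫ L² / 2π dt` (`HasWeierstrassData.lt_surfaceArea`). This gives
the first part. For the marginally stable waist, the integral of `cosh²` over an interval of given
length is smallest when the interval is centered at the origin (`two_mul_coshSqPrim_le`), and among
the symmetric catenoid waists of the slab the area is smallest for the one with half-height `T`
satisfying `T sinh T = cosh T`, which is the marginally stable one (`coshSqPrim_div_sq_le`).
-/

/-! ### Comparison for `f'' ≥ k² f` -/

/-- To the right of a point where `f' ≥ 0`, the function `f` dominates the solution of
`g'' = k² g` which has a critical point there. -/
theorem cosh_le_of_deriv_nonneg {x y k m t₁ : ℝ} {f f' f'' : ℝ → ℝ} (hk : 0 ≤ k)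
    (hf : ∀ t ∈ Ioo x y, HasDerivAt f (f' t) t) (hf' : ∀ t ∈ Ioo x y, HasDerivAt f' (f'' t) t)
    (hc : ∀ t ∈ Ioo x y, k ^ 2 * f t ≤ f'' t) (h₁ : t₁ ∈ Ioo x y) (hm : m ≤ f t₁)
    (h0 : 0 ≤ f' t₁) {t : ℝ} (ht : t ∈ Ioo x y) (h1t : t₁ ≤ t) :
    m * Real.cosh (k * (t - t₁)) ≤ f t := by
  have hsub : Ico t₁ y ⊆ Ioo x y := fun s hs => ⟨h₁.1.trans_le hs.1, hs.2⟩
  set u : ℝ → ℝ := fun s => f s - m * Real.cosh (k * (s - t₁)) with hu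
  set v : ℝ → ℝ := fun s => f' s - m * (Real.sinh (k * (s - t₁)) * k) with hv
  set w : ℝ → ℝ := fun s => f'' s - m * (Real.cosh (k * (s - t₁)) * k * k) with hw
  have hlin : ∀ s, HasDerivAt (fun s => k * (s - t₁)) k s := fun s => by
    simpa using ((hasDerivAt_id s).sub_const t₁).const_mul k
  have hud : ∀ s ∈ Ioo x y, HasDerivAt u (v s) s := fun s hs =>
    (hf s hs).sub (((hlin s).cosh).const_mul m)
  have hvd : ∀ s ∈ Ioo x y, HasDerivAt v (w s) s := fun s hs =>
    (hf' s hs).sub ((((hlin s).sinh).mul_const k).const_mul m)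
  have hexp : ∀ c s : ℝ, HasDerivAt (fun s => Real.exp (c * s)) (Real.exp (c * s) * c) s :=
    fun c s => by simpa using (((hasDerivAt_id s).const_mul c)).exp
  -- `u'' - k² u ≥ 0` factors as `(∂ - k)(∂ + k) u ≥ 0`
  have hz : MonotoneOn (fun s => (v s + k * u s) * Real.exp (-k * s)) (Ico t₁ y) := by
    apply monotoneOn_of_hasDerivWithinAt_nonneg (convex_Ico _ _)
      (f' := fun s => (w s + k * v s) * Real.exp (-k * s)
        + (v s + k * u s) * (Real.exp (-k * s) * -k))
    · intro s hs
      exact ((((hvd s (hsub hs)).add ((hud s (hsub hs)).const_mul k)).mul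
        (hexp _ s))).continuousAt.continuousWithinAt
    · intro s hs
      have hs' := hsub (interior_subset hs)
      exact (((hvd s hs').add ((hud s hs').const_mul k)).mul (hexp _ s)).hasDerivWithinAt
    · intro s hs
      have hs' := hsub (interior_subset hs)
      have : 0 ≤ w s - k ^ 2 * u s := by
        simp only [hw, hu]; nlinarith [hc s hs']
      have e : (w s + k * v s) * Real.exp (-k * s) + (v s + k * u s) * (Real.exp (-k * s) * -k)
        = (w s - k ^ 2 * u s) * Real.exp (-k * s) := by ring
      rw [e]; positivity
  have hu1 : 0 ≤ u t₁ := by simp [hu, hm]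
  have hv1 : 0 ≤ v t₁ := by simp [hv, h0]
  have hmem : t₁ ∈ Ico t₁ y := ⟨le_rfl, h₁.2⟩
  have hzp : ∀ s ∈ Ico t₁ y, 0 ≤ v s + k * u s := by
    intro s hs
    have := hz hmem hs hs.1
    have h2 : 0 ≤ (v t₁ + k * u t₁) * Real.exp (-k * t₁) := by positivity
    exact nonneg_of_mul_nonneg_left (h2.trans this) (Real.exp_pos _)
  have hy : MonotoneOn (fun s => u s * Real.exp (k * s)) (Ico t₁ y) := by
    apply monotoneOn_of_hasDerivWithinAt_nonneg (convex_Ico _ _)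
      (f' := fun s => v s * Real.exp (k * s) + u s * (Real.exp (k * s) * k))
    · intro s hs
      exact ((hud s (hsub hs)).mul (hexp _ s)).continuousAt.continuousWithinAt
    · intro s hs
      exact ((hud s (hsub (interior_subset hs))).mul (hexp _ s)).hasDerivWithinAt
    · intro s hs
      have := hzp s (interior_subset hs)
      have e : v s * Real.exp (k * s) + u s * (Real.exp (k * s) * k)
        = (v s + k * u s) * Real.exp (k * s) := by ring
      rw [e]; positivity
  have := hy hmem ⟨h1t, ht.2⟩ h1t
  have h2 : 0 ≤ u t₁ * Real.exp (k * t₁) := by positivity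
  have := nonneg_of_mul_nonneg_left (h2.trans this) (Real.exp_pos _)
  simpa [hu] using this

theorem cosh_le_of_deriv_nonpos {x y k m t₁ : ℝ} {f f' f'' : ℝ → ℝ} (hk : 0 ≤ k)
    (hf : ∀ t ∈ Ioo x y, HasDerivAt f (f' t) t) (hf' : ∀ t ∈ Ioo x y, HasDerivAt f' (f'' t) t)
    (hc : ∀ t ∈ Ioo x y, k ^ 2 * f t ≤ f'' t) (h₁ : t₁ ∈ Ioo x y) (hm : m ≤ f t₁)
    (h0 : f' t₁ ≤ 0) {t : ℝ} (ht : t ∈ Ioo x y) (h1t : t ≤ t₁) :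
    m * Real.cosh (k * (t - t₁)) ≤ f t := by
  have hneg : ∀ {s}, s ∈ Ioo (-y) (-x) → -s ∈ Ioo x y := fun hs =>
    ⟨by linarith [hs.2], by linarith [hs.1]⟩
  have h := cosh_le_of_deriv_nonneg (x := -y) (y := -x) (k := k) (m := m) (t₁ := -t₁)
    (f := fun s => f (-s)) (f' := fun s => -f' (-s)) (f'' := fun s => f'' (-s)) hk
    (fun s hs => by simpa [Function.comp_def] using (hf _ (hneg hs)).scomp s (hasDerivAt_neg s))
    (fun s hs => by
      simpa [Function.comp_def, Pi.neg_def] using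
        ((hf' _ (hneg hs)).scomp s (hasDerivAt_neg s)).neg)
    (fun s hs => hc _ (hneg hs)) ⟨by linarith [h₁.2], by linarith [h₁.1]⟩ (by simpa using hm)
    (by simpa using h0) (t := -t) ⟨by linarith [ht.2], by linarith [ht.1]⟩ (by linarith)
  rw [← Real.cosh_neg]
  convert h using 3
  · ring
  · simp

/-- If `f` is nondecreasing, the comparison can be centered at the left end point. -/
theorem cosh_le_of_forall_deriv_nonneg {x y k m : ℝ} {f f' f'' : ℝ → ℝ} (hk : 0 ≤ k)
    (hf : ∀ t ∈ Ioo x y, HasDerivAt f (f' t) t) (hf' : ∀ t ∈ Ioo x y, HasDerivAt f' (f'' t) t)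
    (hc : ∀ t ∈ Ioo x y, k ^ 2 * f t ≤ f'' t) (hm : ∀ t ∈ Ioo x y, m ≤ f t)
    (h0 : ∀ t ∈ Ioo x y, 0 ≤ f' t) {t : ℝ} (ht : t ∈ Ioo x y) :
    m * Real.cosh (k * (t - x)) ≤ f t := by
  have hcont : Tendsto (fun s => m * Real.cosh (k * (t - s))) (𝓝[>] x)
      (𝓝 (m * Real.cosh (k * (t - x)))) := by
    apply tendsto_nhdsWithin_of_tendsto_nhds
    exact Continuous.tendsto (by fun_prop) x
  refine le_of_tendsto hcont ?_
  filter_upwards [Ioo_mem_nhdsGT ht.1] with s hs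
  have hs' : s ∈ Ioo x y := ⟨hs.1, hs.2.trans ht.2⟩
  exact cosh_le_of_deriv_nonneg hk hf hf' hc hs' (hm s hs') (h0 s hs') ht hs.2.le

/-- If `f` is nonincreasing, the comparison can be centered at the right end point. -/
theorem cosh_le_of_forall_deriv_nonpos {x y k m : ℝ} {f f' f'' : ℝ → ℝ} (hk : 0 ≤ k)
    (hf : ∀ t ∈ Ioo x y, HasDerivAt f (f' t) t) (hf' : ∀ t ∈ Ioo x y, HasDerivAt f' (f'' t) t)
    (hc : ∀ t ∈ Ioo x y, k ^ 2 * f t ≤ f'' t) (hm : ∀ t ∈ Ioo x y, m ≤ f t)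
    (h0 : ∀ t ∈ Ioo x y, f' t ≤ 0) {t : ℝ} (ht : t ∈ Ioo x y) :
    m * Real.cosh (k * (t - y)) ≤ f t := by
  have hcont : Tendsto (fun s => m * Real.cosh (k * (t - s))) (𝓝[<] y)
      (𝓝 (m * Real.cosh (k * (t - y)))) := by
    apply tendsto_nhdsWithin_of_tendsto_nhds
    exact Continuous.tendsto (by fun_prop) y
  refine le_of_tendsto hcont ?_
  filter_upwards [Ioo_mem_nhdsLT ht.2] with s hs
  have hs' : s ∈ Ioo x y := ⟨ht.1.trans hs.1, hs.2⟩
  exact cosh_le_of_deriv_nonpos hk hf hf' hc hs' (hm s hs') (h0 s hs') ht hs.1.le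

/-- The comparison centered at a critical point. -/
theorem cosh_le_of_deriv_eq_zero {x y k m t₀ : ℝ} {f f' f'' : ℝ → ℝ} (hk : 0 ≤ k)
    (hf : ∀ t ∈ Ioo x y, HasDerivAt f (f' t) t) (hf' : ∀ t ∈ Ioo x y, HasDerivAt f' (f'' t) t)
    (hc : ∀ t ∈ Ioo x y, k ^ 2 * f t ≤ f'' t) (h₁ : t₀ ∈ Ioo x y) (hm : m ≤ f t₀)
    (h0 : f' t₀ = 0) {t : ℝ} (ht : t ∈ Ioo x y) :
    m * Real.cosh (k * (t - t₀)) ≤ f t := by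
  rcases le_total t₀ t with h | h
  · exact cosh_le_of_deriv_nonneg hk hf hf' hc h₁ hm h0.ge ht h
  · exact cosh_le_of_deriv_nonpos hk hf hf' hc h₁ hm h0.le ht h

/-- Without further information on `f`, the comparison holds for some center: a critical point of
`f`, or else, `f` being monotone, an end point. -/
theorem exists_center_cosh_le {x y k m : ℝ} {f f' f'' : ℝ → ℝ} (hxy : x < y) (hk : 0 ≤ k)
    (hf : ∀ t ∈ Ioo x y, HasDerivAt f (f' t) t) (hf' : ∀ t ∈ Ioo x y, HasDerivAt f' (f'' t) t)
    (hc : ∀ t ∈ Ioo x y, k ^ 2 * f t ≤ f'' t) (hm : ∀ t ∈ Ioo x y, m ≤ f t) :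
    ∃ t₀ ∈ Icc x y, ∀ t ∈ Ioo x y, m * Real.cosh (k * (t - t₀)) ≤ f t := by
  by_cases h : ∃ t₀ ∈ Ioo x y, f' t₀ = 0
  · obtain ⟨t₀, h₀, h0⟩ := h
    exact ⟨t₀, Ioo_subset_Icc_self h₀, fun t ht =>
      cosh_le_of_deriv_eq_zero hk hf hf' hc h₀ (hm _ h₀) h0 ht⟩
  push Not at h
  have hcont : ContinuousOn f' (Ioo x y) := fun t ht => (hf' t ht).continuousAt.continuousWithinAt
  by_cases hs : ∃ s ∈ Ioo x y, 0 < f' s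
  · obtain ⟨s, hs, hs0⟩ := hs
    refine ⟨x, ⟨le_rfl, hxy.le⟩, fun t ht =>
      cosh_le_of_forall_deriv_nonneg hk hf hf' hc hm (fun r hr => ?_) ht⟩
    by_contra hneg
    push Not at hneg
    obtain ⟨u, hu, hu0⟩ := isPreconnected_Ioo.intermediate_value hr hs hcont ⟨hneg.le, hs0.le⟩
    exact h u hu hu0
  · push Not at hs
    exact ⟨y, ⟨hxy.le, le_rfl⟩, fun t ht =>
      cosh_le_of_forall_deriv_nonpos hk hf hf' hc hm hs ht⟩

/-! ### Integrals over circles -/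

/-- Differentiation under the integral sign over a period of the angle. -/
theorem hasDerivAt_integral_angle {E : Type*} [NormedAddCommGroup E] [NormedSpace ℝ E]
    {a b : ℝ} {F F' : ℝ → ℝ → E}
    (hF : ∀ t ∈ Ioo a b, ∀ θ, HasDerivAt (fun s => F s θ) (F' t θ) t)
    (hFc : ∀ t ∈ Ioo a b, Continuous (F t))
    (hF' : ContinuousOn (fun p : ℝ × ℝ => F' p.1 p.2) (Ioo a b ×ˢ univ)) {t : ℝ}
    (ht : t ∈ Ioo a b) :
    HasDerivAt (fun s => ∫ θ in (0 : ℝ)..(2 * Real.pi), F s θ)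
      (∫ θ in (0 : ℝ)..(2 * Real.pi), F' t θ) t := by
  obtain ⟨l, hal, hlt⟩ := exists_between ht.1
  obtain ⟨u, htu, hub⟩ := exists_between ht.2
  have hsub : Icc l u ⊆ Ioo a b := fun s hs => ⟨hal.trans_le hs.1, hs.2.trans_lt hub⟩
  have hcomp : IsCompact (Icc l u ×ˢ Icc (0 : ℝ) (2 * Real.pi)) := isCompact_Icc.prod isCompact_Icc
  obtain ⟨M, hM⟩ := hcomp.exists_bound_of_continuousOn
    (hF'.mono (prod_mono hsub (subset_univ _)))
  have hF't : Continuous (F' t) := by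
    have : ContinuousOn (fun θ : ℝ => F' t θ) univ :=
      hF'.comp (f := fun θ : ℝ => (t, θ)) (by fun_prop) (fun θ _ => ⟨ht, mem_univ _⟩)
    exact continuousOn_univ.1 this
  refine (intervalIntegral.hasDerivAt_integral_of_dominated_loc_of_deriv_le
    (bound := fun _ => M) (s := Icc l u) (Icc_mem_nhds hlt htu) ?_ ?_ ?_ ?_ ?_ ?_).2
  · filter_upwards [Ioo_mem_nhds ht.1 ht.2] with s hs
    exact (hFc s hs).aestronglyMeasurable
  · exact (hFc t ht).intervalIntegrable _ _
  · exact hF't.aestronglyMeasurable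
  · refine Eventually.of_forall fun θ hθ s hs => hM (s, θ) ⟨hs, ?_⟩
    rw [uIoc_of_le (by positivity)] at hθ
    exact Ioc_subset_Icc_self hθ
  · simp
  · exact Eventually.of_forall fun θ _ s hs => hF s (hsub hs) θ

/-- The mean over circles of a function `F` which is periodic in the angle has second derivative
the mean of `ΔF`. -/
theorem hasDerivAt_integral_laplacian {a b : ℝ} {Ft Ftt Fθ Fθθ : ℝ → ℝ → ℝ}
    (hFt : ∀ t ∈ Ioo a b, ∀ θ, HasDerivAt (fun s => Ft s θ) (Ftt t θ) t)
    (hFtc : ∀ t ∈ Ioo a b, Continuous (Ft t))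
    (hFtt : ContinuousOn (fun p : ℝ × ℝ => Ftt p.1 p.2) (Ioo a b ×ˢ univ))
    (hFθ : ∀ t ∈ Ioo a b, ∀ θ, HasDerivAt (Fθ t) (Fθθ t θ) θ)
    (hFθθ : ∀ t ∈ Ioo a b, Continuous (Fθθ t))
    (hper : ∀ t ∈ Ioo a b, Fθ t (2 * Real.pi) = Fθ t 0) {t : ℝ} (ht : t ∈ Ioo a b) :
    HasDerivAt (fun s => ∫ θ in (0 : ℝ)..(2 * Real.pi), Ft s θ)
      (∫ θ in (0 : ℝ)..(2 * Real.pi), (Ftt t θ + Fθθ t θ)) t := by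
  have h := hasDerivAt_integral_angle hFt hFtc hFtt ht
  have hc : Continuous (Ftt t) := by
    have : ContinuousOn (fun θ : ℝ => Ftt t θ) univ :=
      hFtt.comp (f := fun θ : ℝ => (t, θ)) (by fun_prop) (fun θ _ => ⟨ht, mem_univ _⟩)
    exact continuousOn_univ.1 this
  rw [intervalIntegral.integral_add (hc.intervalIntegrable _ _)
    ((hFθθ t ht).intervalIntegrable _ _),
    intervalIntegral.integral_eq_sub_of_hasDerivAt (fun θ _ => hFθ t ht θ)
      ((hFθθ t ht).intervalIntegrable _ _), hper t ht, sub_self, add_zero]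
  exact h

/-- **Wirtinger's inequality** for periodic functions of mean zero. -/
theorem wirtinger_of_integral_eq_zero {H H' : ℝ → ℂ} (hH : ∀ θ, HasDerivAt H (H' θ) θ)
    (hc : Continuous H') (hper : H (2 * Real.pi) = H 0)
    (hmean : ∫ θ in (0 : ℝ)..(2 * Real.pi), H θ = 0) :
    ∫ θ in (0 : ℝ)..(2 * Real.pi), ‖H θ‖ ^ 2 ≤ ∫ θ in (0 : ℝ)..(2 * Real.pi), ‖H' θ‖ ^ 2 := by
  have hpi : (0 : ℝ) < 2 * Real.pi := by positivity
  have hcH : Continuous H := continuous_iff_continuousAt.2 fun θ => (hH θ).continuousAt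
  have hL : ∀ f : ℝ → ℂ, Continuous f → MemLp f 2 (volume.restrict (Ioc 0 (2 * Real.pi))) := by
    intro f hf
    obtain ⟨M, hM⟩ := (isCompact_Icc (a := (0 : ℝ)) (b := 2 * Real.pi)).exists_bound_of_continuousOn
      hf.continuousOn
    refine MemLp.of_bound hf.aestronglyMeasurable M ?_
    exact (ae_restrict_iff' measurableSet_Ioc).2
      (Eventually.of_forall fun θ hθ => hM θ (Ioc_subset_Icc_self hθ))
  have h1 := hasSum_sq_fourierCoeffOn hpi (hL H hcH)
  have h2 := hasSum_sq_fourierCoeffOn hpi (hL H' hc)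
  have hle := hasSum_le (fun n => ?_) h1 h2
  · rw [smul_eq_mul, smul_eq_mul, sub_zero] at hle
    exact le_of_mul_le_mul_left hle (by positivity)
  · by_cases hn : n = 0
    · subst hn
      have : fourierCoeffOn hpi H 0 = 0 := by
        rw [fourierCoeffOn_eq_integral]; simp [hmean]
      rw [this]; simp
    · rw [fourierCoeffOn_of_hasDerivAt hpi hn (fun θ _ => hH θ) (hc.intervalIntegrable _ _), hper]
      have hn' : (1 : ℝ) ≤ |(n : ℝ)| := by
        exact_mod_cast Int.one_le_abs hn
      have h3 : ‖1 / (-2 * Real.pi * Complex.I * n) *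
          (fourier (-n) ((0 : ℝ) : AddCircle (2 * Real.pi - 0)) * (H 0 - H 0) -
            (((2 * Real.pi : ℝ) : ℂ) - ((0 : ℝ) : ℂ)) * fourierCoeffOn hpi H' n)‖
          = ‖fourierCoeffOn hpi H' n‖ / |(n : ℝ)| := by
        simp [abs_of_pos Real.pi_pos]
        field_simp
      rw [h3]
      gcongr
      exact div_le_self (norm_nonneg _) hn'

/-- If `∫ G² = 0`, then the constant Fourier coefficient of the periodic function `G` is controlled
by the other ones, whence a Wirtinger inequality. -/
theorem wirtinger_of_integral_sq_eq_zero {G G' : ℝ → ℂ} (hG : ∀ θ, HasDerivAt G (G' θ) θ)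
    (hc : Continuous G') (hper : G (2 * Real.pi) = G 0)
    (hsq : ∫ θ in (0 : ℝ)..(2 * Real.pi), G θ ^ 2 = 0) :
    ∫ θ in (0 : ℝ)..(2 * Real.pi), ‖G θ‖ ^ 2 ≤
      2 * ∫ θ in (0 : ℝ)..(2 * Real.pi), ‖G' θ‖ ^ 2 := by
  have hpi : (0 : ℝ) < 2 * Real.pi := by positivity
  have hcG : Continuous G := continuous_iff_continuousAt.2 fun θ => (hG θ).continuousAt
  set c : ℂ := (2 * Real.pi : ℝ)⁻¹ * ∫ θ in (0 : ℝ)..(2 * Real.pi), G θ with hcdef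
  set H : ℝ → ℂ := fun θ => G θ - c with hHdef
  have hcH : Continuous H := by fun_prop
  have hmean : ∫ θ in (0 : ℝ)..(2 * Real.pi), H θ = 0 := by
    simp only [hHdef]
    rw [intervalIntegral.integral_sub (hcG.intervalIntegrable _ _) (by simp)]
    simp only [intervalIntegral.integral_const, sub_zero, hcdef]
    rw [Complex.real_smul, ← mul_assoc, ← Complex.ofReal_mul,
      mul_inv_cancel₀ hpi.ne']
    simp
  have hW := wirtinger_of_integral_eq_zero (H := H) (fun θ => (hG θ).sub_const c) hc
    (by simp [hHdef, hper]) hmean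
  have h1 : ∫ θ in (0 : ℝ)..(2 * Real.pi), H θ ^ 2 = -((2 * Real.pi : ℝ) * c ^ 2) := by
    have e : ∀ θ, G θ ^ 2 = H θ ^ 2 + 2 * c * H θ + c ^ 2 := fun θ => by simp only [hHdef]; ring
    simp_rw [e] at hsq
    rw [intervalIntegral.integral_add (Continuous.intervalIntegrable (by fun_prop) _ _)
      (by simp), intervalIntegral.integral_add (Continuous.intervalIntegrable (by fun_prop) _ _)
      (Continuous.intervalIntegrable (by fun_prop) _ _), intervalIntegral.integral_const_mul,
      hmean] at hsq
    simp only [mul_zero, add_zero, intervalIntegral.integral_const, sub_zero] at hsq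
    rw [Complex.real_smul] at hsq
    linear_combination hsq
  have h2 : 2 * Real.pi * ‖c‖ ^ 2 ≤ ∫ θ in (0 : ℝ)..(2 * Real.pi), ‖H θ‖ ^ 2 := by
    have := intervalIntegral.norm_integral_le_integral_norm (f := fun θ => H θ ^ 2)
      (μ := volume) hpi.le
    rw [h1] at this
    simpa [abs_of_pos Real.pi_pos] using this
  have h3 : ∫ θ in (0 : ℝ)..(2 * Real.pi), ‖G θ‖ ^ 2 =
      (∫ θ in (0 : ℝ)..(2 * Real.pi), ‖H θ‖ ^ 2) + 2 * Real.pi * ‖c‖ ^ 2 := by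
    have e : ∀ θ, ‖G θ‖ ^ 2 = ‖H θ‖ ^ 2 + 2 * (inner ℝ c (H θ)) + ‖c‖ ^ 2 := fun θ => by
      have : G θ = H θ + c := by simp [hHdef]
      rw [this, norm_add_sq_real, real_inner_comm]
    simp_rw [e]
    rw [intervalIntegral.integral_add (Continuous.intervalIntegrable (by fun_prop) _ _)
      (by simp), intervalIntegral.integral_add (Continuous.intervalIntegrable (by fun_prop) _ _)
      (Continuous.intervalIntegrable (by fun_prop) _ _), intervalIntegral.integral_const_mul]
    have h4 : ∫ θ in (0 : ℝ)..(2 * Real.pi), inner ℝ c (H θ) = 0 := by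
      have := (innerSL ℝ c).intervalIntegral_comp_comm (μ := volume) (a := 0) (b := 2 * Real.pi)
        (hcH.intervalIntegrable _ _)
      simpa [hmean] using this
    rw [h4]; simp
  linarith

/-! ### Ends of a proper annulus of finite energy -/

/-- The **Cauchy–Schwarz inequality** for continuous functions on an interval. -/
theorem sq_integral_mul_le {x y : ℝ} (hxy : x ≤ y) {f g : ℝ → ℝ} (hf : ContinuousOn f (Icc x y))
    (hg : ContinuousOn g (Icc x y)) :
    (∫ t in x..y, f t * g t) ^ 2 ≤ (∫ t in x..y, f t ^ 2) * ∫ t in x..y, g t ^ 2 := by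
  have hI : ∀ {h : ℝ → ℝ}, ContinuousOn h (Icc x y) → IntervalIntegrable h volume x y := by
    intro h hh
    exact ContinuousOn.intervalIntegrable (by rwa [uIcc_of_le hxy])
  have hq : ∀ s : ℝ, 0 ≤ (∫ t in x..y, g t ^ 2) * (s * s) + (2 * ∫ t in x..y, f t * g t) * s
      + ∫ t in x..y, f t ^ 2 := by
    intro s
    have h0 : 0 ≤ ∫ t in x..y, (f t + s * g t) ^ 2 :=
      intervalIntegral.integral_nonneg hxy fun t _ => sq_nonneg _
    have e : ∀ t, (f t + s * g t) ^ 2 = f t ^ 2 + (2 * s) * (f t * g t) + s ^ 2 * g t ^ 2 :=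
      fun t => by ring
    simp_rw [e] at h0
    rw [intervalIntegral.integral_add (hI (by fun_prop)) (hI (by fun_prop)),
      intervalIntegral.integral_add (hI (by fun_prop)) (hI (by fun_prop)),
      intervalIntegral.integral_const_mul, intervalIntegral.integral_const_mul] at h0
    linarith
  have := discrim_le_zero hq
  rw [discrim] at this
  linarith

/-- A curve of finite energy is Hölder continuous of exponent `1/2`. -/
theorem norm_sub_sq_le_of_energy {E : Type*} [NormedAddCommGroup E] [NormedSpace ℝ E]
    [CompleteSpace E] {a b : ℝ} {f f' : ℝ → E} (hf : ∀ t ∈ Ioo a b, HasDerivAt f (f' t) t)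
    (hc : ContinuousOn f' (Ioo a b)) (he : ∫⁻ t in Ioo a b, ‖f' t‖ₑ ^ 2 ≠ ∞) {s t : ℝ}
    (hs : s ∈ Ioo a b) (ht : t ∈ Ioo a b) (hst : s ≤ t) :
    ‖f t - f s‖ ^ 2 ≤ (t - s) * (∫⁻ t in Ioo a b, ‖f' t‖ₑ ^ 2).toReal := by
  have hsub : Icc s t ⊆ Ioo a b := fun r hr => ⟨hs.1.trans_le hr.1, hr.2.trans_lt ht.2⟩
  have hc' : ContinuousOn f' (uIcc s t) := by rw [uIcc_of_le hst]; exact hc.mono hsub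
  have hcn : ContinuousOn (fun r => ‖f' r‖) (Icc s t) := (hc.mono hsub).norm
  have h1 : ∫ r in s..t, f' r = f t - f s :=
    intervalIntegral.integral_eq_sub_of_hasDerivAt
      (fun r hr => hf r (hsub (by rwa [uIcc_of_le hst] at hr))) hc'.intervalIntegrable
  have h2 : ‖f t - f s‖ ≤ ∫ r in s..t, 1 * ‖f' r‖ := by
    rw [← h1]; simpa using intervalIntegral.norm_integral_le_integral_norm hst
  have h3 := sq_integral_mul_le hst (f := fun _ => (1 : ℝ)) continuousOn_const hcn
  have h4 : ∫ r in s..t, ‖f' r‖ ^ 2 ≤ (∫⁻ t in Ioo a b, ‖f' t‖ₑ ^ 2).toReal := by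
    rw [intervalIntegral.integral_of_le hst, integral_eq_lintegral_of_nonneg_ae
      (Eventually.of_forall fun r => by positivity)]
    · apply ENNReal.toReal_mono he
      calc _ = ∫⁻ r in Ioc s t, ‖f' r‖ₑ ^ 2 := by
            refine lintegral_congr fun r => ?_
            rw [ENNReal.ofReal_pow (norm_nonneg _), ofReal_norm]
        _ ≤ _ := lintegral_mono_set (Ioc_subset_Icc_self.trans hsub)
    · exact ((hcn.pow 2).mono Ioc_subset_Icc_self).aestronglyMeasurable measurableSet_Ioc
  calc ‖f t - f s‖ ^ 2 ≤ (∫ r in s..t, 1 * ‖f' r‖) ^ 2 := by gcongr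
    _ ≤ _ := h3
    _ = (t - s) * ∫ r in s..t, ‖f' r‖ ^ 2 := by simp
    _ ≤ _ := by gcongr

/-- A continuous function with values in an interval which leaves every compact subinterval
converges to one of the end points. -/
theorem tendsto_left_or_right_of_leaves_compacts {a b hm hp : ℝ} (hab : a < b) (hmp : hm < hp)
    {f : ℝ → ℝ} (hc : ContinuousOn f (Ioo a b)) (hf : ∀ t ∈ Ioo a b, f t ∈ Ioo hm hp)
    (hl : ∀ ε > 0, ∀ᶠ t in 𝓝[>] a, f t ∉ Icc (hm + ε) (hp - ε)) :
    Tendsto f (𝓝[>] a) (𝓝 hm) ∨ Tendsto f (𝓝[>] a) (𝓝 hp) := by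
  set ε₀ := (hp - hm) / 3 with hε₀
  have hε₀p : 0 < ε₀ := by rw [hε₀]; linarith
  have hab' : ∀ᶠ t in 𝓝[>] a, t ∈ Ioo a b := Ioo_mem_nhdsGT hab
  obtain ⟨l, hl1, hl2⟩ := mem_nhdsGT_iff_exists_Ioo_subset.1 ((hl ε₀ hε₀p).and hab')
  have hev : ∀ᶠ t in 𝓝[>] a, t ∈ Ioo a l := Ioo_mem_nhdsGT hl1
  by_cases hlow : ∃ s ∈ Ioo a l, f s < hm + ε₀
  · left
    obtain ⟨s, hs, hfs⟩ := hlow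
    have hall : ∀ t ∈ Ioo a l, f t < hm + ε₀ := by
      intro t ht
      by_contra hcon
      push Not at hcon
      obtain ⟨r, hr, hr0⟩ := isPreconnected_Ioo.intermediate_value hs ht
        (hc.mono fun r hr => (hl2 hr).2) ⟨hfs.le, hcon⟩
      exact (hl2 hr).1 ⟨hr0.ge, by rw [hr0]; linarith⟩
    refine tendsto_order.2 ⟨fun c hcm => ?_, fun c hcm => ?_⟩
    · filter_upwards [hab'] with t ht using hcm.trans (hf t ht).1
    · filter_upwards [hl (min (c - hm) ε₀) (lt_min (by linarith) hε₀p), hev] with t ht1 ht2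
      have h1 := hall t ht2
      have h2 := min_le_left (c - hm) ε₀
      have h3 := min_le_right (c - hm) ε₀
      by_contra hcon
      push Not at hcon
      exact ht1 ⟨by linarith, by linarith⟩
  · right
    push Not at hlow
    refine tendsto_order.2 ⟨fun c hcm => ?_, fun c hcm => ?_⟩
    · filter_upwards [hl (min (hp - c) ε₀) (lt_min (by linarith) hε₀p), hev] with t ht1 ht2
      have h1 := hlow t ht2
      have h2 := min_le_left (hp - c) ε₀
      have h3 := min_le_right (hp - c) ε₀
      by_contra hcon
      push Not at hcon
      exact ht1 ⟨by linarith, by linarith⟩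
    · filter_upwards [hab'] with t ht using (hf t ht).2.trans hcm

theorem continuous_slice {E : Type*} [TopologicalSpace E] {a b : ℝ} {F : ℝ → ℝ → E}
    (hF : ContinuousOn (fun p : ℝ × ℝ => F p.1 p.2) (Ioo a b ×ˢ univ)) {t : ℝ}
    (ht : t ∈ Ioo a b) : Continuous (F t) :=
  continuousOn_univ.1 (hF.comp (f := fun θ : ℝ => (t, θ)) (by fun_prop)
    (fun _ _ => ⟨ht, mem_univ _⟩))

theorem continuousOn_slice {E : Type*} [TopologicalSpace E] {a b : ℝ} {F : ℝ → ℝ → E}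
    (hF : ContinuousOn (fun p : ℝ × ℝ => F p.1 p.2) (Ioo a b ×ˢ univ)) (θ : ℝ) :
    ContinuousOn (fun t => F t θ) (Ioo a b) :=
  hF.comp (f := fun t : ℝ => (t, θ)) (by fun_prop) (fun _ ht => ⟨ht, mem_univ _⟩)

theorem aemeasurable_enorm_sq_prod {E : Type*} [NormedAddCommGroup E] {a b c d : ℝ} {F : ℝ → ℝ → E}
    (hF : ContinuousOn (fun p : ℝ × ℝ => F p.1 p.2) (Ioo a b ×ˢ univ)) :
    AEMeasurable (fun p : ℝ × ℝ => ‖F p.1 p.2‖ₑ ^ 2)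
      ((volume.restrict (Ioo a b)).prod (volume.restrict (Ioc c d))) := by
  rw [Measure.prod_restrict]
  have h1 : ContinuousOn (fun p : ℝ × ℝ => ‖F p.1 p.2‖ₑ ^ 2) (Ioo a b ×ˢ Ioc c d) :=
    (ENNReal.continuous_pow 2).comp_continuousOn
      (continuous_enorm.comp_continuousOn (hF.mono (prod_mono le_rfl (subset_univ _))))
  exact h1.aemeasurable (measurableSet_Ioo.prod measurableSet_Ioc)

/-- The energy inequality behind the uniqueness of the limit: a function `u` on a circle spends
energy to pass from one value to another one, even when measured with the weight
`(u - h₋)(h₊ - u)`. The cubic polynomial is a primitive of this weight. -/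
theorem sq_sub_cubic_le {hm hp : ℝ} {u u' : ℝ → ℝ} (hu : ∀ θ, HasDerivAt u (u' θ) θ)
    (hc : Continuous u') {θ₁ θ₂ : ℝ} (h₁ : θ₁ ∈ Ioc 0 (2 * Real.pi))
    (h₂ : θ₂ ∈ Ioc 0 (2 * Real.pi)) :
    (((u θ₂ - hm) ^ 2 * (hp - hm) / 2 - (u θ₂ - hm) ^ 3 / 3) -
      ((u θ₁ - hm) ^ 2 * (hp - hm) / 2 - (u θ₁ - hm) ^ 3 / 3)) ^ 2 ≤
    (∫ θ in (0 : ℝ)..(2 * Real.pi), ((u θ - hm) * (hp - u θ)) ^ 2) *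
      ∫ θ in (0 : ℝ)..(2 * Real.pi), u' θ ^ 2 := by
  have hpi : (0 : ℝ) ≤ 2 * Real.pi := by positivity
  have hcu : Continuous u := continuous_iff_continuousAt.2 fun θ => (hu θ).continuousAt
  have hd : ∀ θ, HasDerivAt (fun θ => (u θ - hm) ^ 2 * (hp - hm) / 2 - (u θ - hm) ^ 3 / 3)
      (((u θ - hm) * (hp - u θ)) * u' θ) θ := by
    intro θ
    have h := (hu θ).sub_const hm
    exact ((((h.pow 2).mul_const (hp - hm)).div_const 2).sub ((h.pow 3).div_const 3)).congr_deriv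
      (by push_cast; ring)
  have h3 := intervalIntegral.integral_eq_sub_of_hasDerivAt (a := θ₁) (b := θ₂)
    (fun θ _ => hd θ) (Continuous.intervalIntegrable (by fun_prop) _ _)
  rw [← h3]
  have h4 : |∫ θ in θ₁..θ₂, ((u θ - hm) * (hp - u θ)) * u' θ| ≤
      ∫ θ in (0 : ℝ)..(2 * Real.pi), |(u θ - hm) * (hp - u θ)| * |u' θ| := by
    have h5 := intervalIntegral.norm_integral_le_integral_norm_uIoc (a := θ₁) (b := θ₂)
      (f := fun θ => ((u θ - hm) * (hp - u θ)) * u' θ) (μ := volume)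
    rw [Real.norm_eq_abs] at h5
    refine h5.trans ?_
    rw [intervalIntegral.integral_of_le hpi]
    simp_rw [norm_mul, Real.norm_eq_abs, abs_mul]
    refine setIntegral_mono_set ?_ (Eventually.of_forall fun θ => by positivity)
      (LE.le.eventuallyLE ?_)
    · exact (Continuous.integrableOn_Icc (by fun_prop)).mono_set Ioc_subset_Icc_self
    · rw [uIoc]
      exact Ioc_subset_Ioc (le_min h₁.1.le h₂.1.le) (max_le h₁.2 h₂.2)
  calc _ = |∫ θ in θ₁..θ₂, ((u θ - hm) * (hp - u θ)) * u' θ| ^ 2 := (sq_abs _).symm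
    _ ≤ _ := pow_le_pow_left₀ (abs_nonneg _) h4 2
    _ ≤ (∫ θ in (0 : ℝ)..(2 * Real.pi), |(u θ - hm) * (hp - u θ)| ^ 2) *
        ∫ θ in (0 : ℝ)..(2 * Real.pi), |u' θ| ^ 2 :=
      sq_integral_mul_le hpi (by fun_prop) (by fun_prop)
    _ = _ := by simp_rw [sq_abs]

/-- Along a radius of finite energy, a curve in the slab which leaves all compact subsets of the
slab reaches one of the two boundary planes. -/
theorem tendsto_height_of_energy {a b hm hp : ℝ} (hab : a < b) (hmp : hm < hp) {f f' : ℝ → E3}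
    (hf : ∀ t ∈ Ioo a b, HasDerivAt f (f' t) t) (hc : ContinuousOn f' (Ioo a b))
    (he : ∫⁻ t in Ioo a b, ‖f' t‖ₑ ^ 2 ≠ ∞) (hslab : ∀ t ∈ Ioo a b, f t ∈ slab hm hp)
    (hproper : ∀ K : Set E3, IsCompact K → K ⊆ slab hm hp → ∀ᶠ t in 𝓝[>] a, f t ∉ K) :
    Tendsto (fun t => f t 2) (𝓝[>] a) (𝓝 hm) ∨ Tendsto (fun t => f t 2) (𝓝[>] a) (𝓝 hp) := by
  have hcf : ContinuousOn f (Ioo a b) := fun t ht => (hf t ht).continuousAt.continuousWithinAt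
  refine tendsto_left_or_right_of_leaves_compacts hab hmp (f := fun t => f t 2)
    (by fun_prop) hslab fun ε hε => ?_
  obtain ⟨t₁, ht₁⟩ := exists_between hab
  set e := (∫⁻ t in Ioo a b, ‖f' t‖ₑ ^ 2).toReal with hedef
  have he0 : 0 ≤ e := ENNReal.toReal_nonneg
  set R := Real.sqrt ((b - a) * e) with hR
  have hbd : ∀ t ∈ Ioo a b, f t ∈ Metric.closedBall (f t₁) R := by
    intro t ht
    rw [mem_closedBall_iff_norm]
    apply Real.le_sqrt_of_sq_le
    rcases le_total t t₁ with h | h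
    · rw [norm_sub_rev]
      refine (norm_sub_sq_le_of_energy hf hc he ht ht₁ h).trans ?_
      have : t₁ - t ≤ b - a := by linarith [ht.1, ht₁.2]
      gcongr
    · refine (norm_sub_sq_le_of_energy hf hc he ht₁ ht h).trans ?_
      have : t - t₁ ≤ b - a := by linarith [ht.2, ht₁.1]
      gcongr
  have hK : IsCompact (Metric.closedBall (f t₁) R ∩ {x : E3 | x 2 ∈ Icc (hm + ε) (hp - ε)}) := by
    refine (isCompact_closedBall _ _).inter_right ?_
    exact isClosed_Icc.preimage (by fun_prop : Continuous fun x : E3 => x 2)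
  filter_upwards [hproper _ hK (fun x hx => ⟨by linarith [hx.2.1], by linarith [hx.2.2]⟩),
    Ioo_mem_nhdsGT hab] with t ht1 ht2 hcon
  exact ht1 ⟨hbd t ht2, hcon⟩

/-- A positive multiple of `(t - a)⁻¹` cannot be bounded by an integrable function near `a`. -/
theorem lintegral_eq_top_of_inv_sub_le {a l : ℝ} (hal : a < l) {J : ℝ → ℝ≥0∞} {C : ℝ≥0∞}
    (hC : C ≠ ∞) (hJ : ∀ t ∈ Ioo a l, ENNReal.ofReal ((t - a)⁻¹) ≤ C * J t) :
    ∫⁻ t in Ioo a l, J t = ∞ := by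
  by_contra hfin
  have h1 : ∫⁻ t in Ioo a l, ENNReal.ofReal ((t - a)⁻¹) < ∞ := by
    calc _ ≤ ∫⁻ t in Ioo a l, C * J t := setLIntegral_mono' measurableSet_Ioo hJ
      _ = C * ∫⁻ t in Ioo a l, J t := lintegral_const_mul' _ _ hC
      _ < ∞ := ENNReal.mul_lt_top hC.lt_top (lt_top_iff_ne_top.2 hfin)
  have h2 : IntegrableOn (fun t => (t - a)⁻¹) (Ioo a l) := by
    refine ⟨by fun_prop, ?_⟩
    rw [hasFiniteIntegral_iff_ofReal]
    · exact h1
    · exact (ae_restrict_iff' measurableSet_Ioo).2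
        (Eventually.of_forall fun t ht => inv_nonneg.2 (sub_nonneg.2 ht.1.le))
  have h3 : IntervalIntegrable (fun t => (t - a)⁻¹) volume a l := by
    rw [intervalIntegrable_iff_integrableOn_Ioc_of_le hal.le, integrableOn_Ioc_iff_integrableOn_Ioo]
    exact h2
  rw [intervalIntegrable_sub_inv_iff] at h3
  rcases h3 with h3 | h3
  · exact hal.ne h3
  · exact h3 left_mem_uIcc

/-- A proper map of finite energy from an annulus to the slab, written in logarithmic polar
coordinates, has an end at which the height tends to one and the same value, `h₋` or `h₊`, along
almost every radius. Different limits at two radii are impossible: all circles near the end would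
cross the slab, while the weight `(x₃ - h₋)(h₊ - x₃)` is at most of order `(t - a)^(1/2)`, so the
energy of the circles would be at least of order `(t - a)⁻¹`. -/
theorem exists_ae_tendsto_height {a b hm hp : ℝ} (hab : a < b) (hmp : hm < hp)
    {Y Yt Yθ : ℝ → ℝ → E3}
    (hYt : ∀ t ∈ Ioo a b, ∀ θ, HasDerivAt (fun s => Y s θ) (Yt t θ) t)
    (hYθ : ∀ t ∈ Ioo a b, ∀ θ, HasDerivAt (Y t) (Yθ t θ) θ)
    (hct : ContinuousOn (fun p : ℝ × ℝ => Yt p.1 p.2) (Ioo a b ×ˢ univ))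
    (hcθ : ContinuousOn (fun p : ℝ × ℝ => Yθ p.1 p.2) (Ioo a b ×ˢ univ))
    (hslab : ∀ t ∈ Ioo a b, ∀ θ, Y t θ ∈ slab hm hp)
    (hproper : ∀ K : Set E3, IsCompact K → K ⊆ slab hm hp → ∀ᶠ t in 𝓝[>] a, ∀ θ, Y t θ ∉ K)
    (het : ∫⁻ t in Ioo a b, ∫⁻ θ in Ioc 0 (2 * Real.pi), ‖Yt t θ‖ₑ ^ 2 ≠ ∞)
    (heθ : ∫⁻ t in Ioo a b, ∫⁻ θ in Ioc 0 (2 * Real.pi), ‖Yθ t θ‖ₑ ^ 2 ≠ ∞) :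
    ∃ c, (c = hm ∨ c = hp) ∧ ∀ᵐ θ ∂(volume.restrict (Ioc 0 (2 * Real.pi))),
      Tendsto (fun t => Y t θ 2) (𝓝[>] a) (𝓝 c) := by
  set e : ℝ → ℝ≥0∞ := fun θ => ∫⁻ t in Ioo a b, ‖Yt t θ‖ₑ ^ 2 with hedef
  have hmeas := aemeasurable_enorm_sq_prod (c := 0) (d := 2 * Real.pi) hct
  have hswap : ∫⁻ θ in Ioc 0 (2 * Real.pi), e θ =
      ∫⁻ t in Ioo a b, ∫⁻ θ in Ioc 0 (2 * Real.pi), ‖Yt t θ‖ₑ ^ 2 :=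
    (lintegral_lintegral_swap (f := fun t θ => ‖Yt t θ‖ₑ ^ 2) hmeas).symm
  have hgood : ∀ᵐ θ ∂(volume.restrict (Ioc 0 (2 * Real.pi))), e θ < ∞ :=
    ae_lt_top' hmeas.lintegral_prod_left' (by rw [hswap]; exact het)
  have hlim : ∀ θ, e θ < ∞ → Tendsto (fun t => Y t θ 2) (𝓝[>] a) (𝓝 hm) ∨
      Tendsto (fun t => Y t θ 2) (𝓝[>] a) (𝓝 hp) := fun θ hθ =>
    tendsto_height_of_energy hab hmp (fun t ht => hYt t ht θ) (continuousOn_slice hct θ) hθ.ne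
      (fun t ht => hslab t ht θ) (fun K hK hKs => (hproper K hK hKs).mono fun t ht => ht θ)
  -- the weight is small near the end
  have hweight : ∀ θ, e θ < ∞ → ∀ t ∈ Ioo a b,
      ENNReal.ofReal (((Y t θ 2 - hm) * (hp - Y t θ 2)) ^ 2) ≤
        ENNReal.ofReal ((hp - hm) ^ 2 * (t - a)) * e θ := by
    intro θ hθ t ht
    have hc : ∀ c, Tendsto (fun s => Y s θ 2) (𝓝[>] a) (𝓝 c) →
        (Y t θ 2 - c) ^ 2 ≤ (t - a) * (e θ).toReal := by
      intro c hc
      have h1 : Tendsto (fun s => (Y t θ 2 - Y s θ 2) ^ 2) (𝓝[>] a) (𝓝 ((Y t θ 2 - c) ^ 2)) :=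
        (tendsto_const_nhds.sub hc).pow 2
      refine le_of_tendsto h1 ?_
      filter_upwards [Ioo_mem_nhdsGT ht.1] with s hs
      have hs' : s ∈ Ioo a b := ⟨hs.1, hs.2.trans ht.2⟩
      have h2 := norm_sub_sq_le_of_energy (fun t ht => hYt t ht θ) (continuousOn_slice hct θ) hθ.ne
        hs' ht hs.2.le
      have h3 : |Y t θ 2 - Y s θ 2| ≤ ‖Y t θ - Y s θ‖ := by
        simpa using PiLp.norm_apply_le (Y t θ - Y s θ) 2
      calc (Y t θ 2 - Y s θ 2) ^ 2 = |Y t θ 2 - Y s θ 2| ^ 2 := (sq_abs _).symm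
        _ ≤ ‖Y t θ - Y s θ‖ ^ 2 := by gcongr
        _ ≤ _ := h2
        _ ≤ _ := by
          gcongr
          exact hs.1.le
    have hs := hslab t ht θ
    have hx1 : 0 < Y t θ 2 - hm := sub_pos.2 hs.1
    have hx2 : 0 < hp - Y t θ 2 := sub_pos.2 hs.2
    have hnn : 0 ≤ (t - a) * (e θ).toReal :=
      mul_nonneg (sub_nonneg.2 ht.1.le) ENNReal.toReal_nonneg
    have key : ((Y t θ 2 - hm) * (hp - Y t θ 2)) ^ 2 ≤ (hp - hm) ^ 2 * (t - a) * (e θ).toReal := by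
      rcases hlim θ hθ with h | h
      · have := hc _ h
        calc ((Y t θ 2 - hm) * (hp - Y t θ 2)) ^ 2
            = (Y t θ 2 - hm) ^ 2 * (hp - Y t θ 2) ^ 2 := by ring
          _ ≤ (t - a) * (e θ).toReal * (hp - hm) ^ 2 := by
            gcongr
            linarith
          _ = _ := by ring
      · have := hc _ h
        calc ((Y t θ 2 - hm) * (hp - Y t θ 2)) ^ 2
            = (Y t θ 2 - hp) ^ 2 * (Y t θ 2 - hm) ^ 2 := by ring
          _ ≤ (t - a) * (e θ).toReal * (hp - hm) ^ 2 := by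
            gcongr
            linarith
          _ = _ := by ring
    calc _ ≤ ENNReal.ofReal ((hp - hm) ^ 2 * (t - a) * (e θ).toReal) := ENNReal.ofReal_le_ofReal key
      _ = _ := by
        rw [ENNReal.ofReal_mul (mul_nonneg (sq_nonneg _) (sub_nonneg.2 ht.1.le)),
          ENNReal.ofReal_toReal hθ.ne]
  have hnot : ∀ θ₁ ∈ Ioc 0 (2 * Real.pi), ∀ θ₂ ∈ Ioc 0 (2 * Real.pi),
      Tendsto (fun t => Y t θ₁ 2) (𝓝[>] a) (𝓝 hm) →
      Tendsto (fun t => Y t θ₂ 2) (𝓝[>] a) (𝓝 hp) → False := by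
    intro θ₁ h₁ θ₂ h₂ ht₁ ht₂
    set D := ∫⁻ t in Ioo a b, ∫⁻ θ in Ioc 0 (2 * Real.pi), ‖Yt t θ‖ₑ ^ 2 with hD
    set J : ℝ → ℝ≥0∞ := fun t => ∫⁻ θ in Ioc 0 (2 * Real.pi), ‖Yθ t θ‖ₑ ^ 2 with hJ
    set Ψ : ℝ → ℝ := fun x => (x - hm) ^ 2 * (hp - hm) / 2 - (x - hm) ^ 3 / 3 with hΨ
    have hΨc : Continuous Ψ := by fun_prop
    have hlimΨ : Tendsto (fun t => (Ψ (Y t θ₂ 2) - Ψ (Y t θ₁ 2)) ^ 2) (𝓝[>] a)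
        (𝓝 ((Ψ hp - Ψ hm) ^ 2)) :=
      (((hΨc.tendsto _).comp ht₂).sub ((hΨc.tendsto _).comp ht₁)).pow 2
    have hpos : 0 < (Ψ hp - Ψ hm) ^ 2 := by
      have : Ψ hp - Ψ hm = (hp - hm) ^ 3 / 6 := by simp only [hΨ]; ring
      rw [this]
      have : 0 < hp - hm := sub_pos.2 hmp
      positivity
    set κ := (Ψ hp - Ψ hm) ^ 2 / 2 with hκ
    have hκ0 : 0 < κ := by positivity
    have hevκ : ∀ᶠ t in 𝓝[>] a, κ < (Ψ (Y t θ₂ 2) - Ψ (Y t θ₁ 2)) ^ 2 :=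
      hlimΨ.eventually (lt_mem_nhds (by rw [hκ]; linarith))
    obtain ⟨l, hl1, hl2⟩ := mem_nhdsGT_iff_exists_Ioo_subset.1
      (hevκ.and (Ioo_mem_nhdsGT hab : ∀ᶠ t in 𝓝[>] a, t ∈ Ioo a b))
    have hJtop : ∫⁻ t in Ioo a l, J t = ∞ := by
      refine lintegral_eq_top_of_inv_sub_le hl1
        (C := ENNReal.ofReal (κ⁻¹ * (hp - hm) ^ 2) * D)
        (ENNReal.mul_ne_top ENNReal.ofReal_ne_top het) ?_
      intro t ht
      have htab := (hl2 ht).2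
      have hta : 0 < t - a := sub_pos.2 ht.1
      have hcYt : Continuous (Y t) :=
        continuous_iff_continuousAt.2 fun θ => (hYθ t htab θ).continuousAt
      have hcY2 : Continuous (fun θ => Y t θ 2) := by fun_prop
      have hcYθ : Continuous (fun θ => Yθ t θ 2) := by
        have := continuous_slice hcθ htab
        fun_prop
      have h3 := sq_sub_cubic_le (hm := hm) (hp := hp) (u := fun θ => Y t θ 2)
        (u' := fun θ => Yθ t θ 2)
        (fun θ => ((EuclideanSpace.proj (𝕜 := ℝ) (2 : Fin 3)).hasFDerivAt.comp_hasDerivAt θ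
          (hYθ t htab θ))) hcYθ h₁ h₂
      have h4 : κ ≤ _ := (hl2 ht).1.le.trans h3
      have hconv : ∀ {f : ℝ → ℝ}, Continuous f →
          ENNReal.ofReal (∫ θ in (0 : ℝ)..(2 * Real.pi), f θ ^ 2) =
            ∫⁻ θ in Ioc 0 (2 * Real.pi), ENNReal.ofReal (f θ ^ 2) := by
        intro f hf
        rw [intervalIntegral.integral_of_le (by positivity), ofReal_integral_eq_lintegral_ofReal]
        · exact (Continuous.integrableOn_Icc (by fun_prop)).mono_set Ioc_subset_Icc_self
        · exact Eventually.of_forall fun θ => sq_nonneg _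
      have h5 : ENNReal.ofReal (∫ θ in (0 : ℝ)..(2 * Real.pi),
          ((Y t θ 2 - hm) * (hp - Y t θ 2)) ^ 2) ≤
            ENNReal.ofReal ((hp - hm) ^ 2 * (t - a)) * D := by
        rw [hconv (f := fun θ => (Y t θ 2 - hm) * (hp - Y t θ 2)) (by fun_prop), ← hswap,
          ← lintegral_const_mul' _ _ ENNReal.ofReal_ne_top]
        exact lintegral_mono_ae (hgood.mono fun θ hθ => hweight θ hθ t htab)
      have h6 : ENNReal.ofReal (∫ θ in (0 : ℝ)..(2 * Real.pi), Yθ t θ 2 ^ 2) ≤ J t := by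
        rw [hconv hcYθ]
        refine lintegral_mono fun θ => ?_
        rw [← sq_abs, ENNReal.ofReal_pow (abs_nonneg _), ← ofReal_norm]
        gcongr
        simpa using PiLp.norm_apply_le (Yθ t θ) 2
      have h7 : ENNReal.ofReal κ ≤ ENNReal.ofReal ((hp - hm) ^ 2 * (t - a)) * D * J t := by
        refine (ENNReal.ofReal_le_ofReal h4).trans ?_
        rw [ENNReal.ofReal_mul (intervalIntegral.integral_nonneg (by positivity)
          fun θ _ => sq_nonneg _)]
        gcongr
      calc ENNReal.ofReal ((t - a)⁻¹)
          = ENNReal.ofReal (κ⁻¹ * (t - a)⁻¹) * ENNReal.ofReal κ := by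
            rw [← ENNReal.ofReal_mul (by positivity)]
            congr 1; field_simp
        _ ≤ ENNReal.ofReal (κ⁻¹ * (t - a)⁻¹) *
            (ENNReal.ofReal ((hp - hm) ^ 2 * (t - a)) * D * J t) := by gcongr
        _ = ENNReal.ofReal (κ⁻¹ * (hp - hm) ^ 2) * D * J t := by
            rw [← mul_assoc, ← mul_assoc, ← ENNReal.ofReal_mul (by positivity)]
            congr 3; field_simp
    refine heθ (top_le_iff.1 ?_)
    rw [← hJtop]
    exact lintegral_mono_set fun t ht => (hl2 ht).2
  by_cases hA : ∃ θ ∈ Ioc 0 (2 * Real.pi), Tendsto (fun t => Y t θ 2) (𝓝[>] a) (𝓝 hm)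
  · obtain ⟨θ₁, h₁, ht₁⟩ := hA
    refine ⟨hm, Or.inl rfl, ?_⟩
    filter_upwards [hgood, ae_restrict_mem measurableSet_Ioc] with θ hθ hθm
    exact (hlim θ hθ).resolve_right fun h => hnot θ₁ h₁ θ hθm ht₁ h
  · push Not at hA
    refine ⟨hp, Or.inr rfl, ?_⟩
    filter_upwards [hgood, ae_restrict_mem measurableSet_Ioc] with θ hθ hθm
    exact (hlim θ hθ).resolve_left (hA θ hθm)

/-! ### Harmonic functions on a strip -/

/-- The vertical strip `a < Re ζ < b`; it covers the annulus `e^a < |z| < e^b` by the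
exponential map. -/
def vstrip (a b : ℝ) : Set ℂ := {ζ | a < ζ.re ∧ ζ.re < b}

/-- The point `t + iθ`: logarithmic polar coordinates. -/
noncomputable def logPt (t θ : ℝ) : ℂ := (t : ℂ) + (θ : ℂ) * Complex.I

@[simp] theorem logPt_re (t θ : ℝ) : (logPt t θ).re = t := by simp [logPt]

theorem logPt_re_im (ζ : ℂ) : logPt ζ.re ζ.im = ζ := by simp [logPt]

theorem logPt_add_two_pi (t θ : ℝ) :
    logPt t (θ + 2 * Real.pi) = logPt t θ + 2 * Real.pi * Complex.I := by
  simp only [logPt]; push_cast; ring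

theorem logPt_mem_vstrip {a b t θ : ℝ} : logPt t θ ∈ vstrip a b ↔ t ∈ Ioo a b := by
  simp [vstrip]

theorem isOpen_vstrip (a b : ℝ) : IsOpen (vstrip a b) :=
  (isOpen_lt continuous_const Complex.continuous_re).inter
    (isOpen_lt Complex.continuous_re continuous_const)

theorem convex_vstrip (a b : ℝ) : Convex ℝ (vstrip a b) :=
  (convex_Ioo a b).linear_preimage Complex.reLm

theorem continuous_logPt : Continuous fun p : ℝ × ℝ => logPt p.1 p.2 := by
  unfold logPt; fun_prop

theorem ContinuousOn.comp_logPt {E : Type*} [TopologicalSpace E] {a b : ℝ} {f : ℂ → E}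
    (hf : ContinuousOn f (vstrip a b)) :
    ContinuousOn (fun p : ℝ × ℝ => f (logPt p.1 p.2)) (Ioo a b ×ˢ univ) :=
  hf.comp continuous_logPt.continuousOn fun _ hp => logPt_mem_vstrip.2 hp.1

theorem hasDerivAt_logPt_left (t θ : ℝ) : HasDerivAt (fun s => logPt s θ) 1 t :=
  Complex.ofRealCLM.hasDerivAt.add_const _

theorem hasDerivAt_logPt_right (t θ : ℝ) : HasDerivAt (fun s => logPt t s) Complex.I θ := by
  exact ((Complex.ofRealCLM.hasDerivAt.mul_const Complex.I).const_add (t : ℂ)).congr_deriv (by simp)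

theorem HasDerivAt.comp_logPt_left {G : ℂ → ℂ} {g : ℂ} {t θ : ℝ} (h : HasDerivAt G g (logPt t θ)) :
    HasDerivAt (fun s => G (logPt s θ)) g t := by
  simpa [Function.comp_def] using
    (h.hasFDerivAt.restrictScalars ℝ).comp_hasDerivAt t (hasDerivAt_logPt_left t θ)

theorem HasDerivAt.comp_logPt_right {G : ℂ → ℂ} {g : ℂ} {t θ : ℝ}
    (h : HasDerivAt G g (logPt t θ)) :
    HasDerivAt (fun s => G (logPt t s)) (Complex.I * g) θ := by
  simpa [Function.comp_def] using
    (h.hasFDerivAt.restrictScalars ℝ).comp_hasDerivAt θ (hasDerivAt_logPt_right t θ)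

/-- The real linear form `v ↦ Re (φ v)`. The differential of a real function `U` has this form with
`φ = ∂U/∂x - i ∂U/∂y`, and `φ` is holomorphic if `U` is harmonic. -/
noncomputable def reMul (φ : ℂ) : ℂ →L[ℝ] ℝ := Complex.reCLM ∘L ContinuousLinearMap.mul ℝ ℂ φ

@[simp] theorem reMul_apply (φ v : ℂ) : reMul φ v = (φ * v).re := rfl

theorem HasFDerivAt.comp_logPt_left {U : ℂ → ℝ} {φ : ℂ} {t θ : ℝ}
    (h : HasFDerivAt U (reMul φ) (logPt t θ)) : HasDerivAt (fun s => U (logPt s θ)) φ.re t := by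
  simpa [Function.comp_def] using h.comp_hasDerivAt t (hasDerivAt_logPt_left t θ)

theorem HasFDerivAt.comp_logPt_right {U : ℂ → ℝ} {φ : ℂ} {t θ : ℝ}
    (h : HasFDerivAt U (reMul φ) (logPt t θ)) : HasDerivAt (fun s => U (logPt t s)) (-φ.im) θ := by
  simpa [Function.comp_def] using h.comp_hasDerivAt θ (hasDerivAt_logPt_right t θ)

theorem HasDerivAt.complex_re {f : ℝ → ℂ} {f' : ℂ} {x : ℝ} (h : HasDerivAt f f' x) :
    HasDerivAt (fun s => (f s).re) f'.re x :=
  Complex.reCLM.hasFDerivAt.comp_hasDerivAt x h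

theorem HasDerivAt.complex_im {f : ℝ → ℂ} {f' : ℂ} {x : ℝ} (h : HasDerivAt f f' x) :
    HasDerivAt (fun s => (f s).im) f'.im x :=
  Complex.imCLM.hasFDerivAt.comp_hasDerivAt x h

/-- A nonnegative convex function on an open interval which tends to zero at both ends vanishes. -/
theorem eq_zero_of_convex_of_tendsto_zero {a b : ℝ} {f f' f'' : ℝ → ℝ}
    (hf : ∀ t ∈ Ioo a b, HasDerivAt f (f' t) t) (hf' : ∀ t ∈ Ioo a b, HasDerivAt f' (f'' t) t)
    (h2 : ∀ t ∈ Ioo a b, 0 ≤ f'' t) (h0 : ∀ t ∈ Ioo a b, 0 ≤ f t)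
    (ha : Tendsto f (𝓝[>] a) (𝓝 0)) (hb : Tendsto f (𝓝[<] b) (𝓝 0)) {t : ℝ} (ht : t ∈ Ioo a b) :
    f t = 0 := by
  by_contra hne
  have hpos : 0 < f t := lt_of_le_of_ne (h0 t ht) (Ne.symm hne)
  have hmono : MonotoneOn f' (Ioo a b) := by
    apply monotoneOn_of_hasDerivWithinAt_nonneg (convex_Ioo _ _) (f' := f'')
    · exact fun s hs => (hf' s hs).continuousAt.continuousWithinAt
    · exact fun s hs => (hf' s (interior_subset hs)).hasDerivWithinAt
    · exact fun s hs => h2 s (interior_subset hs)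
  obtain ⟨s, hs1, hs2⟩ := ((ha.eventually (gt_mem_nhds hpos)).and (Ioo_mem_nhdsGT ht.1)).exists
  obtain ⟨u, hu1, hu2⟩ := ((hb.eventually (gt_mem_nhds hpos)).and (Ioo_mem_nhdsLT ht.2)).exists
  have hsub1 : Icc s t ⊆ Ioo a b := fun r hr => ⟨hs2.1.trans_le hr.1, hr.2.trans_lt ht.2⟩
  have hsub2 : Icc t u ⊆ Ioo a b := fun r hr => ⟨ht.1.trans_le hr.1, hr.2.trans_lt hu2.2⟩
  obtain ⟨x, hx, hxe⟩ := exists_hasDerivAt_eq_slope f f' hs2.2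
    (fun r hr => (hf r (hsub1 hr)).continuousAt.continuousWithinAt)
    (fun r hr => hf r (hsub1 (Ioo_subset_Icc_self hr)))
  obtain ⟨y, hy, hye⟩ := exists_hasDerivAt_eq_slope f f' hu2.1
    (fun r hr => (hf r (hsub2 hr)).continuousAt.continuousWithinAt)
    (fun r hr => hf r (hsub2 (Ioo_subset_Icc_self hr)))
  have hx0 : 0 < f' x := by rw [hxe]; exact div_pos (by linarith) (by linarith [hs2.2])
  have hy0 : f' y < 0 := by rw [hye]; exact div_neg_of_neg_of_pos (by linarith) (by linarith [hu2.1])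
  have := hmono (hsub1 (Ioo_subset_Icc_self hx)) (hsub2 (Ioo_subset_Icc_self hy))
    (hx.2.trans hy.1).le
  linarith

theorem tendsto_integral_sq_angle {l : Filter ℝ} [l.IsCountablyGenerated] {w : ℝ → ℝ → ℝ} {M : ℝ}
    (hc : ∀ᶠ t in l, Continuous (w t)) (hM : ∀ᶠ t in l, ∀ θ, |w t θ| ≤ M)
    (hw : ∀ᵐ θ ∂(volume.restrict (Ioc 0 (2 * Real.pi))), Tendsto (fun t => w t θ) l (𝓝 0)) :
    Tendsto (fun t => ∫ θ in (0 : ℝ)..(2 * Real.pi), w t θ ^ 2) l (𝓝 0) := by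
  have h0 : (0 : ℝ) = ∫ θ in (0 : ℝ)..(2 * Real.pi), (0 : ℝ) := by simp
  nth_rewrite 2 [h0]
  refine intervalIntegral.tendsto_integral_filter_of_dominated_convergence (fun _ => M ^ 2) ?_ ?_
    (by simp) ?_
  · exact hc.mono fun t ht => (ht.pow 2).aestronglyMeasurable
  · filter_upwards [hM] with t ht
    refine Eventually.of_forall fun θ _ => ?_
    rw [Real.norm_eq_abs, abs_pow]
    exact pow_le_pow_left₀ (abs_nonneg _) (ht θ) 2
  · rw [uIoc_of_le (by positivity)]
    filter_upwards [(ae_restrict_iff' measurableSet_Ioc).1 hw] with θ hθ hm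
    simpa using (hθ hm).pow 2

/-- A bounded harmonic function on a strip, periodic in the angle, with constant boundary values
almost everywhere on both sides depends on `Re ζ` only: the mean over circles of the square of the
difference to the linear interpolation is convex in `t` and tends to zero at the ends. -/
theorem eq_interpolation_of_ae_tendsto {a b c₀ c₁ M : ℝ} (hab : a < b) {U : ℂ → ℝ} {Φ : ℂ → ℂ}
    (hΦ : DifferentiableOn ℂ Φ (vstrip a b))
    (hU : ∀ ζ ∈ vstrip a b, HasFDerivAt U (reMul (Φ ζ)) ζ)
    (hper : ∀ ζ, U (ζ + 2 * Real.pi * Complex.I) = U ζ)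
    (hΦper : ∀ ζ, Φ (ζ + 2 * Real.pi * Complex.I) = Φ ζ)
    (hM : ∀ ζ ∈ vstrip a b, |U ζ| ≤ M)
    (h₀ : ∀ᵐ θ ∂(volume.restrict (Ioc 0 (2 * Real.pi))),
      Tendsto (fun t => U (logPt t θ)) (𝓝[>] a) (𝓝 c₀))
    (h₁ : ∀ᵐ θ ∂(volume.restrict (Ioc 0 (2 * Real.pi))),
      Tendsto (fun t => U (logPt t θ)) (𝓝[<] b) (𝓝 c₁)) {ζ : ℂ} (hζ : ζ ∈ vstrip a b) :
    U ζ = c₀ + (c₁ - c₀) / (b - a) * (ζ.re - a) := by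
  set α : ℝ := (c₁ - c₀) / (b - a) with hα
  set ℓ : ℝ → ℝ := fun t => c₀ + α * (t - a) with hℓ
  set w : ℝ → ℝ → ℝ := fun t θ => U (logPt t θ) - ℓ t with hw
  have hmem : ∀ {t : ℝ}, t ∈ Ioo a b → ∀ θ, logPt t θ ∈ vstrip a b := fun ht θ =>
    logPt_mem_vstrip.2 ht
  have hUc : ContinuousOn U (vstrip a b) := fun ζ hζ => (hU ζ hζ).continuousAt.continuousWithinAt
  have hΦd : ∀ ζ ∈ vstrip a b, HasDerivAt Φ (deriv Φ ζ) ζ := fun ζ hζ =>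
    (hΦ.differentiableAt ((isOpen_vstrip a b).mem_nhds hζ)).hasDerivAt
  have hΦ'c : ContinuousOn (deriv Φ) (vstrip a b) := (hΦ.deriv (isOpen_vstrip a b)).continuousOn
  have hUp := hUc.comp_logPt
  have hΦp := hΦ.continuousOn.comp_logPt
  have hΦ'p := hΦ'c.comp_logPt
  have hℓd : ∀ t, HasDerivAt ℓ α t := fun t =>
    ((((hasDerivAt_id t).sub_const a).const_mul α).const_add c₀).congr_deriv (by simp)
  have hℓc : Continuous ℓ := by fun_prop
  have hwt : ∀ t ∈ Ioo a b, ∀ θ, HasDerivAt (fun s => w s θ) ((Φ (logPt t θ)).re - α) t :=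
    fun t ht θ => (hU _ (hmem ht θ)).comp_logPt_left.sub (hℓd t)
  have hwθ : ∀ t ∈ Ioo a b, ∀ θ, HasDerivAt (w t) (-(Φ (logPt t θ)).im) θ :=
    fun t ht θ => (hU _ (hmem ht θ)).comp_logPt_right.sub_const _
  have hwc : ∀ t ∈ Ioo a b, Continuous (w t) := fun t ht =>
    continuous_iff_continuousAt.2 fun θ => (hwθ t ht θ).continuousAt
  have hwp : ContinuousOn (fun p : ℝ × ℝ => w p.1 p.2) (Ioo a b ×ˢ univ) :=
    hUp.sub (by fun_prop)
  set f : ℝ → ℝ := fun t => ∫ θ in (0 : ℝ)..(2 * Real.pi), w t θ ^ 2 with hf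
  have hfd : ∀ t ∈ Ioo a b, HasDerivAt f
      (∫ θ in (0 : ℝ)..(2 * Real.pi), 2 * w t θ * ((Φ (logPt t θ)).re - α)) t := by
    intro t ht
    refine hasDerivAt_integral_angle (F := fun t θ => w t θ ^ 2)
      (F' := fun t θ => 2 * w t θ * ((Φ (logPt t θ)).re - α)) (fun s hs θ => ?_)
      (fun s hs => (hwc s hs).pow 2) ?_ ht
    · exact ((hwt s hs θ).pow 2).congr_deriv (by push_cast; ring)
    · exact (continuousOn_const.mul hwp).mul
        ((Complex.continuous_re.comp_continuousOn hΦp).sub continuousOn_const)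
  have hfd2 : ∀ t ∈ Ioo a b, HasDerivAt
      (fun t => ∫ θ in (0 : ℝ)..(2 * Real.pi), 2 * w t θ * ((Φ (logPt t θ)).re - α))
      (∫ θ in (0 : ℝ)..(2 * Real.pi),
        ((2 * ((Φ (logPt t θ)).re - α) ^ 2 + 2 * w t θ * (deriv Φ (logPt t θ)).re) +
          (2 * (Φ (logPt t θ)).im ^ 2 - 2 * w t θ * (deriv Φ (logPt t θ)).re))) t := by
    intro t ht
    have hsl : ∀ s ∈ Ioo a b, Continuous (fun θ => Φ (logPt s θ)) := fun s hs =>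
      continuous_slice (F := fun s θ => Φ (logPt s θ)) hΦp hs
    have hsl' : ∀ s ∈ Ioo a b, Continuous (fun θ => deriv Φ (logPt s θ)) := fun s hs =>
      continuous_slice (F := fun s θ => deriv Φ (logPt s θ)) hΦ'p hs
    refine hasDerivAt_integral_laplacian
      (Ft := fun t θ => 2 * w t θ * ((Φ (logPt t θ)).re - α))
      (Ftt := fun t θ => 2 * ((Φ (logPt t θ)).re - α) ^ 2 + 2 * w t θ * (deriv Φ (logPt t θ)).re)
      (Fθ := fun t θ => 2 * w t θ * -(Φ (logPt t θ)).im)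
      (Fθθ := fun t θ => 2 * (Φ (logPt t θ)).im ^ 2 - 2 * w t θ * (deriv Φ (logPt t θ)).re)
      (fun s hs θ => ?_) (fun s hs => ?_) ?_ (fun s hs θ => ?_) (fun s hs => ?_) (fun s hs => ?_) ht
    · have h1 := (hΦd _ (hmem hs θ)).comp_logPt_left.complex_re.sub_const α
      exact (((hwt s hs θ).const_mul 2).mul h1).congr_deriv (by ring)
    · exact (continuous_const.mul (hwc s hs)).mul
        ((Complex.continuous_re.comp (hsl s hs)).sub continuous_const)
    · have h1 := Complex.continuous_re.comp_continuousOn hΦp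
      have h2 := Complex.continuous_re.comp_continuousOn hΦ'p
      exact (continuousOn_const.mul ((h1.sub continuousOn_const).pow 2)).add
        ((continuousOn_const.mul hwp).mul h2)
    · have h1 : HasDerivAt (fun s' => -(Φ (logPt s s')).im)
          (-(Complex.I * deriv Φ (logPt s θ)).im) θ :=
        (hΦd _ (hmem hs θ)).comp_logPt_right.complex_im.neg
      refine (((hwθ s hs θ).const_mul 2).mul h1).congr_deriv ?_
      simp only [Complex.mul_im, Complex.I_re, Complex.I_im]
      ring
    · exact (continuous_const.mul ((Complex.continuous_im.comp (hsl s hs)).pow 2)).sub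
        ((continuous_const.mul (hwc s hs)).mul (Complex.continuous_re.comp (hsl' s hs)))
    · have e : logPt s (2 * Real.pi) = logPt s 0 + 2 * Real.pi * Complex.I := by
        rw [← logPt_add_two_pi, zero_add]
      simp only [hw, e, hper, hΦper]
  have hM' : ∀ t ∈ Ioo a b, ∀ θ, |w t θ| ≤ M + (|c₀| + |α| * (b - a)) := by
    intro t ht θ
    have h1 := hM _ (hmem ht θ)
    have h2 : |ℓ t| ≤ |c₀| + |α| * (b - a) := by
      refine (abs_add_le _ _).trans ?_
      rw [abs_mul, abs_of_pos (sub_pos.2 ht.1)]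
      have := ht.2.le
      gcongr
    exact (abs_sub _ _).trans (add_le_add h1 h2)
  have hba : b - a ≠ 0 := (sub_pos.2 hab).ne'
  have hlima : Tendsto f (𝓝[>] a) (𝓝 0) := by
    have hev : ∀ᶠ t in 𝓝[>] a, t ∈ Ioo a b := Ioo_mem_nhdsGT hab
    refine tendsto_integral_sq_angle (hev.mono hwc) (hev.mono hM') (h₀.mono fun θ hθ => ?_)
    have h1 : Tendsto ℓ (𝓝[>] a) (𝓝 c₀) := by
      have := tendsto_nhdsWithin_of_tendsto_nhds (s := Ioi a) (hℓc.tendsto a)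
      simpa [hℓ] using this
    simpa using hθ.sub h1
  have hlimb : Tendsto f (𝓝[<] b) (𝓝 0) := by
    have hev : ∀ᶠ t in 𝓝[<] b, t ∈ Ioo a b := Ioo_mem_nhdsLT hab
    refine tendsto_integral_sq_angle (hev.mono hwc) (hev.mono hM') (h₁.mono fun θ hθ => ?_)
    have h1 : Tendsto ℓ (𝓝[<] b) (𝓝 c₁) := by
      have := tendsto_nhdsWithin_of_tendsto_nhds (s := Iio b) (hℓc.tendsto b)
      have e : ℓ b = c₁ := by simp only [hℓ, hα]; field_simp; ring
      rwa [e] at this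
    simpa using hθ.sub h1
  have hf0 : ∀ t ∈ Ioo a b, f t = 0 := fun t ht =>
    eq_zero_of_convex_of_tendsto_zero hfd hfd2
      (fun s _ => intervalIntegral.integral_nonneg (by positivity) fun θ _ => by
        have : 0 ≤ 2 * ((Φ (logPt s θ)).re - α) ^ 2 + 2 * (Φ (logPt s θ)).im ^ 2 := by positivity
        linarith)
      (fun s _ => intervalIntegral.integral_nonneg (by positivity) fun θ _ => sq_nonneg _)
      hlima hlimb ht
  have hw0 : ∀ t ∈ Ioo a b, ∀ θ ∈ Icc 0 (2 * Real.pi), w t θ = 0 := by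
    intro t ht θ hθ
    by_contra hne
    have := intervalIntegral.integral_pos (by positivity : (0 : ℝ) < 2 * Real.pi)
      ((hwc t ht).pow 2).continuousOn (fun _ _ => sq_nonneg _) ⟨θ, hθ, sq_pos_iff.2 hne⟩
    exact this.ne' (hf0 t ht)
  have hwper : Function.Periodic (w ζ.re) (2 * Real.pi) := fun θ => by
    simp only [hw, logPt_add_two_pi, hper]
  obtain ⟨θ, hθ, hθe⟩ := hwper.exists_mem_Ico₀ (by positivity) ζ.im
  have h3 := hw0 ζ.re hζ θ (Ico_subset_Icc_self hθ)
  rw [← hθe] at h3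
  simp only [hw, hℓ, logPt_re_im] at h3
  linarith

/-! ### Holomorphic functions on a strip: square roots and quadratic means -/

theorem add_two_pi_mem_vstrip {a b : ℝ} {ζ : ℂ} (hζ : ζ ∈ vstrip a b) :
    ζ + 2 * Real.pi * Complex.I ∈ vstrip a b := by
  simpa [vstrip] using hζ

theorem eq_of_deriv_eq_zero_vstrip {a b : ℝ} {f : ℂ → ℂ}
    (hf : ∀ ζ ∈ vstrip a b, HasDerivAt f 0 ζ) {z w : ℂ} (hz : z ∈ vstrip a b)
    (hw : w ∈ vstrip a b) : f z = f w :=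
  (convex_vstrip a b).is_const_of_fderivWithin_eq_zero (𝕜 := ℂ)
    (fun ζ hζ => (hf ζ hζ).differentiableAt.differentiableWithinAt)
    (fun ζ hζ => by
      rw [fderivWithin_of_isOpen (isOpen_vstrip a b) hζ]
      ext; simp [(hf ζ hζ).deriv]) hz hw

/-- A zero-free holomorphic function on a strip has a holomorphic logarithm. -/
theorem exists_log_vstrip {a b : ℝ} {p : ℂ → ℂ} (hp : DifferentiableOn ℂ p (vstrip a b))
    (hne : ∀ ζ ∈ vstrip a b, p ζ ≠ 0) :
    ∃ f : ℂ → ℂ, DifferentiableOn ℂ f (vstrip a b) ∧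
      (∀ ζ ∈ vstrip a b, HasDerivAt f (deriv p ζ / p ζ) ζ) ∧
      ∀ ζ ∈ vstrip a b, p ζ = Complex.exp (f ζ) := by
  rcases (vstrip a b).eq_empty_or_nonempty with hemp | ⟨ζ₀, hζ₀⟩
  · exact ⟨0, by simp [hemp], by simp [hemp], by simp [hemp]⟩
  have hopen := isOpen_vstrip a b
  have hpd : ∀ ζ ∈ vstrip a b, HasDerivAt p (deriv p ζ) ζ := fun ζ hζ =>
    (hp.differentiableAt (hopen.mem_nhds hζ)).hasDerivAt
  obtain ⟨g, hg⟩ := (convex_vstrip a b).exists_forall_hasDerivWithinAt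
    (f := fun ζ => deriv p ζ / p ζ) ((hp.deriv hopen).div hp hne)
  have hg' : ∀ ζ ∈ vstrip a b, HasDerivAt g (deriv p ζ / p ζ) ζ := fun ζ hζ =>
    (hg ζ hζ).hasDerivAt (hopen.mem_nhds hζ)
  -- a primitive `g` of `p'/p` is a logarithm of `p` up to a constant
  have hconst : ∀ ζ ∈ vstrip a b, HasDerivAt (fun ζ => p ζ * Complex.exp (-g ζ)) 0 ζ := by
    intro ζ hζ
    refine ((hpd ζ hζ).mul (hg' ζ hζ).neg.cexp).congr_deriv ?_
    have := hne ζ hζ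
    simp only [Pi.neg_apply]
    field_simp
    ring
  set c := p ζ₀ * Complex.exp (-g ζ₀) with hc
  have hc0 : c ≠ 0 := mul_ne_zero (hne _ hζ₀) (Complex.exp_ne_zero _)
  refine ⟨fun ζ => g ζ + Complex.log c, fun ζ hζ =>
    ((hg' ζ hζ).add_const _).differentiableAt.differentiableWithinAt,
    fun ζ hζ => (hg' ζ hζ).add_const _, fun ζ hζ => ?_⟩
  have h1 : p ζ * Complex.exp (-g ζ) = c := eq_of_deriv_eq_zero_vstrip hconst hζ hζ₀
  rw [Complex.exp_add, Complex.exp_log hc0, ← h1, Complex.exp_neg]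
  field_simp [Complex.exp_ne_zero]

/-- Two continuous branches of the argument of the same function on an interval have the same
increment. -/
theorem sub_eq_sub_of_exp_eq {x y : ℝ} (hxy : x ≤ y) {A B : ℝ → ℝ} (hA : ContinuousOn A (Icc x y))
    (hB : ContinuousOn B (Icc x y))
    (h : ∀ θ ∈ Icc x y, Complex.exp ((A θ : ℂ) * Complex.I) = Complex.exp ((B θ : ℂ) * Complex.I)) :
    A y - A x = B y - B x := by
  -- the difference is continuous with values in the discrete group `2πℤ`
  have hmaps : MapsTo (fun θ => A θ - B θ) (Icc x y)
      (AddSubgroup.zmultiples (2 * Real.pi) : Set ℝ) := by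
    intro θ hθ
    obtain ⟨n, hn⟩ := Complex.exp_eq_exp_iff_exists_int.1 (h θ hθ)
    refine ⟨n, ?_⟩
    have h1 : (A θ : ℂ) = B θ + n * (2 * Real.pi) := by
      have := congrArg (fun z => z * -Complex.I) hn
      ring_nf at this
      simp only [Complex.I_sq] at this
      linear_combination this
    have h2 : A θ = B θ + n * (2 * Real.pi) := by exact_mod_cast h1
    simp only [zsmul_eq_mul]
    linarith
  have h2 : A x - B x = A y - B y :=
    isPreconnected_Icc.constant_of_mapsTo
      ⟨inferInstanceAs (DiscreteTopology (AddSubgroup.zmultiples (2 * Real.pi)))⟩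
      (hA.sub hB) hmaps (left_mem_Icc.2 hxy) (right_mem_Icc.2 hxy)
  linarith

/-- A zero-free holomorphic function on a strip, periodic with period `2πi` and with winding number
zero along a period, has a holomorphic square root with the same period. -/
theorem exists_periodic_sqrt {a b t₀ : ℝ} {p : ℂ → ℂ} (hp : DifferentiableOn ℂ p (vstrip a b))
    (hne : ∀ ζ ∈ vstrip a b, p ζ ≠ 0)
    (hper : ∀ ζ, p (ζ + 2 * Real.pi * Complex.I) = p ζ)
    (ht₀ : t₀ ∈ Ioo a b) {A : ℝ → ℝ} (hA : ContinuousOn A (Icc 0 (2 * Real.pi)))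
    (hpA : ∀ θ ∈ Icc 0 (2 * Real.pi),
      p (logPt t₀ θ) = (‖p (logPt t₀ θ)‖ : ℂ) * Complex.exp ((A θ : ℂ) * Complex.I))
    (hA0 : A (2 * Real.pi) = A 0) :
    ∃ G : ℂ → ℂ, DifferentiableOn ℂ G (vstrip a b) ∧ (∀ ζ ∈ vstrip a b, G ζ ^ 2 = p ζ) ∧
      ∀ ζ ∈ vstrip a b, G (ζ + 2 * Real.pi * Complex.I) = G ζ := by
  obtain ⟨f, hf, hfd, hfe⟩ := exists_log_vstrip hp hne
  have hmem : ∀ θ, logPt t₀ θ ∈ vstrip a b := fun θ => logPt_mem_vstrip.2 ht₀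
  have hp' : ∀ ζ ∈ vstrip a b, deriv p (ζ + 2 * Real.pi * Complex.I) = deriv p ζ := by
    intro ζ _
    have : (fun ζ => p (ζ + 2 * Real.pi * Complex.I)) = p := funext hper
    rw [← deriv_comp_add_const, this]
  have hD : ∀ ζ ∈ vstrip a b,
      HasDerivAt (fun ζ => f (ζ + 2 * Real.pi * Complex.I) - f ζ) 0 ζ := by
    intro ζ hζ
    have h1 := (hfd _ (add_two_pi_mem_vstrip hζ)).comp_add_const ζ (2 * Real.pi * Complex.I)
    refine (h1.sub (hfd ζ hζ)).congr_deriv ?_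
    rw [hp' ζ hζ, hper, sub_self]
  have hcont : Continuous fun θ => f (logPt t₀ θ) :=
    continuous_slice (F := fun t θ => f (logPt t θ)) hf.continuousOn.comp_logPt ht₀
  have him := sub_eq_sub_of_exp_eq (x := 0) (y := 2 * Real.pi) (by positivity)
    (A := fun θ => (f (logPt t₀ θ)).im) (B := A)
    (Complex.continuous_im.comp hcont).continuousOn hA (by
      intro θ hθ
      have h1 := hpA θ hθ
      have h2 : Complex.exp (f (logPt t₀ θ)) = (‖p (logPt t₀ θ)‖ : ℂ) *
          Complex.exp (((f (logPt t₀ θ)).im : ℂ) * Complex.I) := by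
        rw [hfe _ (hmem θ), Complex.norm_exp, Complex.ofReal_exp, ← Complex.exp_add,
          Complex.re_add_im]
      rw [← hfe _ (hmem θ), h1] at h2
      have h3 : (‖p (logPt t₀ θ)‖ : ℂ) ≠ 0 := by simpa using hne _ (hmem θ)
      rw [← h1] at h2
      have h4 := h2.symm.trans h1
      exact mul_left_cancel₀ h3 h4)
  have e : logPt t₀ (2 * Real.pi) = logPt t₀ 0 + 2 * Real.pi * Complex.I := by
    rw [← logPt_add_two_pi, zero_add]
  have hre : (f (logPt t₀ (2 * Real.pi))).re = (f (logPt t₀ 0)).re := by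
    have h1 := hfe _ (hmem (2 * Real.pi))
    rw [e, hper, hfe _ (hmem 0), ← e] at h1
    have := congrArg norm h1
    rw [Complex.norm_exp, Complex.norm_exp] at this
    exact (Real.exp_injective this).symm
  have hD0 : ∀ ζ ∈ vstrip a b, f (ζ + 2 * Real.pi * Complex.I) = f ζ := by
    intro ζ hζ
    have h1 := eq_of_deriv_eq_zero_vstrip hD hζ (hmem 0)
    have h2 : f (logPt t₀ (2 * Real.pi)) = f (logPt t₀ 0) :=
      Complex.ext hre (by linarith)
    rw [← e, h2, sub_self] at h1
    exact sub_eq_zero.1 h1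
  refine ⟨fun ζ => Complex.exp (f ζ / 2), (hf.div_const 2).cexp, fun ζ hζ => ?_, fun ζ hζ => ?_⟩
  · rw [hfe ζ hζ, ← Complex.exp_nat_mul]
    congr 1
    push_cast
    ring
  · simp only [hD0 ζ hζ]

/-- The quadratic mean over circles of a periodic holomorphic function `G` with `∫ G² = 0`:
its Laplacian is `4 ∫ |G'|²`, which Wirtinger's inequality bounds below. -/
theorem exists_hasDerivAt_integral_norm_sq {a b : ℝ} {G : ℂ → ℂ}
    (hG : DifferentiableOn ℂ G (vstrip a b))
    (hper : ∀ ζ ∈ vstrip a b, G (ζ + 2 * Real.pi * Complex.I) = G ζ)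
    (hsq : ∀ t ∈ Ioo a b, ∫ θ in (0 : ℝ)..(2 * Real.pi), G (logPt t θ) ^ 2 = 0) :
    ∃ I' I'' : ℝ → ℝ,
      (∀ t ∈ Ioo a b, HasDerivAt
        (fun t => ∫ θ in (0 : ℝ)..(2 * Real.pi), ‖G (logPt t θ)‖ ^ 2) (I' t) t) ∧
      (∀ t ∈ Ioo a b, HasDerivAt I' (I'' t) t) ∧
      ∀ t ∈ Ioo a b, 2 * (∫ θ in (0 : ℝ)..(2 * Real.pi), ‖G (logPt t θ)‖ ^ 2) ≤ I'' t := by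
  have hopen := isOpen_vstrip a b
  have hmem : ∀ {t : ℝ}, t ∈ Ioo a b → ∀ θ, logPt t θ ∈ vstrip a b := fun ht θ =>
    logPt_mem_vstrip.2 ht
  set G₁ := deriv G with hG₁
  set G₂ := deriv G₁ with hG₂
  have hG₁d : DifferentiableOn ℂ G₁ (vstrip a b) := hG.deriv hopen
  have hd : ∀ ζ ∈ vstrip a b, HasDerivAt G (G₁ ζ) ζ := fun ζ hζ =>
    (hG.differentiableAt (hopen.mem_nhds hζ)).hasDerivAt
  have hd₁ : ∀ ζ ∈ vstrip a b, HasDerivAt G₁ (G₂ ζ) ζ := fun ζ hζ =>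
    (hG₁d.differentiableAt (hopen.mem_nhds hζ)).hasDerivAt
  have hper₁ : ∀ ζ ∈ vstrip a b, G₁ (ζ + 2 * Real.pi * Complex.I) = G₁ ζ := by
    intro ζ hζ
    have h1 := (hd _ (add_two_pi_mem_vstrip hζ)).comp_add_const ζ (2 * Real.pi * Complex.I)
    have h2 : (fun ζ => G (ζ + 2 * Real.pi * Complex.I)) =ᶠ[𝓝 ζ] G :=
      (hopen.eventually_mem hζ).mono hper
    exact (h1.congr_of_eventuallyEq h2.symm).unique (hd ζ hζ)
  have c0 := hG.continuousOn.comp_logPt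
  have c1 := hG₁d.continuousOn.comp_logPt
  have c2 := (hG₁d.deriv hopen).continuousOn.comp_logPt
  have s0 : ∀ t ∈ Ioo a b, Continuous (fun θ => G (logPt t θ)) := fun t ht =>
    continuous_slice (F := fun t θ => G (logPt t θ)) c0 ht
  have s1 : ∀ t ∈ Ioo a b, Continuous (fun θ => G₁ (logPt t θ)) := fun t ht =>
    continuous_slice (F := fun t θ => G₁ (logPt t θ)) c1 ht
  have s2 : ∀ t ∈ Ioo a b, Continuous (fun θ => G₂ (logPt t θ)) := fun t ht =>
    continuous_slice (F := fun t θ => G₂ (logPt t θ)) c2 ht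
  have r0 := fun t ht => Complex.continuous_re.comp (s0 t ht)
  have i0 := fun t ht => Complex.continuous_im.comp (s0 t ht)
  have r1 := fun t ht => Complex.continuous_re.comp (s1 t ht)
  have i1 := fun t ht => Complex.continuous_im.comp (s1 t ht)
  have r2 := fun t ht => Complex.continuous_re.comp (s2 t ht)
  have i2 := fun t ht => Complex.continuous_im.comp (s2 t ht)
  have R0 := Complex.continuous_re.comp_continuousOn c0
  have I0 := Complex.continuous_im.comp_continuousOn c0
  have R1 := Complex.continuous_re.comp_continuousOn c1
  have I1 := Complex.continuous_im.comp_continuousOn c1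
  have R2 := Complex.continuous_re.comp_continuousOn c2
  have I2 := Complex.continuous_im.comp_continuousOn c2
  have hnorm : ∀ z : ℂ, ‖z‖ ^ 2 = z.re ^ 2 + z.im ^ 2 := fun z => by
    rw [Complex.sq_norm, Complex.normSq_apply]; ring
  refine ⟨fun t => ∫ θ in (0 : ℝ)..(2 * Real.pi),
      2 * ((G (logPt t θ)).re * (G₁ (logPt t θ)).re + (G (logPt t θ)).im * (G₁ (logPt t θ)).im),
    fun t => ∫ θ in (0 : ℝ)..(2 * Real.pi),
      (2 * ((G₁ (logPt t θ)).re ^ 2 + (G₁ (logPt t θ)).im ^ 2 +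
        (G (logPt t θ)).re * (G₂ (logPt t θ)).re + (G (logPt t θ)).im * (G₂ (logPt t θ)).im) +
      2 * ((G₁ (logPt t θ)).re ^ 2 + (G₁ (logPt t θ)).im ^ 2 -
        (G (logPt t θ)).re * (G₂ (logPt t θ)).re - (G (logPt t θ)).im * (G₂ (logPt t θ)).im)),
    fun t ht => ?_, fun t ht => ?_, fun t ht => ?_⟩
  · simp_rw [hnorm]
    refine hasDerivAt_integral_angle
      (F := fun t θ => (G (logPt t θ)).re ^ 2 + (G (logPt t θ)).im ^ 2)
      (F' := fun t θ => 2 * ((G (logPt t θ)).re * (G₁ (logPt t θ)).re +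
        (G (logPt t θ)).im * (G₁ (logPt t θ)).im)) (fun s hs θ => ?_) (fun s hs => ?_) ?_ ht
    · have h := (hd _ (hmem hs θ)).comp_logPt_left
      exact ((h.complex_re.pow 2).add (h.complex_im.pow 2)).congr_deriv (by push_cast; ring)
    · exact ((r0 s hs).pow 2).add ((i0 s hs).pow 2)
    · exact continuousOn_const.mul ((R0.mul R1).add (I0.mul I1))
  · refine hasDerivAt_integral_laplacian
      (Ft := fun t θ => 2 * ((G (logPt t θ)).re * (G₁ (logPt t θ)).re +
        (G (logPt t θ)).im * (G₁ (logPt t θ)).im))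
      (Ftt := fun t θ => 2 * ((G₁ (logPt t θ)).re ^ 2 + (G₁ (logPt t θ)).im ^ 2 +
        (G (logPt t θ)).re * (G₂ (logPt t θ)).re + (G (logPt t θ)).im * (G₂ (logPt t θ)).im))
      (Fθ := fun t θ => 2 * (-(G (logPt t θ)).re * (G₁ (logPt t θ)).im +
        (G (logPt t θ)).im * (G₁ (logPt t θ)).re))
      (Fθθ := fun t θ => 2 * ((G₁ (logPt t θ)).re ^ 2 + (G₁ (logPt t θ)).im ^ 2 -
        (G (logPt t θ)).re * (G₂ (logPt t θ)).re - (G (logPt t θ)).im * (G₂ (logPt t θ)).im))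
      (fun s hs θ => ?_) (fun s hs => ?_) ?_ (fun s hs θ => ?_) (fun s hs => ?_) (fun s hs => ?_) ht
    · have h := (hd _ (hmem hs θ)).comp_logPt_left
      have h1 := (hd₁ _ (hmem hs θ)).comp_logPt_left
      exact (((h.complex_re.mul h1.complex_re).add (h.complex_im.mul h1.complex_im)).const_mul
        2).congr_deriv (by ring)
    · exact continuous_const.mul (((r0 s hs).mul (r1 s hs)).add ((i0 s hs).mul (i1 s hs)))
    · exact continuousOn_const.mul ((((R1.pow 2).add (I1.pow 2)).add (R0.mul R2)).add (I0.mul I2))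
    · have h := (hd _ (hmem hs θ)).comp_logPt_right
      have h1 := (hd₁ _ (hmem hs θ)).comp_logPt_right
      refine (((h.complex_re.neg.mul h1.complex_im).add
        (h.complex_im.mul h1.complex_re)).const_mul 2).congr_deriv ?_
      simp only [Complex.mul_re, Complex.mul_im, Complex.I_re, Complex.I_im, Pi.neg_apply]
      ring
    · exact continuous_const.mul (((((r1 s hs).pow 2).add ((i1 s hs).pow 2)).sub
        ((r0 s hs).mul (r2 s hs))).sub ((i0 s hs).mul (i2 s hs)))
    · have e : logPt s (2 * Real.pi) = logPt s 0 + 2 * Real.pi * Complex.I := by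
        rw [← logPt_add_two_pi, zero_add]
      simp only [e, hper _ (hmem hs 0), hper₁ _ (hmem hs 0)]
  · have e : logPt t (2 * Real.pi) = logPt t 0 + 2 * Real.pi * Complex.I := by
      rw [← logPt_add_two_pi, zero_add]
    have hW := wirtinger_of_integral_sq_eq_zero (G := fun θ => G (logPt t θ))
      (G' := fun θ => Complex.I * G₁ (logPt t θ)) (fun θ => (hd _ (hmem ht θ)).comp_logPt_right)
      (continuous_const.mul (s1 t ht)) (by simp only [e, hper _ (hmem ht 0)]) (hsq t ht)
    have e2 : ∀ θ, (2 * ((G₁ (logPt t θ)).re ^ 2 + (G₁ (logPt t θ)).im ^ 2 +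
        (G (logPt t θ)).re * (G₂ (logPt t θ)).re + (G (logPt t θ)).im * (G₂ (logPt t θ)).im) +
      2 * ((G₁ (logPt t θ)).re ^ 2 + (G₁ (logPt t θ)).im ^ 2 -
        (G (logPt t θ)).re * (G₂ (logPt t θ)).re - (G (logPt t θ)).im * (G₂ (logPt t θ)).im)) =
        4 * ‖Complex.I * G₁ (logPt t θ)‖ ^ 2 := fun θ => by
      rw [norm_mul, Complex.norm_I, one_mul, hnorm]; ring
    simp_rw [e2]
    rw [intervalIntegral.integral_const_mul]
    linarith

/-! ### Logarithmic polar coordinates on the annulus -/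

theorem polarPt_exp (t θ : ℝ) : polarPt (Real.exp t) θ = Complex.exp (logPt t θ) := by
  rw [polarPt, logPt, Complex.exp_add, Complex.ofReal_exp]

theorem norm_polarPt {r : ℝ} (hr : 0 ≤ r) (θ : ℝ) : ‖polarPt r θ‖ = r := by
  rw [polarPt, norm_mul, Complex.norm_exp_ofReal_mul_I, mul_one, Complex.norm_real,
    Real.norm_of_nonneg hr]

theorem norm_exp_logPt (t θ : ℝ) : ‖Complex.exp (logPt t θ)‖ = Real.exp t := by
  rw [Complex.norm_exp, logPt_re]

theorem isOpen_annulus (R₀ R₁ : ℝ) : IsOpen (annulus R₀ R₁) :=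
  (isOpen_lt continuous_const continuous_norm).inter (isOpen_lt continuous_norm continuous_const)

theorem exp_mem_annulus_iff {R₀ R₁ : ℝ} (h₀ : 0 < R₀) (h₁ : 0 < R₁) {ζ : ℂ} :
    Complex.exp ζ ∈ annulus R₀ R₁ ↔ ζ ∈ vstrip (Real.log R₀) (Real.log R₁) := by
  simp only [annulus, vstrip, mem_ofPred_eq, Complex.norm_exp]
  rw [Real.log_lt_iff_lt_exp h₀, Real.lt_log_iff_exp_lt h₁]

theorem polarPt_mem_annulus {R₀ R₁ r : ℝ} (h₀ : 0 < R₀) (hr : r ∈ Ioo R₀ R₁) (θ : ℝ) :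
    polarPt r θ ∈ annulus R₀ R₁ := by
  simpa [annulus, norm_polarPt (h₀.trans hr.1).le] using hr

theorem polarPt_add_two_pi (r θ : ℝ) : polarPt r (θ + 2 * Real.pi) = polarPt r θ := by
  rw [polarPt, polarPt]
  push_cast
  rw [add_mul, Complex.exp_add, Complex.exp_two_pi_mul_I, mul_one]

/-- Integration over an annulus in logarithmic polar coordinates. -/
theorem lintegral_annulus {R₀ R₁ : ℝ} (h₀ : 0 < R₀) (h₁ : 0 < R₁) {f : ℂ → ℝ≥0∞}
    (hf : ContinuousOn f (annulus R₀ R₁)) :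
    ∫⁻ z in annulus R₀ R₁, f z = ∫⁻ t in Ioo (Real.log R₀) (Real.log R₁),
      ∫⁻ θ in Ioc 0 (2 * Real.pi), ENNReal.ofReal (Real.exp t ^ 2) *
        f (Complex.exp (logPt t θ)) := by
  have hmeas : MeasurableSet (annulus R₀ R₁) := (isOpen_annulus _ _).measurableSet
  have hsymm : ∀ p : ℝ × ℝ, Complex.polarCoord.symm p = polarPt p.1 p.2 := by
    intro p
    rw [Complex.polarCoord_symm_apply, polarPt, Complex.exp_mul_I, Complex.ofReal_cos,
      Complex.ofReal_sin]
  have hpc : Continuous fun p : ℝ × ℝ => polarPt p.1 p.2 := by unfold polarPt; fun_prop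
  rw [← lintegral_indicator hmeas, ← Complex.lintegral_comp_polarCoord_symm]
  have h1 : ∀ p ∈ polarCoord.target,
      ENNReal.ofReal p.1 • (annulus R₀ R₁).indicator f (Complex.polarCoord.symm p) =
        (Ioo R₀ R₁ ×ˢ (univ : Set ℝ)).indicator
          (fun p => ENNReal.ofReal p.1 * f (polarPt p.1 p.2)) p := by
    intro p hp
    have hp1 : 0 < p.1 := hp.1
    rw [hsymm]
    by_cases h : p.1 ∈ Ioo R₀ R₁
    · rw [indicator_of_mem (polarPt_mem_annulus h₀ h _),
        indicator_of_mem (show p ∈ Ioo R₀ R₁ ×ˢ univ from ⟨h, mem_univ _⟩), smul_eq_mul]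
    · rw [indicator_of_notMem, indicator_of_notMem, smul_zero]
      · exact fun hh => h hh.1
      · intro hh
        simp only [annulus, mem_ofPred_eq, norm_polarPt hp1.le] at hh
        exact h hh
  rw [setLIntegral_congr_fun polarCoord.open_target.measurableSet h1,
    setLIntegral_indicator (measurableSet_Ioo.prod MeasurableSet.univ)]
  have h2 : (Ioo R₀ R₁ ×ˢ (univ : Set ℝ)) ∩ polarCoord.target =
      Ioo R₀ R₁ ×ˢ Ioo (-Real.pi) Real.pi := by
    ext p
    simp only [polarCoord, mem_inter_iff, mem_prod, mem_univ, and_true, mem_Ioi]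
    exact ⟨fun h => ⟨h.1, h.2.2⟩, fun h => ⟨h.1, h₀.trans h.1.1, h.2⟩⟩
  rw [h2, Measure.volume_eq_prod, setLIntegral_prod]
  · have himg : Real.exp '' Ioo (Real.log R₀) (Real.log R₁) = Ioo R₀ R₁ := by
      ext r
      constructor
      · rintro ⟨t, ht, rfl⟩
        exact ⟨(Real.log_lt_iff_lt_exp h₀).1 ht.1, (Real.lt_log_iff_exp_lt h₁).1 ht.2⟩
      · intro hr
        have hr0 := h₀.trans hr.1
        exact ⟨Real.log r, ⟨Real.log_lt_log h₀ hr.1, Real.log_lt_log hr0 hr.2⟩, Real.exp_log hr0⟩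
    rw [← himg, lintegral_image_eq_lintegral_abs_deriv_mul measurableSet_Ioo
      (fun t _ => (Real.hasDerivAt_exp t).hasDerivWithinAt) Real.exp_injective.injOn]
    refine lintegral_congr fun t => ?_
    have hper : ∀ θ, (fun θ => ENNReal.ofReal (Real.exp t) * f (polarPt (Real.exp t) θ))
        (θ + 2 * Real.pi) =
          (fun θ => ENNReal.ofReal (Real.exp t) * f (polarPt (Real.exp t) θ)) θ := fun θ => by
      simp only [polarPt_add_two_pi]
    have hshift := (isAddFundamentalDomain_Ioc (T := 2 * Real.pi) (by positivity)
      (-Real.pi)).setLIntegral_eq (isAddFundamentalDomain_Ioc (T := 2 * Real.pi) (by positivity) 0)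
      (fun θ => ENNReal.ofReal (Real.exp t) * f (polarPt (Real.exp t) θ)) (by
        rintro ⟨g, n, rfl⟩ θ
        have hp : Function.Periodic
          (fun θ => ENNReal.ofReal (Real.exp t) * f (polarPt (Real.exp t) θ)) (2 * Real.pi) := hper
        have := (hp.zsmul n) θ
        rw [← this]
        congr 1
        simp [AddSubgroup.vadd_def, add_comm])
    rw [show -Real.pi + 2 * Real.pi = Real.pi by ring, zero_add] at hshift
    rw [restrict_Ioo_eq_restrict_Ioc, hshift, abs_of_pos (Real.exp_pos t),
      ← lintegral_const_mul' _ _ ENNReal.ofReal_ne_top]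
    refine lintegral_congr fun θ => ?_
    rw [← mul_assoc, ← ENNReal.ofReal_mul (Real.exp_pos t).le, polarPt_exp, sq]
  · rw [← Measure.volume_eq_prod]
    have h3 : ContinuousOn (fun p : ℝ × ℝ => f (polarPt p.1 p.2))
        (Ioo R₀ R₁ ×ˢ Ioo (-Real.pi) Real.pi) :=
      hf.comp hpc.continuousOn fun p hp => polarPt_mem_annulus h₀ hp.1 _
    exact (by fun_prop : Measurable fun p : ℝ × ℝ => ENNReal.ofReal p.1).aemeasurable.mul
      (h3.aemeasurable (measurableSet_Ioo.prod measurableSet_Ioo))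

/-! ### Weierstrass data -/

/-- The map `X` on the annulus has the holomorphic derivatives `φ k = ∂X_k/∂x - i ∂X_k/∂y`, whose
sum of squares vanishes: `X` is harmonic and (weakly) conformal. -/
structure HasWeierstrassData (R₀ R₁ : ℝ) (X : ℂ → E3) (φ : Fin 3 → ℂ → ℂ) : Prop where
  holo : ∀ k, DifferentiableOn ℂ (φ k) (annulus R₀ R₁)
  deriv : ∀ k, ∀ z ∈ annulus R₀ R₁, HasFDerivAt (fun z => X z k) (reMul (φ k z)) z
  isotropic : ∀ z ∈ annulus R₀ R₁, φ 0 z ^ 2 + φ 1 z ^ 2 + φ 2 z ^ 2 = 0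

theorem hasDerivAt_euclidean {f : ℝ → E3} {f' : E3} {x : ℝ}
    (h : ∀ k, HasDerivAt (fun s => f s k) (f' k) x) : HasDerivAt f f' x :=
  (PiLp.continuousLinearEquiv 2 ℝ (fun _ : Fin 3 => ℝ)).symm.hasFDerivAt.comp_hasDerivAt x
    (hasDerivAt_pi.2 h)

theorem norm_sq_E3 (v : E3) : ‖v‖ ^ 2 = v 0 ^ 2 + v 1 ^ 2 + v 2 ^ 2 := by
  rw [EuclideanSpace.real_norm_sq_eq, Fin.sum_univ_three]

/-- The holomorphic derivative of `ζ ↦ X (e^ζ)`, if `φ` is the one of `X`. -/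
noncomputable def logForm (φ : ℂ → ℂ) (ζ : ℂ) : ℂ := Complex.exp ζ * φ (Complex.exp ζ)

/-- The derivative in the direction of `t = Re ζ` of `ζ ↦ X (e^ζ)`. -/
noncomputable def reForm (φ : Fin 3 → ℂ → ℂ) (ζ : ℂ) : E3 :=
  WithLp.toLp 2 fun k => (logForm (φ k) ζ).re

/-- The derivative in the direction of `θ = Im ζ` of `ζ ↦ X (e^ζ)`. -/
noncomputable def imForm (φ : Fin 3 → ℂ → ℂ) (ζ : ℂ) : E3 :=
  WithLp.toLp 2 fun k => -(logForm (φ k) ζ).im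

theorem logForm_periodic (φ : ℂ → ℂ) (ζ : ℂ) :
    logForm φ (ζ + 2 * Real.pi * Complex.I) = logForm φ ζ := by
  rw [logForm, logForm, Complex.exp_add, Complex.exp_two_pi_mul_I, mul_one]

theorem isotropic_norm_sq {x y z : ℂ} (h : x ^ 2 + y ^ 2 + z ^ 2 = 0) :
    x.re ^ 2 + y.re ^ 2 + z.re ^ 2 = x.im ^ 2 + y.im ^ 2 + z.im ^ 2 ∧
      x.re * x.im + y.re * y.im + z.re * z.im = 0 := by
  have hr := congrArg Complex.re h
  have hi := congrArg Complex.im h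
  simp only [sq, Complex.add_re, Complex.mul_re, Complex.add_im, Complex.mul_im, Complex.zero_re,
    Complex.zero_im] at hr hi
  exact ⟨by linarith, by linarith⟩

namespace HasWeierstrassData

variable {R₀ R₁ : ℝ} {X : ℂ → E3} {φ : Fin 3 → ℂ → ℂ}

theorem logForm_holo (hW : HasWeierstrassData R₀ R₁ X φ) (h₀ : 0 < R₀) (h₁ : 0 < R₁) (k : Fin 3) :
    DifferentiableOn ℂ (logForm (φ k)) (vstrip (Real.log R₀) (Real.log R₁)) :=
  Complex.differentiable_exp.differentiableOn.mul
    ((hW.holo k).comp Complex.differentiable_exp.differentiableOn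
      fun _ hζ => (exp_mem_annulus_iff h₀ h₁).2 hζ)

theorem logForm_deriv (hW : HasWeierstrassData R₀ R₁ X φ) (h₀ : 0 < R₀) (h₁ : 0 < R₁) (k : Fin 3)
    {ζ : ℂ} (hζ : ζ ∈ vstrip (Real.log R₀) (Real.log R₁)) :
    HasFDerivAt (fun ζ => X (Complex.exp ζ) k) (reMul (logForm (φ k) ζ)) ζ := by
  have h := (hW.deriv k _ ((exp_mem_annulus_iff h₀ h₁).2 hζ)).comp ζ
    ((Complex.hasDerivAt_exp ζ).hasFDerivAt.restrictScalars ℝ)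
  refine h.congr_fderiv ?_
  ext v
  simp [logForm]
  ring

theorem logForm_isotropic (hW : HasWeierstrassData R₀ R₁ X φ) (h₀ : 0 < R₀) (h₁ : 0 < R₁)
    {ζ : ℂ} (hζ : ζ ∈ vstrip (Real.log R₀) (Real.log R₁)) :
    logForm (φ 0) ζ ^ 2 + logForm (φ 1) ζ ^ 2 + logForm (φ 2) ζ ^ 2 = 0 := by
  have := hW.isotropic _ ((exp_mem_annulus_iff h₀ h₁).2 hζ)
  simp only [logForm]
  linear_combination Complex.exp ζ ^ 2 * this

theorem hasDerivAt_left (hW : HasWeierstrassData R₀ R₁ X φ) (h₀ : 0 < R₀) (h₁ : 0 < R₁)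
    {t : ℝ} (ht : t ∈ Ioo (Real.log R₀) (Real.log R₁)) (θ : ℝ) :
    HasDerivAt (fun s => X (Complex.exp (logPt s θ))) (reForm φ (logPt t θ)) t :=
  hasDerivAt_euclidean fun k =>
    (hW.logForm_deriv h₀ h₁ k (logPt_mem_vstrip.2 ht)).comp_logPt_left

theorem hasDerivAt_right (hW : HasWeierstrassData R₀ R₁ X φ) (h₀ : 0 < R₀) (h₁ : 0 < R₁)
    {t : ℝ} (ht : t ∈ Ioo (Real.log R₀) (Real.log R₁)) (θ : ℝ) :
    HasDerivAt (fun s => X (Complex.exp (logPt t s))) (imForm φ (logPt t θ)) θ :=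
  hasDerivAt_euclidean fun k =>
    (hW.logForm_deriv h₀ h₁ k (logPt_mem_vstrip.2 ht)).comp_logPt_right

theorem continuousOn_reForm (hW : HasWeierstrassData R₀ R₁ X φ) (h₀ : 0 < R₀) (h₁ : 0 < R₁) :
    ContinuousOn (reForm φ) (vstrip (Real.log R₀) (Real.log R₁)) :=
  (PiLp.continuous_toLp 2 _).comp_continuousOn (continuousOn_pi.2 fun k =>
    Complex.continuous_re.comp_continuousOn (hW.logForm_holo h₀ h₁ k).continuousOn)

theorem continuousOn_imForm (hW : HasWeierstrassData R₀ R₁ X φ) (h₀ : 0 < R₀) (h₁ : 0 < R₁) :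
    ContinuousOn (imForm φ) (vstrip (Real.log R₀) (Real.log R₁)) :=
  (PiLp.continuous_toLp 2 _).comp_continuousOn (continuousOn_pi.2 fun k =>
    (Complex.continuous_im.comp_continuousOn (hW.logForm_holo h₀ h₁ k).continuousOn).neg)

theorem norm_reForm (hW : HasWeierstrassData R₀ R₁ X φ) (h₀ : 0 < R₀) (h₁ : 0 < R₁)
    {ζ : ℂ} (hζ : ζ ∈ vstrip (Real.log R₀) (Real.log R₁)) : ‖reForm φ ζ‖ = ‖imForm φ ζ‖ := by
  rw [← sq_eq_sq₀ (norm_nonneg _) (norm_nonneg _), norm_sq_E3, norm_sq_E3]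
  have := (isotropic_norm_sq (hW.logForm_isotropic h₀ h₁ hζ)).1
  simpa [reForm, imForm] using this

theorem angularDeriv_eq (hW : HasWeierstrassData R₀ R₁ X φ) (h₀ : 0 < R₀) (h₁ : 0 < R₁)
    {t : ℝ} (ht : t ∈ Ioo (Real.log R₀) (Real.log R₁)) (θ : ℝ) :
    angularDeriv X (Real.exp t) θ = imForm φ (logPt t θ) := by
  simp only [angularDeriv, polarPt_exp]
  exact (hW.hasDerivAt_right h₀ h₁ ht θ).deriv

theorem radialDeriv_eq (hW : HasWeierstrassData R₀ R₁ X φ) (h₀ : 0 < R₀) (h₁ : 0 < R₁)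
    {t : ℝ} (ht : t ∈ Ioo (Real.log R₀) (Real.log R₁)) (θ : ℝ) :
    radialDeriv X (Real.exp t) θ = (Real.exp t)⁻¹ • reForm φ (logPt t θ) := by
  have hmem : polarPt (Real.exp t) θ ∈ annulus R₀ R₁ := by
    rw [polarPt_exp]
    exact (exp_mem_annulus_iff h₀ h₁).2 (logPt_mem_vstrip.2 ht)
  have hpath : HasDerivAt (fun s : ℝ => polarPt s θ) (Complex.exp ((θ : ℂ) * Complex.I))
      (Real.exp t) := by
    simpa [polarPt] using (Complex.ofRealCLM.hasDerivAt (x := Real.exp t)).mul_const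
      (Complex.exp ((θ : ℂ) * Complex.I))
  refine HasDerivAt.deriv (hasDerivAt_euclidean fun k => ?_)
  have h := (hW.deriv k _ hmem).comp_hasDerivAt (Real.exp t) hpath
  refine h.congr_deriv ?_
  have he : (Real.exp t : ℂ) ≠ 0 := by exact_mod_cast (Real.exp_pos t).ne'
  simp only [reMul_apply, reForm, logForm, PiLp.smul_apply, smul_eq_mul, ← polarPt_exp]
  rw [← Complex.re_ofReal_mul]
  congr 1
  simp only [polarPt]
  push_cast
  field_simp

theorem fderiv_apply (hW : HasWeierstrassData R₀ R₁ X φ) {z : ℂ} (hz : z ∈ annulus R₀ R₁) (v : ℂ)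
    (k : Fin 3) : fderiv ℝ X z v k = (φ k z * v).re := by
  have hd : DifferentiableAt ℝ X z :=
    differentiableAt_euclidean.2 fun k => (hW.deriv k z hz).differentiableAt
  have h := (EuclideanSpace.proj (𝕜 := ℝ) k).hasFDerivAt.comp z hd.hasFDerivAt
  have h2 := h.unique (hW.deriv k z hz)
  have := congrArg (fun L => L v) h2
  simpa using this

theorem norm_cross3 (hW : HasWeierstrassData R₀ R₁ X φ) {z : ℂ} (hz : z ∈ annulus R₀ R₁) :
    ‖cross3 (partialX X z) (partialY X z)‖ =
      (φ 0 z).im ^ 2 + (φ 1 z).im ^ 2 + (φ 2 z).im ^ 2 := by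
  obtain ⟨h1, h2⟩ := isotropic_norm_sq (hW.isotropic z hz)
  have hx : ∀ k, partialX X z k = (φ k z).re := fun k => by
    rw [partialX, hW.fderiv_apply hz, mul_one]
  have hy : ∀ k, partialY X z k = -(φ k z).im := fun k => by
    rw [partialY, hW.fderiv_apply hz]; simp
  rw [← sq_eq_sq₀ (norm_nonneg _) (by positivity), norm_sq_E3]
  simp only [cross3, hx, hy, Matrix.cons_val_zero, Matrix.cons_val_one, Matrix.cons_val]
  -- Lagrange's identity
  have : ((φ 1 z).re * -(φ 2 z).im - (φ 2 z).re * -(φ 1 z).im) ^ 2 +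
      ((φ 2 z).re * -(φ 0 z).im - (φ 0 z).re * -(φ 2 z).im) ^ 2 +
      ((φ 0 z).re * -(φ 1 z).im - (φ 1 z).re * -(φ 0 z).im) ^ 2 =
      ((φ 0 z).re ^ 2 + (φ 1 z).re ^ 2 + (φ 2 z).re ^ 2) *
        ((φ 0 z).im ^ 2 + (φ 1 z).im ^ 2 + (φ 2 z).im ^ 2) -
      ((φ 0 z).re * (φ 0 z).im + (φ 1 z).re * (φ 1 z).im + (φ 2 z).re * (φ 2 z).im) ^ 2 := by ring
  rw [this, h1, h2]
  ring

/-- The area is the Dirichlet energy of either derivative in logarithmic polar coordinates. -/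
theorem surfaceArea_eq (hW : HasWeierstrassData R₀ R₁ X φ) (h₀ : 0 < R₀) (h₁ : 0 < R₁) :
    surfaceArea R₀ R₁ X = ∫⁻ t in Ioo (Real.log R₀) (Real.log R₁),
      ∫⁻ θ in Ioc 0 (2 * Real.pi), ‖imForm φ (logPt t θ)‖ₑ ^ 2 := by
  have hc : ContinuousOn (fun z => ENNReal.ofReal
      ((φ 0 z).im ^ 2 + (φ 1 z).im ^ 2 + (φ 2 z).im ^ 2)) (annulus R₀ R₁) := by
    have h : ∀ k, ContinuousOn (fun z => (φ k z).im ^ 2) (annulus R₀ R₁) := fun k =>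
      (Complex.continuous_im.comp_continuousOn (hW.holo k).continuousOn).pow 2
    exact ENNReal.continuous_ofReal.comp_continuousOn (((h 0).add (h 1)).add (h 2))
  have h1 : surfaceArea R₀ R₁ X = ∫⁻ z in annulus R₀ R₁, ENNReal.ofReal
      ((φ 0 z).im ^ 2 + (φ 1 z).im ^ 2 + (φ 2 z).im ^ 2) := by
    refine setLIntegral_congr_fun (isOpen_annulus _ _).measurableSet fun z hz => ?_
    rw [← hW.norm_cross3 hz, ofReal_norm]
  rw [h1, lintegral_annulus h₀ h₁ hc]
  refine setLIntegral_congr_fun measurableSet_Ioo fun t ht => lintegral_congr fun θ => ?_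
  have hζ := logPt_mem_vstrip (θ := θ) |>.2 ht
  rw [← ENNReal.ofReal_mul (by positivity), ← ofReal_norm,
    ← ENNReal.ofReal_pow (norm_nonneg _)]
  congr 1
  obtain ⟨h2, -⟩ := isotropic_norm_sq (hW.logForm_isotropic h₀ h₁ hζ)
  obtain ⟨h3, -⟩ := isotropic_norm_sq (hW.isotropic _ ((exp_mem_annulus_iff h₀ h₁).2 hζ))
  have h4 : ∀ k, (logForm (φ k) (logPt t θ)).re ^ 2 + (logForm (φ k) (logPt t θ)).im ^ 2 =
      Real.exp t ^ 2 * ((φ k (Complex.exp (logPt t θ))).re ^ 2 +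
        (φ k (Complex.exp (logPt t θ))).im ^ 2) := by
    intro k
    have h5 : ∀ w : ℂ, w.re ^ 2 + w.im ^ 2 = ‖w‖ ^ 2 := fun w => by
      rw [Complex.sq_norm, Complex.normSq_apply]; ring
    rw [h5, h5, logForm, norm_mul, norm_exp_logPt, mul_pow]
  rw [norm_sq_E3]
  simp only [imForm, neg_sq]
  linear_combination (-1 / 2 : ℝ) * (h4 0 + h4 1 + h4 2) + (1 / 2 : ℝ) * h2 -
    (1 / 2 : ℝ) * Real.exp t ^ 2 * h3

theorem circleLength_eq (hW : HasWeierstrassData R₀ R₁ X φ) (h₀ : 0 < R₀) (h₁ : 0 < R₁)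
    {t : ℝ} (ht : t ∈ Ioo (Real.log R₀) (Real.log R₁)) :
    circleLength X (Real.exp t) = ∫⁻ θ in Ioc 0 (2 * Real.pi), ‖imForm φ (logPt t θ)‖ₑ := by
  simp only [circleLength, hW.angularDeriv_eq h₀ h₁ ht]

theorem circleFlux_eq (hW : HasWeierstrassData R₀ R₁ X φ) (h₀ : 0 < R₀) (h₁ : 0 < R₁)
    {t : ℝ} (ht : t ∈ Ioo (Real.log R₀) (Real.log R₁)) (k : Fin 3) :
    circleFlux X (Real.exp t) k = ∫ θ in (0 : ℝ)..(2 * Real.pi), (logForm (φ k) (logPt t θ)).re := by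
  have h1 : ∀ θ, ‖angularDeriv X (Real.exp t) θ‖ •
      (‖radialDeriv X (Real.exp t) θ‖⁻¹ • radialDeriv X (Real.exp t) θ) =
        reForm φ (logPt t θ) := by
    intro θ
    rw [hW.angularDeriv_eq h₀ h₁ ht, hW.radialDeriv_eq h₀ h₁ ht,
      ← hW.norm_reForm h₀ h₁ (logPt_mem_vstrip.2 ht), norm_smul, norm_inv,
      Real.norm_of_nonneg (Real.exp_pos t).le, mul_inv, inv_inv, smul_smul, smul_smul]
    by_cases h : reForm φ (logPt t θ) = 0
    · simp [h]
    · have h2 : ‖reForm φ (logPt t θ)‖ ≠ 0 := norm_ne_zero_iff.2 h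
      have h3 := (Real.exp_pos t).ne'
      have : ‖reForm φ (logPt t θ)‖ * (Real.exp t * ‖reForm φ (logPt t θ)‖⁻¹) * (Real.exp t)⁻¹ =
          1 := by
        field_simp
      rw [this, one_smul]
  simp only [circleFlux, h1]
  have hc : Continuous fun θ => reForm φ (logPt t θ) :=
    continuous_slice (F := fun t θ => reForm φ (logPt t θ))
      (hW.continuousOn_reForm h₀ h₁).comp_logPt ht
  have := (EuclideanSpace.proj (ι := Fin 3) (𝕜 := ℝ) k).intervalIntegral_comp_comm
    (μ := volume) (a := 0) (b := 2 * Real.pi) (hc.intervalIntegrable _ _)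
  simpa [reForm] using this.symm

/-- The flux determines the periods of the Weierstrass data: their imaginary parts vanish since `X`
is single valued, and they are the same on all circles by Cauchy's theorem. -/
theorem integral_logForm (hW : HasWeierstrassData R₀ R₁ X φ) (h₀ : 0 < R₀) (h₁ : 0 < R₁)
    {v : E3} (hv : HasFlux R₀ R₁ X v) (k : Fin 3)
    {t : ℝ} (ht : t ∈ Ioo (Real.log R₀) (Real.log R₁)) :
    ∫ θ in (0 : ℝ)..(2 * Real.pi), logForm (φ k) (logPt t θ) = v k := by
  set a := Real.log R₀ with ha
  set b := Real.log R₁ with hb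
  have hholo := hW.logForm_holo h₀ h₁ k
  have hopen := isOpen_vstrip a b
  have hd : ∀ ζ ∈ vstrip a b, HasDerivAt (logForm (φ k)) (_root_.deriv (logForm (φ k)) ζ) ζ :=
    fun ζ hζ => (hholo.differentiableAt (hopen.mem_nhds hζ)).hasDerivAt
  have hslice : ∀ s ∈ Ioo a b, Continuous fun θ => logForm (φ k) (logPt s θ) := fun s hs =>
    continuous_slice (F := fun t θ => logForm (φ k) (logPt t θ)) hholo.continuousOn.comp_logPt hs
  have hslice' : ∀ s ∈ Ioo a b, Continuous fun θ => _root_.deriv (logForm (φ k)) (logPt s θ) :=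
    fun s hs => continuous_slice (F := fun t θ => _root_.deriv (logForm (φ k)) (logPt t θ))
      (hholo.deriv hopen).continuousOn.comp_logPt hs
  have e : ∀ s, logPt s (2 * Real.pi) = logPt s 0 + 2 * Real.pi * Complex.I := fun s => by
    rw [← logPt_add_two_pi, zero_add]
  have hzero : ∀ s ∈ Ioo a b, HasDerivAt
      (fun s => ∫ θ in (0 : ℝ)..(2 * Real.pi), logForm (φ k) (logPt s θ)) 0 s := by
    intro s hs
    have h1 := hasDerivAt_integral_angle (F := fun s θ => logForm (φ k) (logPt s θ))
      (F' := fun s θ => _root_.deriv (logForm (φ k)) (logPt s θ))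
      (fun s hs θ => (hd _ (logPt_mem_vstrip.2 hs)).comp_logPt_left) hslice
      (hholo.deriv hopen).continuousOn.comp_logPt hs
    have h2 := intervalIntegral.integral_eq_sub_of_hasDerivAt (a := 0) (b := 2 * Real.pi)
      (fun θ _ => (hd _ (logPt_mem_vstrip (θ := θ) |>.2 hs)).comp_logPt_right)
      ((continuous_const.mul (hslice' s hs)).intervalIntegrable _ _)
    rw [e, logForm_periodic, sub_self, intervalIntegral.integral_const_mul] at h2
    exact h1.congr_deriv ((mul_eq_zero.1 h2).resolve_left Complex.I_ne_zero)
  obtain ⟨r, hr, hrv⟩ := hv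
  have hr0 := h₀.trans hr.1
  have hs : Real.log r ∈ Ioo a b := ⟨Real.log_lt_log h₀ hr.1, Real.log_lt_log hr0 hr.2⟩
  have hconst : (∫ θ in (0 : ℝ)..(2 * Real.pi), logForm (φ k) (logPt t θ)) =
      ∫ θ in (0 : ℝ)..(2 * Real.pi), logForm (φ k) (logPt (Real.log r) θ) :=
    (convex_Ioo a b).is_const_of_fderivWithin_eq_zero (𝕜 := ℝ)
      (f := fun s => ∫ θ in (0 : ℝ)..(2 * Real.pi), logForm (φ k) (logPt s θ))
      (fun s hs => (hzero s hs).differentiableAt.differentiableWithinAt)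
      (fun s hs => by
        rw [fderivWithin_of_isOpen isOpen_Ioo hs]
        ext; simp [(hzero s hs).deriv]) ht hs
  rw [hconst]
  have hint := (hslice _ hs).intervalIntegrable (μ := volume) 0 (2 * Real.pi)
  have hre := Complex.reCLM.intervalIntegral_comp_comm hint
  have him := Complex.imCLM.intervalIntegral_comp_comm hint
  have hflux := hW.circleFlux_eq h₀ h₁ hs k
  rw [Real.exp_log hr0, hrv] at hflux
  have him0 : ∫ θ in (0 : ℝ)..(2 * Real.pi), (logForm (φ k) (logPt (Real.log r) θ)).im = 0 := by
    have h2 := intervalIntegral.integral_eq_sub_of_hasDerivAt (a := 0) (b := 2 * Real.pi)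
      (fun θ _ => (hW.logForm_deriv h₀ h₁ k
        (logPt_mem_vstrip (θ := θ) |>.2 hs)).comp_logPt_right)
      ((Complex.continuous_im.comp (hslice _ hs)).neg.intervalIntegrable _ _)
    rw [intervalIntegral.integral_neg, e, Complex.exp_add, Complex.exp_two_pi_mul_I, mul_one,
      sub_self, neg_eq_zero] at h2
    exact h2
  apply Complex.ext
  · rw [Complex.ofReal_re, hflux]
    exact hre.symm
  · rw [Complex.ofReal_im]
    exact him.symm.trans him0

end HasWeierstrassData

/-! ### The Weierstrass data of a minimal annulus -/

theorem IsMinimalAnnulus.hasWeierstrassData {hm hp R₀ R₁ : ℝ} {X : ℂ → E3}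
    (hX : IsMinimalAnnulus hm hp R₀ R₁ X) :
    HasWeierstrassData R₀ R₁ X (fun k z => (fderiv ℝ (fun z => X z k) z 1 : ℂ) -
      Complex.I * (fderiv ℝ (fun z => X z k) z Complex.I : ℂ)) := by
  have hharm : ∀ k : Fin 3, ∀ z ∈ annulus R₀ R₁,
      InnerProductSpace.HarmonicAt (fun z => X z k) z := fun k z hz =>
    (hX.harmonic z hz).comp_CLM (EuclideanSpace.proj (𝕜 := ℝ) k)
  have hdiff : ∀ k : Fin 3, ∀ z ∈ annulus R₀ R₁, DifferentiableAt ℝ (fun z => X z k) z :=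
    fun k z hz => (hharm k z hz).1.differentiableAt two_ne_zero
  refine ⟨fun k z hz => ?_, fun k z hz => ?_, fun z hz => ?_⟩
  · exact (HarmonicAt.differentiableAt_complex_partial (hharm k z hz)).differentiableWithinAt
  · refine (hdiff k z hz).hasFDerivAt.congr_fderiv ?_
    ext v
    have hv : v = v.re • (1 : ℂ) + v.im • Complex.I := by simp
    conv_lhs => rw [hv, map_add, map_smul, map_smul]
    simp
    ring
  · obtain ⟨c, -, hc⟩ := conformalAt_iff'.1 (hX.conformal z hz)
    have hd : DifferentiableAt ℝ X z := (hX.conformal z hz).differentiableAt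
    have hcomp : ∀ (k : Fin 3) v, fderiv ℝ (fun z => X z k) z v = fderiv ℝ X z v k := by
      intro k v
      have h := (EuclideanSpace.proj (𝕜 := ℝ) k).hasFDerivAt.comp z hd.hasFDerivAt
      have := h.fderiv
      exact congrArg (fun L => L v) this
    have h11 := hc 1 1
    have hII := hc Complex.I Complex.I
    have h1I := hc 1 Complex.I
    simp only [PiLp.inner_apply, Fin.sum_univ_three, ← hcomp, Complex.inner] at h11 hII h1I
    simp at h11 hII h1I
    apply Complex.ext
    · simp [sq]
      linarith
    · simp [sq]
      linarith

namespace HasWeierstrassData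

variable {R₀ R₁ : ℝ} {X : ℂ → E3} {φ : Fin 3 → ℂ → ℂ}

/-- The Gauss map in terms of the Weierstrass data: `g = φ₂ / (φ₀ - iφ₁)`. -/
theorem gaussMap_mul (hW : HasWeierstrassData R₀ R₁ X φ) {z : ℂ} (hz : z ∈ annulus R₀ R₁)
    (hg : gaussMap X z ≠ 0) : gaussMap X z * (φ 0 z - Complex.I * φ 1 z) = φ 2 z := by
  obtain ⟨h1, h2⟩ := isotropic_norm_sq (hW.isotropic z hz)
  have hx : ∀ k, partialX X z k = (φ k z).re := fun k => by
    rw [partialX, hW.fderiv_apply hz, mul_one]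
  have hy : ∀ k, partialY X z k = -(φ k z).im := fun k => by
    rw [partialY, hW.fderiv_apply hz]; simp
  set n := cross3 (partialX X z) (partialY X z) with hn
  have hnorm : ‖n‖ = (φ 0 z).im ^ 2 + (φ 1 z).im ^ 2 + (φ 2 z).im ^ 2 := hW.norm_cross3 hz
  have key : ((n 0 : ℂ) + (n 1 : ℂ) * Complex.I) * (φ 0 z - Complex.I * φ 1 z) =
      ((‖n‖ : ℂ) - (n 2 : ℂ)) * φ 2 z := by
    rw [hnorm, hn]
    simp only [cross3, hx, hy, Matrix.cons_val_zero, Matrix.cons_val_one, Matrix.cons_val]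
    apply Complex.ext
    · simp [sq]
      linear_combination -(φ 2 z).im * h2
    · simp [sq]
      linear_combination -(φ 2 z).re * h2 + (φ 2 z).im * h1
  have hN : ∀ k, unitNormal X z k = ‖n‖⁻¹ * n k := fun k => by
    rw [unitNormal, ← hn, PiLp.smul_apply, smul_eq_mul]
  have hn0 : ‖n‖ ≠ 0 := by
    intro h0
    apply hg
    rw [gaussMap, hN, hN, h0]
    simp
  have hden : (1 - (unitNormal X z 2 : ℂ)) ≠ 0 := by
    intro h0
    apply hg
    rw [gaussMap, h0, div_zero]
  have hn0' : (‖n‖ : ℂ) ≠ 0 := by exact_mod_cast hn0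
  rw [gaussMap, div_mul_eq_mul_div, div_eq_iff hden, hN, hN, hN]
  push_cast
  field_simp
  linear_combination key

end HasWeierstrassData

/-! ### The height function -/

/-- Near the ends of the annulus, a proper map leaves all compact subsets of the slab. -/
theorem IsMinimalAnnulus.exists_bounds {hm hp R₀ R₁ : ℝ} {X : ℂ → E3}
    (hX : IsMinimalAnnulus hm hp R₀ R₁ X) {K : Set E3} (hK : IsCompact K)
    (hKs : K ⊆ slab hm hp) :
    ∃ l ∈ Ioo (Real.log R₀) (Real.log R₁), ∃ u ∈ Ioo (Real.log R₀) (Real.log R₁),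
      ∀ t ∈ Ioo (Real.log R₀) (Real.log R₁), ∀ θ, X (Complex.exp (logPt t θ)) ∈ K →
        l ≤ t ∧ t ≤ u := by
  have h₀ := hX.inner_pos
  have h₁ := h₀.trans hX.inner_lt_outer
  have hS := hX.proper K hK hKs
  set S := annulus R₀ R₁ ∩ X ⁻¹' K with hSdef
  have hlog : ∀ z ∈ annulus R₀ R₁, Real.log ‖z‖ ∈ Ioo (Real.log R₀) (Real.log R₁) := fun z hz =>
    ⟨Real.log_lt_log h₀ hz.1, Real.log_lt_log (h₀.trans hz.1) hz.2⟩
  rcases S.eq_empty_or_nonempty with hemp | hne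
  · obtain ⟨m, hm'⟩ := exists_between (Real.log_lt_log h₀ hX.inner_lt_outer)
    refine ⟨m, hm', m, hm', fun t ht θ hK => ?_⟩
    have : Complex.exp (logPt t θ) ∈ S :=
      ⟨(exp_mem_annulus_iff h₀ h₁).2 (logPt_mem_vstrip.2 ht), hK⟩
    simp [hemp] at this
  · obtain ⟨z, hz, hzmin⟩ := hS.exists_isMinOn hne continuous_norm.continuousOn
    obtain ⟨w, hw, hwmax⟩ := hS.exists_isMaxOn hne continuous_norm.continuousOn
    refine ⟨_, hlog z hz.1, _, hlog w hw.1, fun t ht θ hK => ?_⟩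
    have hmem : Complex.exp (logPt t θ) ∈ S :=
      ⟨(exp_mem_annulus_iff h₀ h₁).2 (logPt_mem_vstrip.2 ht), hK⟩
    have h1 := hzmin hmem
    have h2 := hwmax hmem
    simp only [mem_ofPred_eq, norm_exp_logPt] at h1 h2
    exact ⟨(Real.log_le_iff_le_exp (h₀.trans hz.1.1)).2 h1,
      (Real.le_log_iff_exp_le (h₀.trans hw.1.1)).2 h2⟩

theorem setLIntegral_comp_neg (a b : ℝ) (f : ℝ → ℝ≥0∞) :
    ∫⁻ t in Ioo (-b) (-a), f (-t) = ∫⁻ t in Ioo a b, f t := by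
  have himg : (fun t : ℝ => -t) '' Ioo (-b) (-a) = Ioo a b := by
    simp
  rw [← himg, lintegral_image_eq_lintegral_abs_deriv_mul measurableSet_Ioo
    (fun t _ => (hasDerivAt_neg t).hasDerivWithinAt) neg_injective.injOn]
  simp

/-- The height of a minimal annulus of finite area is an affine function of `log |z|`, and maps the
two ends of the annulus to the two boundary planes of the slab. -/
theorem IsMinimalAnnulus.exists_height_eq {hm hp R₀ R₁ : ℝ} (hmp : hm < hp) {X : ℂ → E3}
    (hX : IsMinimalAnnulus hm hp R₀ R₁ X) (harea : surfaceArea R₀ R₁ X ≠ ∞) :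
    ∃ α β : ℝ, (∀ ζ ∈ vstrip (Real.log R₀) (Real.log R₁),
        X (Complex.exp ζ) 2 = α * ζ.re + β) ∧
      ((0 < α ∧ α * Real.log R₀ + β = hm ∧ α * Real.log R₁ + β = hp) ∨
        (α < 0 ∧ α * Real.log R₀ + β = hp ∧ α * Real.log R₁ + β = hm)) := by
  have h₀ := hX.inner_pos
  have h₁ := h₀.trans hX.inner_lt_outer
  obtain ⟨φ, hW⟩ : ∃ φ, HasWeierstrassData R₀ R₁ X φ := ⟨_, hX.hasWeierstrassData⟩
  rw [hW.surfaceArea_eq h₀ h₁] at harea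
  have hab := Real.log_lt_log h₀ hX.inner_lt_outer
  have hbounds := @IsMinimalAnnulus.exists_bounds _ _ _ _ _ hX
  have hslab : ∀ ζ ∈ vstrip (Real.log R₀) (Real.log R₁), X (Complex.exp ζ) ∈ slab hm hp :=
    fun ζ hζ => hX.mapsTo ((exp_mem_annulus_iff h₀ h₁).2 hζ)
  have hleft := fun {t} => hW.hasDerivAt_left h₀ h₁ (t := t)
  have hright := fun {t} => hW.hasDerivAt_right h₀ h₁ (t := t)
  have hre := (hW.continuousOn_reForm h₀ h₁).comp_logPt
  have him := (hW.continuousOn_imForm h₀ h₁).comp_logPt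
  have hnorm := fun {ζ} => hW.norm_reForm h₀ h₁ (ζ := ζ)
  have hder := fun {ζ} => hW.logForm_deriv h₀ h₁ 2 (ζ := ζ)
  have hholo := hW.logForm_holo h₀ h₁ 2
  set a := Real.log R₀
  set b := Real.log R₁
  have harea' : ∫⁻ t in Ioo a b, ∫⁻ θ in Ioc 0 (2 * Real.pi), ‖reForm φ (logPt t θ)‖ₑ ^ 2 ≠ ∞ := by
    convert harea using 1
    refine setLIntegral_congr_fun measurableSet_Ioo fun t ht => lintegral_congr fun θ => ?_
    rw [← ofReal_norm, ← ofReal_norm, hnorm (logPt_mem_vstrip.2 ht)]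
  obtain ⟨c₀, hc₀, hlim₀⟩ := exists_ae_tendsto_height hab hmp
    (Y := fun t θ => X (Complex.exp (logPt t θ))) (Yt := fun t θ => reForm φ (logPt t θ))
    (Yθ := fun t θ => imForm φ (logPt t θ)) (fun t ht θ => hleft ht θ) (fun t ht θ => hright ht θ)
    hre him (fun t ht θ => hslab _ (logPt_mem_vstrip.2 ht))
    (fun K hK hKs => by
      obtain ⟨l, hl, u, hu, h⟩ := hbounds hK hKs
      filter_upwards [Ioo_mem_nhdsGT hl.1] with t ht θ hmem
      exact absurd (h t ⟨ht.1, ht.2.trans hl.2⟩ θ hmem).1 (not_le.2 ht.2)) harea' harea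
  have hneg : ∀ {t}, t ∈ Ioo (-b) (-a) → -t ∈ Ioo a b := fun ht =>
    ⟨by linarith [ht.2], by linarith [ht.1]⟩
  obtain ⟨c₁, hc₁, hlim₁⟩ := exists_ae_tendsto_height (neg_lt_neg hab) hmp
    (Y := fun t θ => X (Complex.exp (logPt (-t) θ))) (Yt := fun t θ => -reForm φ (logPt (-t) θ))
    (Yθ := fun t θ => imForm φ (logPt (-t) θ))
    (fun t ht θ => by
      simpa [Function.comp_def] using (hleft (hneg ht) θ).scomp t (hasDerivAt_neg t))
    (fun t ht θ => hright (hneg ht) θ)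
    ((hre.comp (f := fun p : ℝ × ℝ => (-p.1, p.2)) (by fun_prop)
      (fun p hp => ⟨hneg hp.1, mem_univ _⟩)).neg)
    (him.comp (f := fun p : ℝ × ℝ => (-p.1, p.2)) (by fun_prop)
      (fun p hp => ⟨hneg hp.1, mem_univ _⟩))
    (fun t ht θ => hslab _ (logPt_mem_vstrip.2 (hneg ht)))
    (fun K hK hKs => by
      obtain ⟨l, hl, u, hu, h⟩ := hbounds hK hKs
      filter_upwards [Ioo_mem_nhdsGT (neg_lt_neg hu.2)] with t ht θ hmem
      have ht' : -t ∈ Ioo a b := ⟨by linarith [ht.2, hu.1], by linarith [ht.1]⟩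
      have := (h _ ht' θ hmem).2
      linarith [ht.2])
    (by
      simp only [enorm_neg]
      rwa [setLIntegral_comp_neg a b fun t => ∫⁻ θ in Ioc 0 (2 * Real.pi),
        ‖reForm φ (logPt t θ)‖ₑ ^ 2])
    (by rwa [setLIntegral_comp_neg a b fun t => ∫⁻ θ in Ioc 0 (2 * Real.pi),
        ‖imForm φ (logPt t θ)‖ₑ ^ 2])
  have hlim₁' : ∀ᵐ θ ∂(volume.restrict (Ioc 0 (2 * Real.pi))),
      Tendsto (fun t => X (Complex.exp (logPt t θ)) 2) (𝓝[<] b) (𝓝 c₁) := by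
    refine hlim₁.mono fun θ hθ => ?_
    have := hθ.comp (tendsto_neg_nhdsLT (a := b))
    simpa [Function.comp_def] using this
  have hinterp := fun {ζ} => eq_interpolation_of_ae_tendsto (ζ := ζ) hab
    (M := max |hm| |hp|) hholo
    (fun ζ hζ => hder hζ) (fun ζ => by rw [Complex.exp_add, Complex.exp_two_pi_mul_I, mul_one])
    (logForm_periodic _)
    (fun ζ hζ => abs_le_max_abs_abs (hslab ζ hζ).1.le (hslab ζ hζ).2.le) hlim₀ hlim₁'
  have hba : 0 < b - a := sub_pos.2 hab
  refine ⟨(c₁ - c₀) / (b - a), c₀ - (c₁ - c₀) / (b - a) * a, fun ζ hζ => ?_, ?_⟩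
  · rw [hinterp hζ]; ring
  · have e₀ : (c₁ - c₀) / (b - a) * a + (c₀ - (c₁ - c₀) / (b - a) * a) = c₀ := by ring
    have e₁ : (c₁ - c₀) / (b - a) * b + (c₀ - (c₁ - c₀) / (b - a) * a) = c₁ := by
      field_simp; ring
    rw [e₀, e₁]
    -- if both ends went to the same plane, the height would be constant
    have hne : c₀ ≠ c₁ := by
      rintro rfl
      obtain ⟨m, hm'⟩ := exists_between hab
      have hmem : logPt m 0 ∈ vstrip a b := logPt_mem_vstrip.2 hm'
      have h1 := hinterp hmem
      rw [sub_self, zero_div, zero_mul, add_zero] at h1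
      have h2 := hslab _ hmem
      rw [slab, mem_ofPred_eq, h1] at h2
      rcases hc₀ with rfl | rfl
      · exact lt_irrefl _ h2.1
      · exact lt_irrefl _ h2.2
    rcases hc₀ with rfl | rfl <;> rcases hc₁ with rfl | rfl
    · exact absurd rfl hne
    · exact Or.inl ⟨div_pos (sub_pos.2 hmp) hba, rfl, rfl⟩
    · exact Or.inr ⟨div_neg_of_neg_of_pos (sub_neg.2 hmp) hba, rfl, rfl⟩
    · exact absurd rfl hne

theorem eq_of_reMul_eq {φ ψ : ℂ} (h : reMul φ = reMul ψ) : φ = ψ := by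
  have h1 := congrArg (fun L => L 1) h
  have h2 := congrArg (fun L => L Complex.I) h
  simp at h1 h2
  exact Complex.ext h1 h2

theorem HasWeierstrassData.logForm_two_eq {R₀ R₁ : ℝ} {X : ℂ → E3} {φ : Fin 3 → ℂ → ℂ}
    (hW : HasWeierstrassData R₀ R₁ X φ) (h₀ : 0 < R₀) (h₁ : 0 < R₁) {α β : ℝ}
    (hα : ∀ ζ ∈ vstrip (Real.log R₀) (Real.log R₁), X (Complex.exp ζ) 2 = α * ζ.re + β) {ζ : ℂ}
    (hζ : ζ ∈ vstrip (Real.log R₀) (Real.log R₁)) : logForm (φ 2) ζ = α := by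
  have h2 : HasFDerivAt (fun ζ : ℂ => α * ζ.re + β) (reMul (α : ℂ)) ζ := by
    have := (Complex.reCLM.hasFDerivAt (x := ζ)).const_mul α |>.add_const β
    refine this.congr_fderiv ?_
    ext v
    simp
  have h3 := h2.congr_of_eventuallyEq
    (((isOpen_vstrip _ _).eventually_mem hζ).mono fun w hw => hα w hw)
  exact eq_of_reMul_eq ((hW.logForm_deriv h₀ h₁ 2 hζ).unique h3)

/-! ### The length of the level curves -/

namespace HasWeierstrassData

variable {R₀ R₁ : ℝ} {X : ℂ → E3} {φ : Fin 3 → ℂ → ℂ}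

/-- The isotropy of the Weierstrass data, in terms of `P = Φ₀ - iΦ₁` and `Q = Φ₀ + iΦ₁`. -/
theorem mul_eq_neg_sq (hW : HasWeierstrassData R₀ R₁ X φ) (h₀ : 0 < R₀) (h₁ : 0 < R₁) {ζ : ℂ}
    (hζ : ζ ∈ vstrip (Real.log R₀) (Real.log R₁)) :
    (logForm (φ 0) ζ - Complex.I * logForm (φ 1) ζ) *
      (logForm (φ 0) ζ + Complex.I * logForm (φ 1) ζ) = -logForm (φ 2) ζ ^ 2 := by
  linear_combination hW.logForm_isotropic h₀ h₁ hζ - logForm (φ 1) ζ ^ 2 * Complex.I_sq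

/-- The metric in terms of `P` and `Q`: as `|PQ| = |Φ₂|²`, the quantity `(|P| + |Q|)² / 4` is half of
`|Φ₀|² + |Φ₁|² + |Φ₂|²`. -/
theorem norm_imForm_eq (hW : HasWeierstrassData R₀ R₁ X φ) (h₀ : 0 < R₀) (h₁ : 0 < R₁) {ζ : ℂ}
    (hζ : ζ ∈ vstrip (Real.log R₀) (Real.log R₁)) :
    ‖imForm φ ζ‖ = (‖logForm (φ 0) ζ - Complex.I * logForm (φ 1) ζ‖ +
      ‖logForm (φ 0) ζ + Complex.I * logForm (φ 1) ζ‖) / 2 := by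
  have h1 := congrArg norm (hW.mul_eq_neg_sq h₀ h₁ hζ)
  rw [norm_mul, norm_neg, norm_pow] at h1
  obtain ⟨h2, -⟩ := isotropic_norm_sq (hW.logForm_isotropic h₀ h₁ hζ)
  rw [← sq_eq_sq₀ (norm_nonneg _) (by positivity), norm_sq_E3, div_pow, add_sq, mul_assoc, h1]
  simp only [Complex.sq_norm, Complex.normSq_apply, imForm, Complex.sub_re, Complex.sub_im,
    Complex.add_re, Complex.add_im, Complex.mul_re, Complex.mul_im, Complex.I_re, Complex.I_im]
  linear_combination (-1 / 2 : ℝ) * h2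

theorem abs_le_norm_imForm (hW : HasWeierstrassData R₀ R₁ X φ) (h₀ : 0 < R₀) (h₁ : 0 < R₁)
    {α : ℝ} {ζ : ℂ} (hζ : ζ ∈ vstrip (Real.log R₀) (Real.log R₁))
    (hα : logForm (φ 2) ζ = α) : |α| ≤ ‖imForm φ ζ‖ := by
  rw [← hW.norm_reForm h₀ h₁ hζ]
  have := PiLp.norm_apply_le (reForm φ ζ) 2
  simpa [reForm, hα] using this

/-- If the Gauss map has winding number zero, `P = Φ₀ - iΦ₁` has a periodic square root. -/
theorem exists_sqrt_of_winding (hW : HasWeierstrassData R₀ R₁ X φ) (h₀ : 0 < R₀) (h₁ : 0 < R₁)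
    {α : ℝ} (hα0 : α ≠ 0)
    (hα : ∀ ζ ∈ vstrip (Real.log R₀) (Real.log R₁), logForm (φ 2) ζ = α)
    (hwind : HasGaussWinding R₀ R₁ X 0) :
    ∃ G : ℂ → ℂ, DifferentiableOn ℂ G (vstrip (Real.log R₀) (Real.log R₁)) ∧
      (∀ ζ ∈ vstrip (Real.log R₀) (Real.log R₁),
        G ζ ^ 2 = logForm (φ 0) ζ - Complex.I * logForm (φ 1) ζ) ∧
      ∀ ζ ∈ vstrip (Real.log R₀) (Real.log R₁), G (ζ + 2 * Real.pi * Complex.I) = G ζ := by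
  obtain ⟨r, hr, A, hA, hγ, hA0⟩ := hwind
  have hr0 := h₀.trans hr.1
  have ht : Real.log r ∈ Ioo (Real.log R₀) (Real.log R₁) :=
    ⟨Real.log_lt_log h₀ hr.1, Real.log_lt_log hr0 hr.2⟩
  have hαc : (α : ℂ) ≠ 0 := by exact_mod_cast hα0
  -- as `P = α / g`, a branch of the argument of `P` is `arg α - A`
  refine exists_periodic_sqrt (t₀ := Real.log r)
    (p := fun ζ => logForm (φ 0) ζ - Complex.I * logForm (φ 1) ζ)
    (A := fun θ => Complex.arg α - A θ)
    ((hW.logForm_holo h₀ h₁ 0).sub ((hW.logForm_holo h₀ h₁ 1).const_mul _)) (fun ζ hζ h => ?_)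
    (fun ζ => by simp only [logForm_periodic]) ht (continuousOn_const.sub hA) (fun θ hθ => ?_)
    (by simp at hA0; linarith)
  · have h1 := hW.mul_eq_neg_sq h₀ h₁ hζ
    rw [hα ζ hζ, h, zero_mul] at h1
    exact pow_ne_zero 2 hαc (neg_eq_zero.1 h1.symm)
  · obtain ⟨hg0, hg⟩ := hγ θ hθ
    have hmem := logPt_mem_vstrip (θ := θ) |>.2 ht
    have hz := (exp_mem_annulus_iff h₀ h₁).2 hmem
    have hpz : polarPt r θ = Complex.exp (logPt (Real.log r) θ) := by
      rw [← polarPt_exp, Real.exp_log hr0]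
    beta_reduce at hg hg0
    rw [hpz] at hg hg0
    have h1 := hW.gaussMap_mul hz hg0
    set g := gaussMap X (Complex.exp (logPt (Real.log r) θ)) with hgdef
    set ζ := logPt (Real.log r) θ with hζ
    set P := logForm (φ 0) ζ - Complex.I * logForm (φ 1) ζ with hP
    have h2 : g * P = α := by
      rw [← hα ζ hmem, hP]
      simp only [logForm]
      linear_combination Complex.exp ζ * h1
    have h3 : ‖g‖ * ‖P‖ = ‖(α : ℂ)‖ := by rw [← norm_mul, h2]
    have hgn : (‖g‖ : ℂ) ≠ 0 := by simpa using hg0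
    have h4 : (‖P‖ : ℂ) = ‖(α : ℂ)‖ / ‖g‖ := by
      rw [eq_div_iff hgn, mul_comm]
      exact_mod_cast h3
    have h5 : P = α / g := by rw [eq_div_iff hg0, mul_comm, h2]
    have hα2 := Complex.norm_mul_exp_arg_mul_I (α : ℂ)
    show P = _
    rw [h4, h5]
    nth_rewrite 1 [hg, ← hα2]
    push_cast
    rw [sub_mul, Complex.exp_sub]
    field_simp

/-- The length `L(t)` of the image of the circle `|z| = e^t` satisfies `L'' ≥ 2L`, and is at least
the length `2π|α|` of the waist circle of the catenoid with the same flux. With the square roots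
`G` of `P` and `K` of `Q`, one has `L = ½ ∫ |G|² + |K|²`, and the vanishing of the horizontal flux
says `∫ G² = ∫ K² = 0`. -/
theorem exists_length_convex (hW : HasWeierstrassData R₀ R₁ X φ) (h₀ : 0 < R₀) (h₁ : 0 < R₁)
    {α : ℝ} (hα0 : α ≠ 0)
    (hα : ∀ ζ ∈ vstrip (Real.log R₀) (Real.log R₁), logForm (φ 2) ζ = α)
    (hwind : HasGaussWinding R₀ R₁ X 0) {F₃ : ℝ} (hflux : HasFlux R₀ R₁ X !₂[0, 0, F₃]) :
    ∃ L' L'' : ℝ → ℝ,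
      (∀ t ∈ Ioo (Real.log R₀) (Real.log R₁), HasDerivAt
        (fun t => ∫ θ in (0 : ℝ)..(2 * Real.pi), ‖imForm φ (logPt t θ)‖) (L' t) t) ∧
      (∀ t ∈ Ioo (Real.log R₀) (Real.log R₁), HasDerivAt L' (L'' t) t) ∧
      (∀ t ∈ Ioo (Real.log R₀) (Real.log R₁),
        2 * (∫ θ in (0 : ℝ)..(2 * Real.pi), ‖imForm φ (logPt t θ)‖) ≤ L'' t) ∧
      ∀ t ∈ Ioo (Real.log R₀) (Real.log R₁),
        2 * Real.pi * |α| ≤ ∫ θ in (0 : ℝ)..(2 * Real.pi), ‖imForm φ (logPt t θ)‖ := by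
  obtain ⟨G, hG, hG2, hGper⟩ := hW.exists_sqrt_of_winding h₀ h₁ hα0 hα hwind
  have hαc : (α : ℂ) ≠ 0 := by exact_mod_cast hα0
  have hper0 := fun {t} => hW.integral_logForm h₀ h₁ hflux 0 (t := t)
  have hper1 := fun {t} => hW.integral_logForm h₀ h₁ hflux 1 (t := t)
  have hmul := fun {ζ} => hW.mul_eq_neg_sq h₀ h₁ (ζ := ζ)
  have hnormim := fun {ζ} => hW.norm_imForm_eq h₀ h₁ (ζ := ζ)
  have hle := fun {ζ} => hW.abs_le_norm_imForm h₀ h₁ (α := α) (ζ := ζ)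
  have hc0 := (hW.logForm_holo h₀ h₁ 0).continuousOn.comp_logPt
  have hc1 := (hW.logForm_holo h₀ h₁ 1).continuousOn.comp_logPt
  have hcim := (hW.continuousOn_imForm h₀ h₁).comp_logPt
  set a := Real.log R₀
  set b := Real.log R₁
  have hGne : ∀ ζ ∈ vstrip a b, G ζ ≠ 0 := by
    intro ζ hζ h
    have h1 := hmul hζ
    rw [← hG2 ζ hζ, h, hα ζ hζ] at h1
    apply pow_ne_zero 2 hαc
    linear_combination h1
  set K : ℂ → ℂ := fun ζ => Complex.I * α / G ζ with hK
  have hKd : DifferentiableOn ℂ K (vstrip a b) := (differentiableOn_const _).div hG hGne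
  have hK2 : ∀ ζ ∈ vstrip a b, K ζ ^ 2 = logForm (φ 0) ζ + Complex.I * logForm (φ 1) ζ := by
    intro ζ hζ
    have h1 := hmul hζ
    rw [← hG2 ζ hζ, hα ζ hζ] at h1
    rw [hK]
    simp only
    rw [div_pow, div_eq_iff (pow_ne_zero 2 (hGne ζ hζ)), mul_pow, Complex.I_sq]
    linear_combination -h1
  have hKper : ∀ ζ ∈ vstrip a b, K (ζ + 2 * Real.pi * Complex.I) = K ζ := fun ζ hζ => by
    simp only [hK, hGper ζ hζ]
  have hs0 : ∀ t ∈ Ioo a b, Continuous fun θ => logForm (φ 0) (logPt t θ) := fun t ht =>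
    continuous_slice (F := fun t θ => logForm (φ 0) (logPt t θ)) hc0 ht
  have hs1 : ∀ t ∈ Ioo a b, Continuous fun θ => logForm (φ 1) (logPt t θ) := fun t ht =>
    continuous_slice (F := fun t θ => logForm (φ 1) (logPt t θ)) hc1 ht
  have hs1' : ∀ t ∈ Ioo a b, Continuous fun θ => Complex.I * logForm (φ 1) (logPt t θ) :=
    fun t ht => continuous_const.mul (hs1 t ht)
  have hGsq : ∀ t ∈ Ioo a b, ∫ θ in (0 : ℝ)..(2 * Real.pi), G (logPt t θ) ^ 2 = 0 := by
    intro t ht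
    simp_rw [fun θ => hG2 _ (logPt_mem_vstrip (θ := θ) |>.2 ht)]
    rw [intervalIntegral.integral_sub ((hs0 t ht).intervalIntegrable _ _)
      ((hs1' t ht).intervalIntegrable _ _),
      intervalIntegral.integral_const_mul, hper0 ht, hper1 ht]
    simp
  have hKsq : ∀ t ∈ Ioo a b, ∫ θ in (0 : ℝ)..(2 * Real.pi), K (logPt t θ) ^ 2 = 0 := by
    intro t ht
    simp_rw [fun θ => hK2 _ (logPt_mem_vstrip (θ := θ) |>.2 ht)]
    rw [intervalIntegral.integral_add ((hs0 t ht).intervalIntegrable _ _)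
      ((hs1' t ht).intervalIntegrable _ _),
      intervalIntegral.integral_const_mul, hper0 ht, hper1 ht]
    simp
  obtain ⟨I', I'', hI', hI'', hI⟩ := exists_hasDerivAt_integral_norm_sq hG hGper hGsq
  obtain ⟨J', J'', hJ', hJ'', hJ⟩ := exists_hasDerivAt_integral_norm_sq hKd hKper hKsq
  have hL : ∀ t ∈ Ioo a b, ∫ θ in (0 : ℝ)..(2 * Real.pi), ‖imForm φ (logPt t θ)‖ =
      ((∫ θ in (0 : ℝ)..(2 * Real.pi), ‖G (logPt t θ)‖ ^ 2) +
        ∫ θ in (0 : ℝ)..(2 * Real.pi), ‖K (logPt t θ)‖ ^ 2) / 2 := by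
    intro t ht
    have hsG : Continuous fun θ => G (logPt t θ) :=
      continuous_slice (F := fun t θ => G (logPt t θ)) hG.continuousOn.comp_logPt ht
    have hsK : Continuous fun θ => K (logPt t θ) :=
      continuous_slice (F := fun t θ => K (logPt t θ)) hKd.continuousOn.comp_logPt ht
    have hsG2 : Continuous fun θ => ‖G (logPt t θ)‖ ^ 2 := hsG.norm.pow 2
    have hsK2 : Continuous fun θ => ‖K (logPt t θ)‖ ^ 2 := hsK.norm.pow 2
    rw [← intervalIntegral.integral_add (hsG2.intervalIntegrable _ _)
      (hsK2.intervalIntegrable _ _), ← intervalIntegral.integral_div]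
    refine intervalIntegral.integral_congr fun θ _ => ?_
    have hm := logPt_mem_vstrip (θ := θ) |>.2 ht
    rw [hnormim hm, ← hG2 _ hm, ← hK2 _ hm, norm_pow, norm_pow]
  refine ⟨fun t => (I' t + J' t) / 2, fun t => (I'' t + J'' t) / 2, fun t ht => ?_, fun t ht => ?_,
    fun t ht => ?_, fun t ht => ?_⟩
  · refine (((hI' t ht).add (hJ' t ht)).div_const 2).congr_of_eventuallyEq ?_
    exact (isOpen_Ioo.eventually_mem ht).mono hL
  · exact ((hI'' t ht).add (hJ'' t ht)).div_const 2
  · rw [hL t ht]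
    linarith [hI t ht, hJ t ht]
  · have hs : Continuous fun θ => ‖imForm φ (logPt t θ)‖ :=
      (continuous_slice (F := fun t θ => imForm φ (logPt t θ)) hcim ht).norm
    have h1 : ∫ θ in (0 : ℝ)..(2 * Real.pi), |α| ≤
        ∫ θ in (0 : ℝ)..(2 * Real.pi), ‖imForm φ (logPt t θ)‖ :=
      intervalIntegral.integral_mono_on (by positivity) (by simp) (hs.intervalIntegrable _ _)
        fun θ _ => hle (logPt_mem_vstrip.2 ht) (hα _ (logPt_mem_vstrip.2 ht))
    simpa using h1

end HasWeierstrassData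

/-! ### Catenoids -/

/-- The primitive `(s + sinh s cosh s) / 2` of `cosh²`. -/
noncomputable def coshSqPrim (s : ℝ) : ℝ := (s + Real.sinh s * Real.cosh s) / 2

theorem hasDerivAt_coshSqPrim (s : ℝ) : HasDerivAt coshSqPrim (Real.cosh s ^ 2) s := by
  refine (((hasDerivAt_id s).add
    ((Real.hasDerivAt_sinh s).mul (Real.hasDerivAt_cosh s))).div_const 2).congr_deriv ?_
  linear_combination (-1 / 2 : ℝ) * Real.cosh_sq s

theorem coshSqPrim_neg (s : ℝ) : coshSqPrim (-s) = -coshSqPrim s := by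
  simp only [coshSqPrim, Real.sinh_neg, Real.cosh_neg]
  ring

theorem lintegral_cosh_sq {a b : ℝ} (hab : a ≤ b) (m t₀ : ℝ) :
    ∫⁻ t in Ioo a b, ENNReal.ofReal (2 * Real.pi * m ^ 2 * Real.cosh (t - t₀) ^ 2) =
      ENNReal.ofReal (2 * Real.pi * m ^ 2 * (coshSqPrim (b - t₀) - coshSqPrim (a - t₀))) := by
  have hcont : Continuous fun t => 2 * Real.pi * m ^ 2 * Real.cosh (t - t₀) ^ 2 := by fun_prop
  rw [restrict_Ioo_eq_restrict_Ioc, ← ofReal_integral_eq_lintegral_ofReal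
    ((hcont.intervalIntegrable a b).1) (Eventually.of_forall fun t => by positivity),
    ← intervalIntegral.integral_of_le hab,
    intervalIntegral.integral_eq_sub_of_hasDerivAt
      (f := fun t => 2 * Real.pi * m ^ 2 * coshSqPrim (t - t₀)) (fun t _ => ?_)
      (hcont.intervalIntegrable _ _)]
  · rw [mul_sub]
  · have h := (hasDerivAt_coshSqPrim (t - t₀)).comp t ((hasDerivAt_id t).sub_const t₀)
    simpa [Function.comp_def] using h.const_mul (2 * Real.pi * m ^ 2)

/-- The Weierstrass data `c(1 - z⁻²)/2`, `-ic(1 + z⁻²)/2`, `c/z` of the catenoid. -/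
noncomputable def catenoidData (c : ℝ) : Fin 3 → ℂ → ℂ :=
  ![fun z => c / 2 * (1 - (z ^ 2)⁻¹), fun z => -Complex.I * (c / 2) * (1 + (z ^ 2)⁻¹),
    fun z => c / z]

theorem cosh_log_norm_div {z : ℂ} (hz : z ≠ 0) (x : ℝ) :
    Real.cosh (Real.log ‖z‖) * (x / ‖z‖) = (x + x / Complex.normSq z) / 2 := by
  have hn := norm_pos_iff.2 hz
  rw [Real.cosh_eq, Real.exp_neg, Real.exp_log hn, Complex.normSq_eq_norm_sq]
  field_simp

theorem hasDerivAt_log_norm {z : ℂ} (hz : z ≠ 0) :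
    HasFDerivAt (fun w : ℂ => Real.log ‖w‖) (reMul z⁻¹) z := by
  -- near `z`, the principal branch gives `log ‖w‖ = Re (log (w / z)) + log ‖z‖`
  have h1 : HasDerivAt (fun w : ℂ => Complex.log (w / z)) z⁻¹ z := by
    have := ((hasDerivAt_id z).div_const z).clog (by simp [hz])
    simpa [hz] using this
  have h2 := (Complex.reCLM.hasFDerivAt.comp z (h1.hasFDerivAt.restrictScalars ℝ)).add_const
    (Real.log ‖z‖)
  refine (h2.congr_of_eventuallyEq ?_).congr_fderiv ?_
  · filter_upwards [isOpen_ne.mem_nhds hz] with w hw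
    have hw' : ‖w‖ ≠ 0 := norm_ne_zero_iff.2 hw
    have hz' : ‖z‖ ≠ 0 := norm_ne_zero_iff.2 hz
    simp [Complex.log_re, Real.log_div hw' hz']
  · ext v
    simp [mul_comm]

theorem hasWeierstrassData_catenoid (p q c h : ℝ) {R₀ : ℝ} (h₀ : 0 < R₀) (R₁ : ℝ) :
    HasWeierstrassData R₀ R₁ (catenoid p q c h) (catenoidData c) := by
  have hne : ∀ z ∈ annulus R₀ R₁, z ≠ 0 := fun z hz => norm_pos_iff.1 (h₀.trans hz.1)
  have hinv : ∀ z : ℂ, z ≠ 0 → HasDerivAt (fun w : ℂ => w⁻¹) (-(z ^ 2)⁻¹) z := fun z hz =>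
    hasDerivAt_inv hz
  refine ⟨fun k => ?_, fun k z hz => ?_, fun z hz => ?_⟩
  · have hd : DifferentiableOn ℂ (fun z : ℂ => (z ^ 2)⁻¹) (annulus R₀ R₁) :=
      (differentiable_id.pow 2).differentiableOn.inv fun z hz => pow_ne_zero 2 (hne z hz)
    fin_cases k
    · exact ((differentiableOn_const _).sub hd).const_mul _
    · exact ((differentiableOn_const _).add hd).const_mul _
    · exact (differentiableOn_const _).div differentiableOn_id hne
  · have hz0 := hne z hz
    have hnear : ∀ᶠ w in 𝓝 z, w ≠ 0 := isOpen_ne.mem_nhds hz0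
    fin_cases k
    · have h1 := (((hasDerivAt_id z).add (hinv z hz0)).const_mul (c / 2 : ℂ))
      have h2 := (Complex.reCLM.hasFDerivAt.comp z (h1.hasFDerivAt.restrictScalars ℝ)).const_add p
      refine (h2.congr_of_eventuallyEq ?_).congr_fderiv ?_
      · filter_upwards [hnear] with w hw
        simp [catenoid, mul_assoc, cosh_log_norm_div hw, Complex.inv_re]
        ring
      · ext v
        simp [catenoidData]
        ring
    · have h1 := (((hasDerivAt_id z).sub (hinv z hz0)).const_mul (-Complex.I * (c / 2) : ℂ))
      have h2 := (Complex.reCLM.hasFDerivAt.comp z (h1.hasFDerivAt.restrictScalars ℝ)).const_add q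
      refine (h2.congr_of_eventuallyEq ?_).congr_fderiv ?_
      · filter_upwards [hnear] with w hw
        simp [catenoid, mul_assoc, cosh_log_norm_div hw, Complex.inv_im]
        ring
      · ext v
        simp [catenoidData]
        ring
    · refine (((hasDerivAt_log_norm hz0).const_mul c).const_add h).congr_fderiv ?_
      ext v
      simp [catenoidData, div_eq_mul_inv]
      ring
  · have hz0 := hne z hz
    simp only [catenoidData, Matrix.cons_val_zero, Matrix.cons_val_one, Matrix.cons_val]
    field_simp
    rw [Complex.I_sq]
    ring

theorem logForm_catenoidData_two (c : ℝ) (ζ : ℂ) : logForm (catenoidData c 2) ζ = c := by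
  simp only [logForm, catenoidData, Matrix.cons_val]
  field_simp [Complex.exp_ne_zero]

/-- The conformal factor of the catenoid in logarithmic coordinates; here `P = -c e^(-ζ)` and
`Q = c e^ζ`. -/
theorem norm_imForm_catenoidData {c : ℝ} (hc : 0 < c) (t θ : ℝ) :
    ‖imForm (catenoidData c) (logPt t θ)‖ = c * Real.cosh t := by
  have hW := hasWeierstrassData_catenoid 0 0 c 0 (Real.exp_pos (t - 1)) (Real.exp (t + 1))
  have hmem : logPt t θ ∈ vstrip (Real.log (Real.exp (t - 1))) (Real.log (Real.exp (t + 1))) := by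
    rw [logPt_mem_vstrip, Real.log_exp, Real.log_exp]
    constructor <;> linarith
  have hE := Complex.exp_ne_zero (logPt t θ)
  rw [hW.norm_imForm_eq (Real.exp_pos _) (Real.exp_pos _) hmem]
  have hP : logForm (catenoidData c 0) (logPt t θ) - Complex.I *
      logForm (catenoidData c 1) (logPt t θ) = -c * (Complex.exp (logPt t θ))⁻¹ := by
    simp only [logForm, catenoidData, Matrix.cons_val_zero, Matrix.cons_val_one]
    field_simp
    rw [Complex.I_sq]
    ring
  have hQ : logForm (catenoidData c 0) (logPt t θ) + Complex.I *
      logForm (catenoidData c 1) (logPt t θ) = c * Complex.exp (logPt t θ) := by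
    simp only [logForm, catenoidData, Matrix.cons_val_zero, Matrix.cons_val_one]
    field_simp
    rw [Complex.I_sq]
    ring
  rw [hP, hQ, norm_mul, norm_mul, norm_neg, norm_inv, norm_exp_logPt, Complex.norm_real,
    Real.norm_of_nonneg hc.le, ← Real.exp_neg, Real.cosh_eq]
  ring

theorem catenoidWaistArea_eq {hm hp : ℝ} (hmp : hm < hp) (p q : ℝ) {c : ℝ} (hc : 0 < c) (h₀ : ℝ) :
    catenoidWaistArea hm hp p q c h₀ = ENNReal.ofReal
      (2 * Real.pi * c ^ 2 * (coshSqPrim ((hp - h₀) / c) - coshSqPrim ((hm - h₀) / c))) := by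
  have hle : (hm - h₀) / c ≤ (hp - h₀) / c := by gcongr
  have hW := hasWeierstrassData_catenoid p q c h₀ (Real.exp_pos ((hm - h₀) / c))
    (Real.exp ((hp - h₀) / c))
  rw [catenoidWaistArea, catenoidRadius, catenoidRadius,
    hW.surfaceArea_eq (Real.exp_pos _) (Real.exp_pos _), Real.log_exp, Real.log_exp]
  have h := lintegral_cosh_sq hle c 0
  simp only [sub_zero] at h
  rw [← h]
  refine lintegral_congr fun t => ?_
  simp only [← ofReal_norm, norm_imForm_catenoidData hc]
  rw [setLIntegral_const, Real.volume_Ioc, ← ENNReal.ofReal_pow (by positivity),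
    ← ENNReal.ofReal_mul (by positivity)]
  congr 1
  ring

theorem eq_of_hasFlux_catenoid {hm hp : ℝ} (hmp : hm < hp) {p q c : ℝ} (hc : 0 < c) {h₀ F : ℝ}
    (hF : HasFlux (catenoidRadius c h₀ hm) (catenoidRadius c h₀ hp) (catenoid p q c h₀)
      !₂[0, 0, F]) : 2 * Real.pi * c = F := by
  have hlt : (hm - h₀) / c < (hp - h₀) / c := by gcongr
  have hW := hasWeierstrassData_catenoid p q c h₀ (Real.exp_pos ((hm - h₀) / c))
    (Real.exp ((hp - h₀) / c))
  obtain ⟨t, ht⟩ := exists_between hlt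
  have h := hW.integral_logForm (Real.exp_pos _) (Real.exp_pos _) hF 2 (t := t)
    (by rwa [Real.log_exp, Real.log_exp])
  simp only [logForm_catenoidData_two] at h
  rw [intervalIntegral.integral_const] at h
  simp at h
  apply Complex.ofReal_injective
  push_cast
  exact h

/-- Tangency of the rays from the center means that the half-height `T`, in units of the waist
radius, solves `T sinh T = cosh T`. -/
theorem IsMaxSymMarginallyStable.mul_sinh_eq_cosh {hm hp p q c : ℝ}
    (h : IsMaxSymMarginallyStable hm hp p q c) :
    (hp - hm) / (2 * c) * Real.sinh ((hp - hm) / (2 * c)) =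
      Real.cosh ((hp - hm) / (2 * c)) := by
  obtain ⟨hc, h⟩ := h
  set T := (hp - hm) / (2 * c) with hT
  set m := (hm + hp) / 2 with hm'
  have hcT : c * T = (hp - hm) / 2 := by rw [hT]; field_simp
  have hE := Real.exp_pos T
  have hnorm : ‖(Real.exp T : ℂ)‖ = Real.exp T := by
    rw [Complex.norm_real, Real.norm_of_nonneg hE.le]
  have h2 : catenoid p q c m (Real.exp T) 2 = hp := by
    simp only [catenoid, hnorm, Real.log_exp, hcT, hm']
    simp
    ring
  -- tangency at one point of the upper boundary circle is all that is needed
  obtain ⟨v, hv⟩ := h (Real.exp T) (Or.inr h2)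
  have hW := hasWeierstrassData_catenoid p q c m (R₀ := Real.exp T / 2) (by positivity)
    (2 * Real.exp T)
  have hmem : (Real.exp T : ℂ) ∈ annulus (Real.exp T / 2) (2 * Real.exp T) := by
    simp only [annulus, mem_ofPred_eq, hnorm]
    constructor <;> linarith
  have hv0 := hW.fderiv_apply hmem v 0
  have hv2 := hW.fderiv_apply hmem v 2
  rw [hv] at hv0 hv2
  have e2 : catenoidData c 2 (Real.exp T) * v = ((c / Real.exp T : ℝ) : ℂ) * v := by
    simp [catenoidData]
  have e0 : catenoidData c 0 (Real.exp T) * v =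
      ((c / 2 * (1 - (Real.exp T ^ 2)⁻¹) : ℝ) : ℂ) * v := by
    simp [catenoidData]
  rw [e2, Complex.re_ofReal_mul] at hv2
  rw [e0, Complex.re_ofReal_mul] at hv0
  simp only [catenoid, PiLp.sub_apply, hnorm, Real.log_exp, Complex.ofReal_re] at hv0 hv2
  simp at hv0 hv2
  have hv2' : v.re = T * Real.exp T := by
    field_simp at hv2
    linarith
  rw [hv2'] at hv0
  rw [Real.sinh_eq, Real.exp_neg]
  field_simp at hv0 ⊢
  linarith

/-- The quotient `(s + sinh s cosh s)/s²`, which up to a factor is the area of the symmetric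
catenoid piece of logarithmic half-width `s` in a fixed slab, is smallest where
`s sinh s = cosh s`. -/
theorem coshSqPrim_div_sq_le {T : ℝ} (hT : 0 < T) (hTs : T * Real.sinh T = Real.cosh T) {S : ℝ}
    (hS : 0 < S) : coshSqPrim T / T ^ 2 ≤ coshSqPrim S / S ^ 2 := by
  have hder : ∀ s ∈ Ioi (0 : ℝ), HasDerivAt (fun s => coshSqPrim s / s ^ 2)
      (Real.sinh s * (s * Real.sinh s - Real.cosh s) / s ^ 3) s := by
    intro s hs
    have hs0 : s ≠ 0 := ne_of_gt hs
    refine ((hasDerivAt_coshSqPrim s).div (hasDerivAt_pow 2 s) (pow_ne_zero 2 hs0)).congr_deriv ?_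
    rw [coshSqPrim, div_eq_div_iff (by positivity) (by positivity), Real.cosh_sq]
    ring
  -- the sign of the derivative is that of the increasing function `s sinh s - cosh s`
  have hw : StrictMonoOn (fun s => s * Real.sinh s - Real.cosh s) (Ici 0) := by
    refine strictMonoOn_of_deriv_pos (convex_Ici 0) (by fun_prop) fun s hs => ?_
    rw [interior_Ici] at hs
    have : HasDerivAt (fun s => s * Real.sinh s - Real.cosh s) (s * Real.cosh s) s := by
      refine (((hasDerivAt_id s).mul (Real.hasDerivAt_sinh s)).sub
        (Real.hasDerivAt_cosh s)).congr_deriv ?_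
      simp
    rw [this.deriv]
    exact mul_pos hs (Real.cosh_pos s)
  have hT0 : T * Real.sinh T - Real.cosh T = 0 := by rw [hTs, sub_self]
  rcases le_total S T with h | h
  · refine antitoneOn_of_deriv_nonpos (f := fun s => coshSqPrim s / s ^ 2) (convex_Icc S T)
      (fun s hs => (hder s (hS.trans_le hs.1)).continuousAt.continuousWithinAt)
      (fun s hs => ?_) (fun s hs => ?_) (left_mem_Icc.2 h) (right_mem_Icc.2 h) h
    all_goals rw [interior_Icc] at hs; have hs0 : 0 < s := hS.trans hs.1
    · exact (hder s hs0).differentiableAt.differentiableWithinAt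
    · rw [(hder s hs0).deriv]
      have := hw hs0.le hT.le hs.2
      simp only [hT0] at this
      exact div_nonpos_of_nonpos_of_nonneg
        (mul_nonpos_of_nonneg_of_nonpos (Real.sinh_nonneg_iff.2 hs0.le) this.le) (by positivity)
  · refine monotoneOn_of_deriv_nonneg (f := fun s => coshSqPrim s / s ^ 2) (convex_Icc T S)
      (fun s hs => (hder s (hT.trans_le hs.1)).continuousAt.continuousWithinAt)
      (fun s hs => ?_) (fun s hs => ?_) (left_mem_Icc.2 h) (right_mem_Icc.2 h) h
    all_goals rw [interior_Icc] at hs; have hs0 : 0 < s := hT.trans hs.1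
    · exact (hder s hs0).differentiableAt.differentiableWithinAt
    · rw [(hder s hs0).deriv]
      have := hw hT.le hs0.le hs.1
      simp only [hT0] at this
      exact div_nonneg (mul_nonneg (Real.sinh_nonneg_iff.2 hs0.le) this.le) (by positivity)

/-- Among the intervals of length `2S`, the centered one has the smallest integral of `cosh²`. -/
theorem two_mul_coshSqPrim_le {S : ℝ} (hS : 0 ≤ S) (d : ℝ) :
    2 * coshSqPrim S ≤ coshSqPrim (S + d) - coshSqPrim (-S + d) := by
  have key : ∀ x y : ℝ, Real.sinh (x + y) * Real.cosh (x - y) =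
      Real.sinh x * Real.cosh x + Real.sinh y * Real.cosh y := fun x y => by
    rw [Real.sinh_add, Real.cosh_sub]
    linear_combination Real.sinh y * Real.cosh y * Real.cosh_sq x +
      Real.sinh x * Real.cosh x * Real.cosh_sq y
  have h : coshSqPrim (S + d) - coshSqPrim (-S + d) =
      S + Real.sinh (2 * S) * Real.cosh (2 * d) / 2 := by
    rw [show 2 * S = (S + d) + (S - d) by ring, show 2 * d = (S + d) - (S - d) by ring,
      show -S + d = -(S - d) by ring, coshSqPrim_neg, key, coshSqPrim, coshSqPrim]
    ring
  have h0 : 2 * coshSqPrim S = S + Real.sinh (2 * S) / 2 := by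
    rw [Real.sinh_two_mul, coshSqPrim]
    ring
  rw [h, h0]
  have := mul_le_mul_of_nonneg_left (Real.one_le_cosh (2 * d))
    (Real.sinh_nonneg_iff.2 (show 0 ≤ 2 * S by linarith))
  linarith

/-! ### Area and level lengths of a minimal annulus -/

theorem monotoneOn_of_hasDerivAt_nonneg {x y : ℝ} {f f' : ℝ → ℝ}
    (hf : ∀ t ∈ Ioo x y, HasDerivAt f (f' t) t) (h : ∀ t ∈ Ioo x y, 0 ≤ f' t) :
    MonotoneOn f (Ioo x y) :=
  monotoneOn_of_hasDerivWithinAt_nonneg (convex_Ioo x y)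
    (fun t ht => (hf t ht).continuousAt.continuousWithinAt)
    (fun t ht => (hf t (interior_subset ht)).hasDerivWithinAt)
    fun t ht => h t (interior_subset ht)

/-- A convex function whose lower limit at the left end is its infimum is nondecreasing. -/
theorem deriv_nonneg_of_eventually_le {x y : ℝ} {f f' f'' : ℝ → ℝ}
    (hf : ∀ t ∈ Ioo x y, HasDerivAt f (f' t) t) (hf' : ∀ t ∈ Ioo x y, HasDerivAt f' (f'' t) t)
    (hc : ∀ t ∈ Ioo x y, 0 ≤ f'' t)
    (hinf : ∀ c, (∀ᶠ s in 𝓝[>] x, c ≤ f s) → ∀ t ∈ Ioo x y, c ≤ f t) :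
    ∀ t ∈ Ioo x y, 0 ≤ f' t := by
  intro t ht
  by_contra! hneg
  have hmono := monotoneOn_of_hasDerivAt_nonneg hf' hc
  have hanti : StrictAntiOn f (Ioc x t) := by
    have hsub : ∀ {s}, s ∈ Ioc x t → s ∈ Ioo x y := fun hs => ⟨hs.1, hs.2.trans_lt ht.2⟩
    refine strictAntiOn_of_deriv_neg (convex_Ioc x t)
      (fun s hs => (hf s (hsub hs)).continuousAt.continuousWithinAt) fun s hs => ?_
    have hs := interior_subset hs
    rw [(hf s (hsub hs)).deriv]
    exact (hmono (hsub hs) ht hs.2).trans_lt hneg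
  obtain ⟨u, hu⟩ := exists_between ht.1
  have h1 : f t < f u := hanti ⟨hu.1, hu.2.le⟩ ⟨ht.1, le_rfl⟩ hu.2
  refine absurd (hinf (f u) ?_ t ht) (not_le.2 h1)
  filter_upwards [Ioo_mem_nhdsGT hu.1] with s hs
  exact (hanti ⟨hs.1, (hs.2.trans hu.2).le⟩ ⟨hu.1, hu.2.le⟩ hs.2).le

/-- A convex function whose lower limit at the right end is its infimum is nonincreasing. -/
theorem deriv_nonpos_of_eventually_le {x y : ℝ} {f f' f'' : ℝ → ℝ}
    (hf : ∀ t ∈ Ioo x y, HasDerivAt f (f' t) t) (hf' : ∀ t ∈ Ioo x y, HasDerivAt f' (f'' t) t)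
    (hc : ∀ t ∈ Ioo x y, 0 ≤ f'' t)
    (hinf : ∀ c, (∀ᶠ s in 𝓝[<] y, c ≤ f s) → ∀ t ∈ Ioo x y, c ≤ f t) :
    ∀ t ∈ Ioo x y, f' t ≤ 0 := by
  intro t ht
  by_contra! hpos
  have hmono := monotoneOn_of_hasDerivAt_nonneg hf' hc
  have hsmono : StrictMonoOn f (Ico t y) := by
    have hsub : ∀ {s}, s ∈ Ico t y → s ∈ Ioo x y := fun hs => ⟨ht.1.trans_le hs.1, hs.2⟩
    refine strictMonoOn_of_deriv_pos (convex_Ico t y)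
      (fun s hs => (hf s (hsub hs)).continuousAt.continuousWithinAt) fun s hs => ?_
    have hs := interior_subset hs
    rw [(hf s (hsub hs)).deriv]
    exact hpos.trans_le (hmono ht (hsub hs) hs.1)
  obtain ⟨u, hu⟩ := exists_between ht.2
  have h1 : f t < f u := hsmono ⟨le_rfl, ht.2⟩ ⟨hu.1.le, hu.2⟩ hu.1
  refine absurd (hinf (f u) ?_ t ht) (not_le.2 h1)
  filter_upwards [Ioo_mem_nhdsLT hu.2] with s hs
  exact (hsmono ⟨hu.1.le, hu.2⟩ ⟨(hu.1.trans hs.1).le, hs.2⟩ hs.1).le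

namespace HasWeierstrassData

variable {R₀ R₁ : ℝ} {X : ℂ → E3} {φ : Fin 3 → ℂ → ℂ}

theorem continuous_norm_imForm (hW : HasWeierstrassData R₀ R₁ X φ) (h₀ : 0 < R₀) (h₁ : 0 < R₁)
    {t : ℝ} (ht : t ∈ Ioo (Real.log R₀) (Real.log R₁)) :
    Continuous fun θ => ‖imForm φ (logPt t θ)‖ :=
  (continuous_slice (F := fun t θ => imForm φ (logPt t θ))
    (hW.continuousOn_imForm h₀ h₁).comp_logPt ht).norm

/-- If the height is `α log|z| + β`, the level curve at height `αt + β` is the image of the circle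
`|z| = e^t`. -/
theorem levelLength_eq (hW : HasWeierstrassData R₀ R₁ X φ) (h₀ : 0 < R₀) (h₁ : 0 < R₁)
    {α β : ℝ} (hα : α ≠ 0) (hh : ∀ ζ ∈ vstrip (Real.log R₀) (Real.log R₁),
      X (Complex.exp ζ) 2 = α * ζ.re + β)
    {t : ℝ} (ht : t ∈ Ioo (Real.log R₀) (Real.log R₁)) :
    levelLength R₀ R₁ X (α * t + β) =
      ENNReal.ofReal (∫ θ in (0 : ℝ)..(2 * Real.pi), ‖imForm φ (logPt t θ)‖) := by
  have hset : {z | z ∈ annulus R₀ R₁ ∧ X z 2 = α * t + β} =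
      Metric.sphere (0 : ℂ) (Real.exp t) := by
    ext z
    simp only [mem_ofPred_eq, mem_sphere_zero_iff_norm]
    constructor
    · rintro ⟨hz, hX⟩
      have hz0 : z ≠ 0 := norm_pos_iff.1 (h₀.trans hz.1)
      rw [← Complex.exp_log hz0, exp_mem_annulus_iff h₀ h₁] at hz
      have h := hh _ hz
      rw [Complex.exp_log hz0, hX, Complex.log_re, add_left_inj] at h
      rw [mul_left_cancel₀ hα h, Real.exp_log (norm_pos_iff.2 hz0)]
    · intro hz
      have hz0 : z ≠ 0 := norm_pos_iff.1 (hz ▸ Real.exp_pos t)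
      have hre : (Complex.log z).re = t := by rw [Complex.log_re, hz, Real.log_exp]
      have hmem : Complex.log z ∈ vstrip (Real.log R₀) (Real.log R₁) := by
        simp only [vstrip, mem_ofPred_eq, hre]
        exact ht
      refine ⟨?_, ?_⟩
      · rw [← Complex.exp_log hz0]
        exact (exp_mem_annulus_iff h₀ h₁).2 hmem
      · have h := hh _ hmem
        rwa [Complex.exp_log hz0, hre] at h
  have hlen : circleLength X (Real.exp t) =
      ENNReal.ofReal (∫ θ in (0 : ℝ)..(2 * Real.pi), ‖imForm φ (logPt t θ)‖) := by
    rw [hW.circleLength_eq h₀ h₁ ht, intervalIntegral.integral_of_le (by positivity),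
      ofReal_integral_eq_lintegral_ofReal
        (((hW.continuous_norm_imForm h₀ h₁ ht).intervalIntegrable 0 _).1)
        (Eventually.of_forall fun _ => norm_nonneg _)]
    simp only [ofReal_norm]
  rw [levelLength, hset, ← hlen]
  have hmem : (Real.exp t : ℂ) ∈ Metric.sphere (0 : ℂ) (Real.exp t) := by
    rw [mem_sphere_zero_iff_norm, Complex.norm_real, Real.norm_of_nonneg (Real.exp_pos t).le]
  have htr : Real.exp t ∈ Ioo R₀ R₁ :=
    ⟨(Real.log_lt_iff_lt_exp h₀).1 ht.1, (Real.lt_log_iff_exp_lt h₁).1 ht.2⟩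
  refine le_antisymm (iInf₂_le (Real.exp t) ⟨htr, rfl⟩) (le_iInf₂ fun r hr => ?_)
  have hmem2 := hmem
  rw [hr.2, mem_sphere_zero_iff_norm] at hmem2
  rw [mem_sphere_zero_iff_norm, hmem2] at hmem
  rw [hmem]

/-- A lower bound `2π|α| cosh(√2(t - t₀))` on the lengths gives, by the Cauchy–Schwarz inequality
on each circle, more area than the catenoid has, whose circles have length `2π|α| cosh(t - t₀)`. -/
theorem lt_surfaceArea (hW : HasWeierstrassData R₀ R₁ X φ) (h₀ : 0 < R₀) (h₀₁ : R₀ < R₁)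
    {α : ℝ} (hα : α ≠ 0) (t₀ : ℝ)
    (hL : ∀ t ∈ Ioo (Real.log R₀) (Real.log R₁), 2 * Real.pi * |α| *
      Real.cosh (√2 * (t - t₀)) ≤ ∫ θ in (0 : ℝ)..(2 * Real.pi), ‖imForm φ (logPt t θ)‖) :
    ENNReal.ofReal (2 * Real.pi * α ^ 2 *
      (coshSqPrim (Real.log R₁ - t₀) - coshSqPrim (Real.log R₀ - t₀))) < surfaceArea R₀ R₁ X := by
  have h₁ := h₀.trans h₀₁
  have hab := Real.log_lt_log h₀ h₀₁
  have hα2 : 0 < α ^ 2 := by positivity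
  rw [hW.surfaceArea_eq h₀ h₁, ← lintegral_cosh_sq hab.le]
  calc ∫⁻ t in Ioo (Real.log R₀) (Real.log R₁),
        ENNReal.ofReal (2 * Real.pi * α ^ 2 * Real.cosh (t - t₀) ^ 2)
      < ∫⁻ t in Ioo (Real.log R₀) (Real.log R₁),
        ENNReal.ofReal (2 * Real.pi * α ^ 2 * Real.cosh (√2 * (t - t₀)) ^ 2) := by
        refine lintegral_strict_mono ?_ ?_ ?_ ?_
        · rw [Ne, Measure.restrict_eq_zero, Real.volume_Ioo, ENNReal.ofReal_eq_zero]
          linarith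
        · fun_prop
        · rw [lintegral_cosh_sq hab.le]
          exact ENNReal.ofReal_ne_top
        · have hne : ∀ᵐ t ∂(volume.restrict (Ioo (Real.log R₀) (Real.log R₁))), t ≠ t₀ :=
            ae_restrict_of_ae (by simp [ae_iff, measure_singleton])
          filter_upwards [hne] with t ht
          refine (ENNReal.ofReal_lt_ofReal_iff (by positivity)).2 ?_
          have hlt : Real.cosh (t - t₀) < Real.cosh (√2 * (t - t₀)) := by
            rw [Real.cosh_lt_cosh, abs_mul, abs_of_pos (by positivity : 0 < √2)]
            have h2 : 1 < √2 := Real.one_lt_sqrt_two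
            have h3 : 0 < |t - t₀| := abs_pos.2 (sub_ne_zero.2 ht)
            nlinarith
          gcongr
    _ ≤ _ := by
        refine setLIntegral_mono' measurableSet_Ioo fun t ht => ?_
        have hc := hW.continuous_norm_imForm h₀ h₁ ht
        have hc2 : Continuous fun θ => ‖imForm φ (logPt t θ)‖ ^ 2 := hc.pow 2
        have hinner : ∫⁻ θ in Ioc 0 (2 * Real.pi), ‖imForm φ (logPt t θ)‖ₑ ^ 2 =
            ENNReal.ofReal (∫ θ in (0 : ℝ)..(2 * Real.pi), ‖imForm φ (logPt t θ)‖ ^ 2) := by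
          rw [intervalIntegral.integral_of_le (by positivity),
            ofReal_integral_eq_lintegral_ofReal ((hc2.intervalIntegrable 0 _).1)
              (Eventually.of_forall fun _ => by positivity)]
          simp only [← ofReal_norm, ENNReal.ofReal_pow (norm_nonneg _)]
        rw [hinner]
        refine ENNReal.ofReal_le_ofReal ?_
        have hcs := sq_integral_mul_le (x := 0) (y := 2 * Real.pi) (by positivity)
          hc.continuousOn (continuousOn_const (c := (1 : ℝ)))
        simp only [mul_one, one_pow, intervalIntegral.integral_const, sub_zero, smul_eq_mul] at hcs
        have hsq := pow_le_pow_left₀ (by positivity) (hL t ht) 2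
        rw [mul_pow, mul_pow, sq_abs] at hsq
        have hpi : 0 < 2 * Real.pi := by positivity
        refine le_of_mul_le_mul_right ?_ hpi
        calc _ = (2 * Real.pi) ^ 2 * α ^ 2 * Real.cosh (√2 * (t - t₀)) ^ 2 := by ring
          _ ≤ _ := hsq.trans hcs

end HasWeierstrassData

/-- If the level lengths are given by a function `f` of `t` with `f'' ≥ k² f`, the comparison can be
centered at a shortest level: an interior one is a minimum of `f`, and if the lower limit at an end
is the infimum of the lengths, then `f` is monotone. -/
theorem IsShortestLevel.cosh_le {hm hp R₀ R₁ : ℝ} {X : ℂ → E3} {h₀ : ℝ} (hmp : hm < hp)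
    (hs : IsShortestLevel hm hp R₀ R₁ X h₀) {a b α β m k : ℝ} {f f' f'' : ℝ → ℝ}
    (hends : (0 < α ∧ α * a + β = hm ∧ α * b + β = hp) ∨
      (α < 0 ∧ α * a + β = hp ∧ α * b + β = hm))
    (hℓ : ∀ t ∈ Ioo a b, levelLength R₀ R₁ X (α * t + β) = ENNReal.ofReal (f t))
    (hk : 0 ≤ k) (hf : ∀ t ∈ Ioo a b, HasDerivAt f (f' t) t)
    (hf' : ∀ t ∈ Ioo a b, HasDerivAt f' (f'' t) t) (hc : ∀ t ∈ Ioo a b, k ^ 2 * f t ≤ f'' t)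
    (hm0 : 0 ≤ m) (hmf : ∀ t ∈ Ioo a b, m ≤ f t) {t : ℝ} (ht : t ∈ Ioo a b) :
    m * Real.cosh (k * (t - (h₀ - β) / α)) ≤ f t := by
  have hα : α ≠ 0 := by rcases hends with h | h; exacts [h.1.ne', h.1.ne]
  have hf0 : ∀ t ∈ Ioo a b, 0 ≤ f t := fun t ht => hm0.trans (hmf t ht)
  have hc0 : ∀ t ∈ Ioo a b, 0 ≤ f'' t := fun t ht =>
    (mul_nonneg (sq_nonneg k) (hf0 t ht)).trans (hc t ht)
  have hmaps : ∀ t ∈ Ioo a b, α * t + β ∈ Ioo hm hp := by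
    intro t ht
    rcases hends with ⟨h, rfl, rfl⟩ | ⟨h, rfl, rfl⟩
    · exact ⟨by nlinarith [ht.1], by nlinarith [ht.2]⟩
    · exact ⟨by nlinarith [ht.2], by nlinarith [ht.1]⟩
  have hinf : ∀ t ∈ Ioo a b, levelLengthExt hm hp R₀ R₁ X h₀ ≤ ENNReal.ofReal (f t) := by
    intro t ht
    rw [hs.2, ← hℓ t ht]
    exact iInf₂_le _ (hmaps t ht)
  have hcont : Continuous fun h => (h - β) / α := by fun_prop
  have hliminf : ∀ {l l' : Filter ℝ}, Tendsto (fun h => (h - β) / α) l' l →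
      (∀ᶠ t in l, t ∈ Ioo a b) → levelLengthExt hm hp R₀ R₁ X h₀ = liminf (levelLength R₀ R₁ X) l' →
      ∀ c, (∀ᶠ s in l, c ≤ f s) → ∀ t ∈ Ioo a b, c ≤ f t := by
    intro l l' hl hI he c hcf t ht
    refine (ENNReal.ofReal_le_ofReal_iff (hf0 t ht)).1 (le_trans ?_ (he ▸ hinf t ht))
    refine le_liminf_of_le (by isBoundedDefault) ?_
    filter_upwards [hl.eventually hI, hl.eventually hcf] with h h1 h2
    have := hℓ _ h1
    rw [mul_div_cancel₀ _ hα, sub_add_cancel] at this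
    rw [this]
    exact ENNReal.ofReal_le_ofReal h2
  have hab : a < b := ht.1.trans ht.2
  have hIa : ∀ᶠ t in 𝓝[>] a, t ∈ Ioo a b := Ioo_mem_nhdsGT hab
  have hIb : ∀ᶠ t in 𝓝[<] b, t ∈ Ioo a b := Ioo_mem_nhdsLT hab
  -- the change of variable from the height to `t`, which reverses the order if `α < 0`
  have htend : ∀ {h t : ℝ} {s s' : Set ℝ}, α * t + β = h →
      (∀ x ∈ s', (x - β) / α ∈ s) → Tendsto (fun h => (h - β) / α) (𝓝[s'] h) (𝓝[s] t) := by
    intro h t s s' hht hss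
    have e : t = (h - β) / α := by rw [← hht]; field_simp; ring
    rw [e]
    exact tendsto_nhdsWithin_of_tendsto_nhds_of_eventually_within _
      ((hcont.tendsto h).mono_left nhdsWithin_le_nhds) (eventually_nhdsWithin_of_forall hss)
  have hleft : ∀ {h l'}, α * a + β = h → Tendsto (fun h => (h - β) / α) l' (𝓝[>] a) →
      levelLengthExt hm hp R₀ R₁ X h₀ = liminf (levelLength R₀ R₁ X) l' →
      m * Real.cosh (k * (t - (h - β) / α)) ≤ f t := by
    intro h l' he hl hlim
    have e : (h - β) / α = a := by rw [← he]; field_simp; ring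
    rw [e]
    exact cosh_le_of_forall_deriv_nonneg hk hf hf' hc hmf
      (deriv_nonneg_of_eventually_le hf hf' hc0 (hliminf hl hIa hlim)) ht
  have hright : ∀ {h l'}, α * b + β = h → Tendsto (fun h => (h - β) / α) l' (𝓝[<] b) →
      levelLengthExt hm hp R₀ R₁ X h₀ = liminf (levelLength R₀ R₁ X) l' →
      m * Real.cosh (k * (t - (h - β) / α)) ≤ f t := by
    intro h l' he hl hlim
    have e : (h - β) / α = b := by rw [← he]; field_simp; ring
    rw [e]
    exact cosh_le_of_forall_deriv_nonpos hk hf hf' hc hmf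
      (deriv_nonpos_of_eventually_le hf hf' hc0 (hliminf hl hIb hlim)) ht
  rcases eq_or_ne h₀ hm with h | hnm
  · have hext : levelLengthExt hm hp R₀ R₁ X h₀ = liminf (levelLength R₀ R₁ X) (𝓝[>] hm) := by
      rw [levelLengthExt, if_pos h]
    rw [h]
    rcases hends with ⟨h1, h2, h3⟩ | ⟨h1, h2, h3⟩
    · refine hleft h2 (htend h2 fun x hx => ?_) hext
      have hx : hm < x := hx
      rw [mem_Ioi, lt_div_iff₀ h1]
      linarith
    · refine hright h3 (htend h3 fun x hx => ?_) hext
      have hx : hm < x := hx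
      rw [mem_Iio, div_lt_iff_of_neg h1]
      linarith
  rcases eq_or_ne h₀ hp with h | hnp
  · have hext : levelLengthExt hm hp R₀ R₁ X h₀ = liminf (levelLength R₀ R₁ X) (𝓝[<] hp) := by
      rw [levelLengthExt, if_neg hnm, if_pos h]
    rw [h]
    rcases hends with ⟨h1, h2, h3⟩ | ⟨h1, h2, h3⟩
    · refine hright h3 (htend h3 fun x hx => ?_) hext
      have hx : x < hp := hx
      rw [mem_Iio, div_lt_iff₀ h1]
      linarith
    · refine hleft h2 (htend h2 fun x hx => ?_) hext
      have hx : x < hp := hx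
      rw [mem_Ioi, lt_div_iff_of_neg h1]
      linarith
  · have hlt1 : hm < h₀ := lt_of_le_of_ne hs.1.1 hnm.symm
    have hlt2 : h₀ < hp := lt_of_le_of_ne hs.1.2 hnp
    have hmem : (h₀ - β) / α ∈ Ioo a b := by
      rcases hends with ⟨h1, h2, h3⟩ | ⟨h1, h2, h3⟩
      · exact ⟨by rw [lt_div_iff₀ h1]; linarith, by rw [div_lt_iff₀ h1]; linarith⟩
      · exact ⟨by rw [lt_div_iff_of_neg h1]; linarith, by rw [div_lt_iff_of_neg h1]; linarith⟩
    have hval : levelLengthExt hm hp R₀ R₁ X h₀ = ENNReal.ofReal (f ((h₀ - β) / α)) := by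
      rw [levelLengthExt, if_neg hnm, if_neg hnp, ← hℓ _ hmem, mul_div_cancel₀ _ hα,
        sub_add_cancel]
    have hmin : ∀ t ∈ Ioo a b, f ((h₀ - β) / α) ≤ f t := fun t ht =>
      (ENNReal.ofReal_le_ofReal_iff (hf0 t ht)).1 (hval ▸ hinf t ht)
    have hloc : IsLocalMin f ((h₀ - β) / α) := by
      filter_upwards [isOpen_Ioo.mem_nhds hmem] with t ht using hmin t ht
    exact cosh_le_of_deriv_eq_zero hk hf hf' hc hmem (hmf _ hmem)
      (hloc.hasDerivAt_eq_zero (hf _ hmem)) ht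

theorem mainTheorem1 (hm hp : ℝ) (hmp : hm < hp) (R₀ R₁ : ℝ) (X : ℂ → E3)
    (hX : IsMinimalAnnulus hm hp R₀ R₁ X)
    (F₃ : ℝ) (hflux : HasFlux R₀ R₁ X !₂[0, 0, F₃])
    (hwind : HasGaussWinding R₀ R₁ X 0) :
    (∀ h₀ : ℝ, IsShortestLevel hm hp R₀ R₁ X h₀ →
      ∀ p q c : ℝ, 0 < c →
        HasFlux (catenoidRadius c h₀ hm) (catenoidRadius c h₀ hp) (catenoid p q c h₀)
          !₂[0, 0, |F₃|] →
        catenoidWaistArea hm hp p q c h₀ < surfaceArea R₀ R₁ X) ∧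
    (∀ p q c : ℝ, IsMaxSymMarginallyStable hm hp p q c →
      catenoidWaistArea hm hp p q c ((hm + hp) / 2) < surfaceArea R₀ R₁ X) := by
  by_cases harea : surfaceArea R₀ R₁ X = ∞
  · rw [harea]
    refine ⟨fun h₀ _ p q c hc _ => ?_, fun p q c hms => ?_⟩
    · rw [catenoidWaistArea_eq hmp p q hc]
      exact ENNReal.ofReal_lt_top
    · rw [catenoidWaistArea_eq hmp p q hms.1]
      exact ENNReal.ofReal_lt_top
  have h₀ := hX.inner_pos
  have h₁ := h₀.trans hX.inner_lt_outer
  have hab := Real.log_lt_log h₀ hX.inner_lt_outer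
  obtain ⟨φ, hW⟩ : ∃ φ, HasWeierstrassData R₀ R₁ X φ := ⟨_, hX.hasWeierstrassData⟩
  obtain ⟨α, β, hh, hends⟩ := hX.exists_height_eq hmp harea
  have hα : α ≠ 0 := by rcases hends with h | h; exacts [h.1.ne', h.1.ne]
  have hform : ∀ ζ ∈ vstrip (Real.log R₀) (Real.log R₁), logForm (φ 2) ζ = α := fun ζ hζ =>
    hW.logForm_two_eq h₀ h₁ hh hζ
  obtain ⟨L', L'', hL', hL'', hconv, hmin⟩ :=
    hW.exists_length_convex h₀ h₁ hα hform hwind hflux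
  have hconv' : ∀ t ∈ Ioo (Real.log R₀) (Real.log R₁), √2 ^ 2 *
      (∫ θ in (0 : ℝ)..(2 * Real.pi), ‖imForm φ (logPt t θ)‖) ≤ L'' t := by
    rwa [Real.sq_sqrt two_pos.le]
  have hsqrt : 0 ≤ √2 := Real.sqrt_nonneg 2
  refine ⟨fun h hs p q c hc hF => ?_, fun p q c hms => ?_⟩
  · have hFα : 2 * Real.pi * α = F₃ := by
      obtain ⟨t, ht⟩ := exists_between hab
      have h1 := hW.integral_logForm h₀ h₁ hflux 2 ht
      simp_rw [fun θ => hform _ (logPt_mem_vstrip (θ := θ) |>.2 ht)] at h1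
      rw [intervalIntegral.integral_const] at h1
      simp at h1
      apply Complex.ofReal_injective
      push_cast
      exact h1
    have hcα : c = |α| := by
      have h1 := eq_of_hasFlux_catenoid hmp hc hF
      rw [← hFα, abs_mul, abs_of_pos (by positivity : 0 < 2 * Real.pi)] at h1
      exact mul_left_cancel₀ (by positivity) h1
    rw [catenoidWaistArea_eq hmp p q hc]
    have hlt := hW.lt_surfaceArea h₀ hX.inner_lt_outer hα ((h - β) / α) fun t ht =>
      hs.cosh_le hmp hends (fun t ht => hW.levelLength_eq h₀ h₁ hα hh ht) hsqrt hL' hL'' hconv'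
        (by positivity) hmin ht
    convert hlt using 2
    rw [hcα, sq_abs]
    congr 1
    rcases hends with ⟨h1, rfl, rfl⟩ | ⟨h1, rfl, rfl⟩
    · rw [abs_of_pos h1]
      congr 2 <;> field_simp <;> ring
    · -- the annulus is traversed downwards, and `coshSqPrim` is odd
      rw [abs_of_neg h1,
        show (α * Real.log R₀ + β - h) / -α = -(Real.log R₀ - (h - β) / α) by field_simp; ring,
        show (α * Real.log R₁ + β - h) / -α = -(Real.log R₁ - (h - β) / α) by field_simp; ring,
        coshSqPrim_neg, coshSqPrim_neg]
      ring
  · have hc := hms.1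
    obtain ⟨t₀, -, ht₀⟩ := exists_center_cosh_le hab hsqrt hL' hL'' hconv' hmin
    refine lt_of_le_of_lt ?_ (hW.lt_surfaceArea h₀ hX.inner_lt_outer hα t₀ ht₀)
    rw [catenoidWaistArea_eq hmp p q hc]
    refine ENNReal.ofReal_le_ofReal ?_
    set T := (hp - hm) / (2 * c) with hT
    set S := (Real.log R₁ - Real.log R₀) / 2 with hS
    have hT0 : 0 < T := div_pos (by linarith) (by positivity)
    have hS0 : 0 < S := by rw [hS]; linarith
    -- both surfaces span the slab
    have hscale : c ^ 2 * T ^ 2 = α ^ 2 * S ^ 2 := by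
      have h1 : c * T = (hp - hm) / 2 := by rw [hT]; field_simp
      rw [← mul_pow, ← mul_pow, h1, hS]
      rcases hends with ⟨-, h2, h3⟩ | ⟨-, h2, h3⟩
      · rw [← h2, ← h3]; ring
      · rw [← h2, ← h3]; ring
    have hle : c ^ 2 * coshSqPrim T ≤ α ^ 2 * coshSqPrim S := by
      have h1 := mul_le_mul_of_nonneg_left
        (coshSqPrim_div_sq_le hT0 hms.mul_sinh_eq_cosh hS0) (by positivity : 0 ≤ c ^ 2 * T ^ 2)
      nth_rewrite 2 [hscale] at h1
      field_simp at h1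
      linarith
    have hcenter := two_mul_coshSqPrim_le hS0.le ((Real.log R₁ + Real.log R₀) / 2 - t₀)
    rw [show S + ((Real.log R₁ + Real.log R₀) / 2 - t₀) = Real.log R₁ - t₀ by rw [hS]; ring,
      show -S + ((Real.log R₁ + Real.log R₀) / 2 - t₀) = Real.log R₀ - t₀ by rw [hS]; ring]
      at hcenter
    rw [show (hp - (hm + hp) / 2) / c = T by rw [hT]; field_simp; ring,
      show (hm - (hm + hp) / 2) / c = -T by rw [hT]; field_simp; ring, coshSqPrim_neg]
    calc 2 * Real.pi * c ^ 2 * (coshSqPrim T - -coshSqPrim T)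
        = 4 * Real.pi * (c ^ 2 * coshSqPrim T) := by ring
      _ ≤ 4 * Real.pi * (α ^ 2 * coshSqPrim S) := by gcongr
      _ = 2 * Real.pi * α ^ 2 * (2 * coshSqPrim S) := by ring
      _ ≤ _ := by gcongr
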